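/- **Notation.** Let $N\ge 1$, $\omega=e^{2\pi i/N}$, and let $\mathbb{E}$ denote averages. - For $K\subseteq\mathbb{Z}_N$ and a width $w$, the Bohr set $B(K,w)$ is $\{x\in\mathbb{Z}_N:|\omega^{tx}-1|\le w\ \text{for all } t\in K\}$. A Bohr set $B=B(K,w)$ with $w>0$ is regular if for every $\eta>0$ we have $|B(K,w(1+\eta))|\le |B|(1+100|K|\eta)$ and $|B(K,w(1-\eta))|\ge |B|(1-100|K|\eta)$. $B$ has complexity at most $(d,w)$ if $B=B(K,w')$ for some $|K|\le d$ and $w'\ge w$. - A map $q:A\to\mathbb{Z}_N$ with $A\subseteq\mathbb{Z}_N$ is quadratic if $q(x)-q(x+a)-q(x+b)-q(x+c)+q(x+a+b)+q(x+a+c)+q(x+b+c)-q(x+a+b+c)=0$ whenever all eight points lie in $A$. - A quadratic average with base $(B,q)$, where $B$ is a regular Bohr set and $q$ is a quadratic map defined on a set $A\supseteq B$, is a function $Q(x)=\mathbb{E}_{y\in x-B}\,\omega^{q(x-y)+\phi_y(x-y)}$, where each $\phi_y:B\to\mathbb{Z}_N$ is a Freiman homomorphism (of order 2). It is $(\epsilon,m)$-special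 if there is a set $X\subseteq\mathbb{Z}_N$ with $|X|\le m$ such that for all but at most $\epsilon N$ points $x\in\mathbb{Z}_N$ there is $t\in X$ with $x+B\subseteq t+A$ and $Q(z)=\omega^{q(z-t)}$ for all $z\in x+B$. - If $2P-2P\subseteq B$, the rank of such a $Q$ with respect to $P$ is $\log(1/\alpha)$, where $\alpha=|\mathbb{E}_{a,a',b,b'\in P}\,\omega^{q(a+b-a'-b')-q(a-a')-q(b-b')}|$. - A generalized arithmetic progression of dimension $d'$ is a set $\{x_0+\sum_{i=1}^{d'}a_iv_i:0\le a_i<l_i\}$ with integers $l_i\ge1$. The density of $P\subseteq\mathbb{Z}_N$ is $|P|/N$. - $\|f\|_{U^2}^4=\mathbb{E}_{x,a,b}f(x)\overline{f(x+a)f(x+b)}f(x+a+b)$, and $\|f\|_{U^2}^*=\sup\{|\mathbb{E}_xf(x)\overline{g(x)}|:\|g\|_{U^2}\le1\}$. - Linear forms $L_j(x)=\sum_{u=1}^sc_{ju}x_u$ ($c_{ju}\in\mathbb{Z}$) are square independent if the polynomials $L_1^2,\dots,L_r^2$ are linearly independent over $\mathbb{Q}$. **Proposition.** Let $r\ge1$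 and $\epsilon,\theta>0$. For each $j=1,\dots,r$ let $k_j,m_j,d_j'\ge 0$ and $d_j\ge1$ be integers and let $C_j\ge1$, $0<\rho_j\le1$, $\epsilon_j>0$, $T_j$ and $R_j$ be reals. Let $f_j=\sum_{i=1}^{k_j}Q_i^{(j)}U_i^{(j)}$, where $U_i^{(j)}:\mathbb{Z}_N\to\mathbb{C}$ and each $Q_i^{(j)}$ is an $(\epsilon,m_j)$-special quadratic average on $\mathbb{Z}_N$ with base $(B_i^{(j)},q_i^{(j)})$, $B_i^{(j)}$ being of complexity at most $(d_j,\ \epsilon_j\rho_j/(800d_j5^{d_j}))$. Suppose that $P^{(j)}$ is a generalized arithmetic progression of dimension $d_j'\le k_jd_j$ and density $\gamma_j'$ such that $P^{(j)}\subseteq B_i^{(j)}$ and $2P^{(j)}-2P^{(j)}\subseteq B_i^{(j)}$ for every $i\le k_j$, and that each $Q_i^{(j)}$ has rank at least $R_j$ with respect to $P^{(j)}$. Suppose also that $\sum_i\|U_i^{(j)}\|_\infty\le2C_j$ and $\sum_i\|U_i^{(j)}\|_{U^2}^*\le T_j$. Set $C=\max_jC_j$, $T=\max_jT_j$, $R=\min_jR_j$,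 $d=\max_jd_j$, $k=\max_jk_j$, $\gamma'=\min_j\gamma_j'$, $\rho=\min_j\rho_j$, and suppose that $r(2kC)^r\epsilon\le\theta$. Let $L_1,\dots,L_r$ be a square independent system of linear forms in $s$ variables, $L_j(x)=\sum_{u=1}^sc_{ju}x_u$ with $c_{ju}\in\mathbb{Z}$, each of which maps $\mathbb{Z}_N^s$ onto $\mathbb{Z}_N$, and let $M=\max_j\sum_{u=1}^s|c_{ju}|$. Then $$\Bigl|\mathbb{E}_{x\in\mathbb{Z}_N^s}\prod_{j=1}^rf_j(L_j(x))\Bigr|\le5\theta+\chi\,e^{-R/(4r^3)},$$ where $$\chi=\left(\frac{2^{239}r^{59}d^6\,5^{2d}(3kC)^{50r}T^{24}M^4}{\gamma'\epsilon^2\rho^2\theta^{50}}\right)^{2^{53}r^{22}k^2d^4(2kC)^{12r}T^8/\theta^{12}}.$$ -/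

import Mathlib

open scoped BigOperators

noncomputable section

namespace QuadAvg

variable {N : ℕ} [NeZero N]

/-- The Bohr set `B(K, ρ) = {x : |ω^{rx} - 1| ≤ ρ for all r ∈ K}`, where `ω = e^{2πi/N}`
(so that `ZMod.stdAddChar t = ω^t`). -/
def bohr (K : Finset (ZMod N)) (ρ : ℝ) : Finset (ZMod N) :=
  open Classical in
  Finset.univ.filter fun x ↦ ∀ r ∈ K, ‖ZMod.stdAddChar (r * x) - 1‖ ≤ ρ

/-- `B` is a regular Bohr set. -/
def IsRegularBohr (B : Finset (ZMod N)) : Prop :=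
  ∃ (K : Finset (ZMod N)) (ρ : ℝ), 0 < ρ ∧ B = bohr K ρ ∧
    ∀ η : ℝ, 0 < η →
      ((bohr K (ρ * (1 + η))).card : ℝ) ≤ B.card * (1 + 100 * K.card * η) ∧
      (B.card : ℝ) * (1 - 100 * K.card * η) ≤ (bohr K (ρ * (1 - η))).card

/-- The Bohr set `B` has complexity at most `(d, w)`. -/
def ComplexityAtMost (B : Finset (ZMod N)) (d : ℕ) (w : ℝ) : Prop :=
  ∃ (K : Finset (ZMod N)) (ρ : ℝ), K.card ≤ d ∧ w ≤ ρ ∧ B = bohr K ρ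

/-- `q` is an (additive) quadratic homomorphism on `A`: its third differences vanish on every
cube that is contained in `A`. The values of `q` outside `A` are irrelevant. -/
def IsQuadraticOn (A : Set (ZMod N)) (q : ZMod N → ZMod N) : Prop :=
  ∀ x a b c : ZMod N, x ∈ A → x + a ∈ A → x + b ∈ A → x + c ∈ A → x + a + b ∈ A →
    x + a + c ∈ A → x + b + c ∈ A → x + a + b + c ∈ A →
    q x - q (x + a) - q (x + b) - q (x + c) + q (x + a + b) + q (x + a + c) + q (x + b + c)
      - q (x + a + b + c) = 0

/-- `Q` is a quadratic average with base `(B, q)`: `B` is a regular Bohr set, `q` is a quadratic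
map on `B`, and `Q(x) = 𝔼_{y ∈ x - B} ω^{q_y(x)}` with `q_y(x) = q(x - y) + φ_y(x - y)` for
Freiman homomorphisms `φ_y` on `B`. -/
def IsQuadraticAverage (B : Finset (ZMod N)) (q : ZMod N → ZMod N) (Q : ZMod N → ℂ) : Prop :=
  IsRegularBohr B ∧ IsQuadraticOn (B : Set (ZMod N)) q ∧
    ∃ φ : ZMod N → ZMod N → ZMod N,
      (∀ y, IsAddFreimanHom 2 (B : Set (ZMod N)) Set.univ (φ y)) ∧
      ∀ x, Q x = 𝔼 y ∈ B.image (fun b ↦ x - b), ZMod.stdAddChar (q (x - y) + φ y (x - y))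

/-- `Q` is an `(ε, m)`-special quadratic average with base `(B, q)`. Here `A ⊇ B` is the set on
which the quadratic map `q` is defined; a translate `q(· - t)` is then defined on `t + A`, and it
can be compared with `Q` on `x + B` when `x + B ⊆ t + A`. -/
def IsSpecialQuadraticAverage (ε : ℝ) (m : ℕ) (B : Finset (ZMod N)) (q : ZMod N → ZMod N)
    (Q : ZMod N → ℂ) : Prop :=
  IsQuadraticAverage B q Q ∧
    ∃ (A : Set (ZMod N)) (X E : Finset (ZMod N)),
      (B : Set (ZMod N)) ⊆ A ∧ IsQuadraticOn A q ∧ X.card ≤ m ∧ (E.card : ℝ) ≤ ε * N ∧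
      ∀ x ∉ E, ∃ t ∈ X, ∀ b ∈ B,
        x + b - t ∈ A ∧ Q (x + b) = ZMod.stdAddChar (q (x + b - t))

/-- `P` is a (not necessarily proper) generalized arithmetic progression of dimension `d`. -/
def IsGAP (P : Finset (ZMod N)) (d : ℕ) : Prop :=
  ∃ (x₀ : ZMod N) (v : Fin d → ZMod N) (l : Fin d → ℕ), (∀ i, 0 < l i) ∧
    ∀ x, x ∈ P ↔ ∃ a : Fin d → ℕ, (∀ i, a i < l i) ∧ x = x₀ + ∑ i, (a i : ZMod N) * v i

/-- The rank of (a quadratic average with base) `(B, q)` relative to a set `P` with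
`2P - 2P ⊆ B`. -/
def rank (P : Finset (ZMod N)) (q : ZMod N → ZMod N) : ℝ :=
  Real.log (1 / ‖𝔼 a ∈ P, 𝔼 a' ∈ P, 𝔼 b ∈ P, 𝔼 b' ∈ P,
    ZMod.stdAddChar (q (a + b - a' - b') - q (a - a') - q (b - b'))‖)

/-- The `U²` norm of a function on `ℤ/Nℤ` (the average is a nonnegative real number). -/
def u2Norm (f : ZMod N → ℂ) : ℝ :=
  ‖𝔼 x, 𝔼 a, 𝔼 b, f x * starRingEnd ℂ (f (x + a)) * starRingEnd ℂ (f (x + b)) * f (x + a + b)‖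
    ^ (1 / 4 : ℝ)

/-- The dual norm `‖f‖_{U²}^* = sup {|⟨f, g⟩| : ‖g‖_{U²} ≤ 1}`. The supremum is finite since
`‖·‖_{U²}` is a norm on a finite-dimensional space. -/
def u2DualNorm (f : ZMod N → ℂ) : ℝ :=
  sSup {t : ℝ | ∃ g : ZMod N → ℂ, u2Norm g ≤ 1 ∧ t = ‖𝔼 x, f x * starRingEnd ℂ (g x)‖}

/-- The value at `x` of the linear form with integer coefficients `c`. -/
def linForm {s : ℕ} (c : Fin s → ℤ) (x : Fin s → ZMod N) : ZMod N :=
  ∑ u, (c u : ZMod N) * x u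

/-- The linear forms with coefficient vectors `c 0, c 1, …` are square independent: their squares
are linearly independent polynomials. -/
def SquareIndependent {r s : ℕ} (c : Fin r → Fin s → ℤ) : Prop :=
  LinearIndependent ℚ fun j ↦
    (∑ u, MvPolynomial.C (c j u : ℚ) * MvPolynomial.X u : MvPolynomial (Fin s) ℚ) ^ 2

/-- The constant in front of the exponential. -/
def chi (r k d : ℕ) (C T M γ ε ρ θ : ℝ) : ℝ :=
  (2 ^ 239 * (r : ℝ) ^ 59 * (d : ℝ) ^ 6 * 5 ^ (2 * d) * (3 * k * C) ^ (50 * r) * T ^ 24 * M ^ 4 /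
      (γ * ε ^ 2 * ρ ^ 2 * θ ^ 50)) ^
    (2 ^ 53 * (r : ℝ) ^ 22 * (k : ℝ) ^ 2 * (d : ℝ) ^ 4 * (2 * k * C) ^ (12 * r) * T ^ 8 / θ ^ 12)

end QuadAvg

end

/-! Each coefficient function U is replaced, with a small error in L², by a function V whose Fourier
coefficients are summable with an explicit bound (`exists_truncation`). V averages U over
differences of a large set on which the characters of the few large Fourier coefficients of U are
nearly constant; this rests on the U² norm being the ℓ⁴ norm of the Fourier transform. Expanding
each V in characters leaves averages of products of the Q_j(L_j(x)) with linear phases.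

Such an average is localized: x is shifted along coordinate directions u_i and v_i by multiples of
differences from a dense set Y. Outside a set of x of density at most rε every Q_j becomes a single
quadratic phase. The second difference in the i-th pair of shifts is the bilinear form γ_i = Σ_j n_i
c_{j,u_i} c_{j,v_i} β_j with β_j = `polar (q j)`, so two uses of Cauchy–Schwarz bound the fourth
power of the local average by the normalized bias of every γ_i (`norm_sum_pow_four_le`). Square
independence says that the arrays (c_{ju} c_{jv}) are independent, and Cramer's rule gives integers
n_i for which Σ_i γ_i = D β_{j₀} (`SquareIndependent.exists_coefficients`).

The decisive inequality is `prod_bias_le`: up to powers of N, the product of the biases of the γ_i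
is at most the bias of their sum. The 4r-th power of the local average is thus bounded by the bias
of D β_{j₀}, which the rank controls. The set Y comes from shrinking the progressions P_j and
intersecting translates, and all losses are absorbed in `loss_le_chi`. -/

namespace QuadAvg

open Finset

/-! ### Fourier analysis on ℤ/Nℤ, the U² norm and its dual. -/

section Fourier

variable {N : ℕ} [NeZero N]

lemma norm_stdAddChar (t : ZMod N) : ‖ZMod.stdAddChar t‖ = 1 := by
  rw [ZMod.stdAddChar_apply]
  exact Circle.norm_coe _

lemma conj_expect {ι : Type*} (s : Finset ι) (f : ι → ℂ) :
    starRingEnd ℂ (𝔼 i ∈ s, f i) = 𝔼 i ∈ s, starRingEnd ℂ (f i) := by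
  rw [Finset.expect_eq_sum_div_card, Finset.expect_eq_sum_div_card, map_div₀, map_sum, map_natCast]

lemma conj_stdAddChar (t : ZMod N) :
    starRingEnd ℂ (ZMod.stdAddChar t) = ZMod.stdAddChar (-t) := by
  rw [AddChar.map_neg_eq_inv, Complex.inv_eq_conj (norm_stdAddChar t)]

lemma expect_stdAddChar (ξ : ZMod N) :
    𝔼 x : ZMod N, ZMod.stdAddChar (ξ * x) = if ξ = 0 then (1 : ℂ) else 0 := by
  have h := AddChar.sum_mulShift ξ (ZMod.isPrimitive_stdAddChar N)
  rw [Fintype.expect_eq_sum_div_card]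
  simp only [mul_comm ξ]
  rw [h]
  split_ifs <;> simp

/-- The Fourier coefficients of a function on `ℤ/Nℤ`. -/
noncomputable def fourierCoef (f : ZMod N → ℂ) (ξ : ZMod N) : ℂ :=
  𝔼 x, f x * ZMod.stdAddChar (-(ξ * x))

lemma sum_fourierCoef_mul (f : ZMod N → ℂ) (x : ZMod N) :
    ∑ ξ, fourierCoef f ξ * ZMod.stdAddChar (ξ * x) = f x := by
  have h : ∀ y, ∑ ξ : ZMod N, ZMod.stdAddChar (-(ξ * y)) * ZMod.stdAddChar (ξ * x) =
      if y = x then (N : ℂ) else 0 := by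
    intro y
    have := AddChar.sum_mulShift (x - y) (ZMod.isPrimitive_stdAddChar N)
    simp only [← AddChar.map_add_eq_mul]
    rw [show (∑ ξ : ZMod N, (ZMod.stdAddChar (-(ξ * y) + ξ * x) : ℂ)) =
      ∑ ξ : ZMod N, ZMod.stdAddChar (ξ * (x - y)) from
        Finset.sum_congr rfl fun ξ _ ↦ by congr 1; ring, this]
    simp [sub_eq_zero, eq_comm]
  simp only [fourierCoef, Fintype.expect_eq_sum_div_card, div_mul_eq_mul_div, Finset.sum_mul]
  rw [← Finset.sum_div, Finset.sum_comm]
  simp only [mul_assoc, ← Finset.mul_sum, h]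
  simp

lemma expect_mul_conj (f g : ZMod N → ℂ) :
    𝔼 x, f x * starRingEnd ℂ (g x) =
      ∑ ξ, fourierCoef f ξ * starRingEnd ℂ (fourierCoef g ξ) := by
  have : ∀ x, f x * starRingEnd ℂ (g x) =
      ∑ ξ, (f x * ZMod.stdAddChar (-(ξ * x))) * starRingEnd ℂ (fourierCoef g ξ) := by
    intro x
    conv_lhs => rw [← sum_fourierCoef_mul g x]
    rw [map_sum, Finset.mul_sum]
    refine Finset.sum_congr rfl fun ξ _ ↦ ?_
    rw [map_mul, conj_stdAddChar]
    ring
  simp only [this, Finset.expect_sum_comm, fourierCoef, Finset.expect_mul]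

lemma expect_norm_sq (f : ZMod N → ℂ) :
    𝔼 x, ‖f x‖ ^ 2 = ∑ ξ, ‖fourierCoef f ξ‖ ^ 2 := by
  have h := expect_mul_conj f f
  simp only [Complex.mul_conj'] at h
  have h2 : ((𝔼 x, ‖f x‖ ^ 2 : ℝ) : ℂ) = ((∑ ξ, ‖fourierCoef f ξ‖ ^ 2 : ℝ) : ℂ) := by
    rw [Fintype.expect_eq_sum_div_card] at h ⊢
    push_cast at h ⊢
    exact h
  exact_mod_cast h2

lemma fourierCoef_sum (c : ZMod N → ℂ) (ξ : ZMod N) :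
    fourierCoef (fun x ↦ ∑ η, c η * ZMod.stdAddChar (η * x)) ξ = c ξ := by
  have : ∀ η, 𝔼 x : ZMod N, c η * ZMod.stdAddChar (η * x) * ZMod.stdAddChar (-(ξ * x)) =
      if η = ξ then c η else 0 := by
    intro η
    have h := expect_stdAddChar (η - ξ)
    simp only [mul_assoc, ← AddChar.map_add_eq_mul, ← Finset.mul_expect]
    rw [show (𝔼 x : ZMod N, (ZMod.stdAddChar (η * x + -(ξ * x)) : ℂ)) =
      𝔼 x : ZMod N, ZMod.stdAddChar ((η - ξ) * x) from
        Finset.expect_congr rfl fun x _ ↦ by congr 1; ring, h]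
    simp [sub_eq_zero]
  simp only [fourierCoef, Finset.sum_mul, Finset.expect_sum_comm, this]
  simp

lemma fourierCoef_add_right (f : ZMod N → ℂ) (a ξ : ZMod N) :
    fourierCoef (fun x ↦ f (x + a)) ξ = fourierCoef f ξ * ZMod.stdAddChar (ξ * a) := by
  unfold fourierCoef
  rw [Finset.expect_mul]
  refine Fintype.expect_equiv (Equiv.addRight a) _ _ fun x ↦ ?_
  rw [Equiv.coe_addRight, mul_assoc, ← AddChar.map_add_eq_mul]
  congr 2
  ring

/-- The box average is the mean square of the autocorrelation `c` of g. Up to reflection, `c` has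
Fourier coefficients |ĝ(ξ)|², so Parseval gives the fourth powers. -/
lemma u2Norm_pow_four (g : ZMod N → ℂ) : u2Norm g ^ 4 = ∑ ξ, ‖fourierCoef g ξ‖ ^ 4 := by
  have key : (𝔼 x, 𝔼 a, 𝔼 b, g x * starRingEnd ℂ (g (x + a)) * starRingEnd ℂ (g (x + b)) *
      g (x + a + b)) = ((∑ ξ, ‖fourierCoef g ξ‖ ^ 4 : ℝ) : ℂ) := by
    set c : ZMod N → ℂ := fun a ↦ 𝔼 x, g x * starRingEnd ℂ (g (x + a)) with hc
    have hc' : ∀ a, c (-a) =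
        ∑ ξ, ((‖fourierCoef g ξ‖ ^ 2 : ℝ) : ℂ) * ZMod.stdAddChar (ξ * a) := by
      intro a
      rw [hc]
      simp only
      rw [expect_mul_conj g fun x ↦ g (x + -a)]
      refine Finset.sum_congr rfl fun ξ _ ↦ ?_
      rw [fourierCoef_add_right, map_mul, ← mul_assoc, Complex.mul_conj', conj_stdAddChar]
      push_cast
      congr 2
      ring
    have h1 : (𝔼 x, 𝔼 a, 𝔼 b, g x * starRingEnd ℂ (g (x + a)) * starRingEnd ℂ (g (x + b)) *
        g (x + a + b)) = 𝔼 a, c a * starRingEnd ℂ (c a) := by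
      rw [Finset.expect_comm]
      refine Finset.expect_congr rfl fun a _ ↦ ?_
      have : ∀ x, 𝔼 b, g x * starRingEnd ℂ (g (x + a)) * starRingEnd ℂ (g (x + b)) *
          g (x + a + b) = g x * starRingEnd ℂ (g (x + a)) * starRingEnd ℂ (c a) := by
        intro x
        rw [hc]
        simp only
        rw [conj_expect, Finset.mul_expect]
        refine Fintype.expect_equiv (Equiv.addLeft x) _ _ fun b ↦ ?_
        rw [map_mul, Complex.conj_conj, Equiv.coe_addLeft, add_right_comm x a b]
        ring
      simp only [this]
      rw [← Finset.expect_mul]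
    rw [h1]
    have h2 : 𝔼 a, c a * starRingEnd ℂ (c a) = 𝔼 a, c (-a) * starRingEnd ℂ (c (-a)) :=
      Fintype.expect_equiv (Equiv.neg _) _ _ fun a ↦ by simp
    rw [h2, expect_mul_conj (fun a ↦ c (-a))]
    simp only [hc', fourierCoef_sum]
    push_cast
    refine Finset.sum_congr rfl fun ξ _ ↦ ?_
    rw [map_pow, Complex.conj_ofReal]
    ring
  have hnn : 0 ≤ ∑ ξ, ‖fourierCoef g ξ‖ ^ 4 := by positivity
  rw [u2Norm, key, Complex.norm_real, Real.norm_of_nonneg hnn, ← Real.rpow_natCast,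
    ← Real.rpow_mul hnn]
  norm_num

lemma u2Norm_nonneg (g : ZMod N → ℂ) : 0 ≤ u2Norm g := by
  unfold u2Norm; positivity

lemma u2Norm_smul (c : ℂ) (g : ZMod N → ℂ) : u2Norm (fun x ↦ c * g x) = ‖c‖ * u2Norm g := by
  have h : u2Norm (fun x ↦ c * g x) ^ 4 = (‖c‖ * u2Norm g) ^ 4 := by
    rw [mul_pow, u2Norm_pow_four, u2Norm_pow_four, Finset.mul_sum]
    refine Finset.sum_congr rfl fun ξ _ ↦ ?_
    have : fourierCoef (fun x ↦ c * g x) ξ = c * fourierCoef g ξ := by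
      simp only [fourierCoef, mul_assoc, Finset.mul_expect]
    rw [this, norm_mul, mul_pow]
  exact (pow_left_inj₀ (u2Norm_nonneg _) (mul_nonneg (norm_nonneg _) (u2Norm_nonneg _))
    (by norm_num)).1 h

lemma norm_fourierCoef_le_u2Norm (g : ZMod N → ℂ) (ξ : ZMod N) :
    ‖fourierCoef g ξ‖ ≤ u2Norm g := by
  refine le_of_pow_le_pow_left₀ (n := 4) (by norm_num) (u2Norm_nonneg _) ?_
  rw [u2Norm_pow_four]
  exact Finset.single_le_sum (f := fun ξ ↦ ‖fourierCoef g ξ‖ ^ 4) (fun _ _ ↦ by positivity)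
    (Finset.mem_univ ξ)

/-- Without boundedness the real `sSup` would take the default value 0 and the duality inequality
would be lost. -/
lemma bddAbove_u2DualNorm (f : ZMod N → ℂ) :
    BddAbove {t : ℝ | ∃ g : ZMod N → ℂ, u2Norm g ≤ 1 ∧ t = ‖𝔼 x, f x * starRingEnd ℂ (g x)‖} := by
  refine ⟨∑ ξ, ‖fourierCoef f ξ‖, ?_⟩
  rintro t ⟨g, hg, rfl⟩
  rw [expect_mul_conj]
  refine (norm_sum_le _ _).trans (Finset.sum_le_sum fun ξ _ ↦ ?_)
  rw [norm_mul, RCLike.norm_conj]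
  exact mul_le_of_le_one_right (norm_nonneg _) ((norm_fourierCoef_le_u2Norm g ξ).trans hg)

lemma u2DualNorm_nonneg (f : ZMod N → ℂ) : 0 ≤ u2DualNorm f := by
  refine Real.sSup_nonneg ?_
  rintro t ⟨g, -, rfl⟩
  positivity

lemma norm_expect_mul_conj_le (f g : ZMod N → ℂ) :
    ‖𝔼 x, f x * starRingEnd ℂ (g x)‖ ≤ u2DualNorm f * u2Norm g := by
  rcases (u2Norm_nonneg g).eq_or_lt with h0 | hpos
  · have : ∀ ξ, fourierCoef g ξ = 0 := fun ξ ↦ by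
      have := norm_fourierCoef_le_u2Norm g ξ
      rw [← h0] at this
      exact norm_le_zero_iff.1 this
    rw [expect_mul_conj]
    simp [this, ← h0]
  · have hmem : ‖𝔼 x, f x * starRingEnd ℂ ((((u2Norm g)⁻¹ : ℝ) : ℂ) * g x)‖ ≤ u2DualNorm f := by
      refine le_csSup (bddAbove_u2DualNorm f)
        ⟨fun x ↦ (((u2Norm g)⁻¹ : ℝ) : ℂ) * g x, ?_, rfl⟩
      rw [u2Norm_smul, Complex.norm_real, Real.norm_of_nonneg (by positivity)]
      exact (inv_mul_cancel₀ hpos.ne').le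
    have : (𝔼 x, f x * starRingEnd ℂ ((((u2Norm g)⁻¹ : ℝ) : ℂ) * g x)) =
        (((u2Norm g)⁻¹ : ℝ) : ℂ) * 𝔼 x, f x * starRingEnd ℂ (g x) := by
      rw [Finset.mul_expect]
      refine Finset.expect_congr rfl fun x _ ↦ ?_
      rw [map_mul, Complex.conj_ofReal]
      ring
    rw [this, norm_mul, Complex.norm_real, Real.norm_of_nonneg (by positivity),
      inv_mul_le_iff₀ hpos] at hmem
    linarith

/-- Testing the dual norm against the function with Fourier coefficients `c`. -/
lemma norm_sum_fourierCoef_mul_conj_le (f : ZMod N → ℂ) (c : ZMod N → ℂ) :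
    ‖∑ ξ, fourierCoef f ξ * starRingEnd ℂ (c ξ)‖ ^ 4 ≤
      u2DualNorm f ^ 4 * ∑ ξ, ‖c ξ‖ ^ 4 := by
  have h := norm_expect_mul_conj_le f fun x ↦ ∑ η, c η * ZMod.stdAddChar (η * x)
  have h4 := u2Norm_pow_four (fun x : ZMod N ↦ ∑ η, c η * ZMod.stdAddChar (η * x))
  rw [expect_mul_conj] at h
  simp only [fourierCoef_sum] at h h4
  rw [← h4, ← mul_pow]
  exact pow_le_pow_left₀ (norm_nonneg _) h 4

/-- The `ℓ²` mass of the Fourier transform on a set where its coefficients are at most `δ`. -/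
lemma sum_norm_sq_pow_three_le (f : ZMod N → ℂ) (S : Finset (ZMod N)) {δ : ℝ}
    (hS : ∀ ξ ∈ S, ‖fourierCoef f ξ‖ ≤ δ) :
    (∑ ξ ∈ S, ‖fourierCoef f ξ‖ ^ 2) ^ 3 ≤ u2DualNorm f ^ 4 * δ ^ 2 := by
  set E := ∑ ξ ∈ S, ‖fourierCoef f ξ‖ ^ 2 with hE
  have hE0 : 0 ≤ E := by positivity
  -- The test function is the part of f with frequencies in S: E⁴ ≤ T⁴ Σ_S |f̂|⁴ ≤ T⁴ δ² E, where T
  -- is the dual norm, and one factor E cancels.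
  have h := norm_sum_fourierCoef_mul_conj_le f fun ξ ↦ if ξ ∈ S then fourierCoef f ξ else 0
  have h1 : ∑ ξ, fourierCoef f ξ * starRingEnd ℂ (if ξ ∈ S then fourierCoef f ξ else 0) =
      ((E : ℝ) : ℂ) := by
    rw [hE, Complex.ofReal_sum, ← Finset.sum_filter_add_sum_filter_not univ (· ∈ S)]
    simp only [Finset.filter_univ_mem]
    rw [Finset.sum_congr rfl fun ξ hξ ↦ by rw [if_pos hξ, Complex.mul_conj', ← Complex.ofReal_pow],
      Finset.sum_eq_zero (s := univ.filter (· ∉ S)), add_zero]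
    intro ξ hξ
    rw [if_neg (Finset.mem_filter.1 hξ).2]
    simp
  have h2 : ∑ ξ, ‖(if ξ ∈ S then fourierCoef f ξ else 0)‖ ^ 4 ≤ δ ^ 2 * E := by
    rw [hE, Finset.mul_sum, ← Finset.sum_filter_add_sum_filter_not univ (· ∈ S)]
    simp only [Finset.filter_univ_mem]
    rw [Finset.sum_eq_zero (s := univ.filter (· ∉ S)), add_zero]
    · refine Finset.sum_le_sum fun ξ hξ ↦ ?_
      rw [if_pos hξ, show ‖fourierCoef f ξ‖ ^ 4 = ‖fourierCoef f ξ‖ ^ 2 * ‖fourierCoef f ξ‖ ^ 2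
        by ring]
      gcongr
      exact hS ξ hξ
    · intro ξ hξ
      rw [if_neg (Finset.mem_filter.1 hξ).2]
      simp
  rw [h1, Complex.norm_real, Real.norm_of_nonneg hE0] at h
  have h3 : E * E ^ 3 ≤ E * (u2DualNorm f ^ 4 * δ ^ 2) := by
    calc E * E ^ 3 = E ^ 4 := by ring
      _ ≤ u2DualNorm f ^ 4 * (δ ^ 2 * E) := h.trans (by gcongr)
      _ = _ := by ring
  rcases hE0.eq_or_lt with h0 | hpos
  · rw [← h0, zero_pow (by norm_num)]; positivity
  · exact le_of_mul_le_mul_left h3 hpos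

/-- The number of Fourier coefficients that are at least `δ`. -/
lemma pow_mul_card_pow_three_le (f : ZMod N → ℂ) (S : Finset (ZMod N)) {δ : ℝ} (hδ : 0 < δ)
    (hS : ∀ ξ ∈ S, δ ≤ ‖fourierCoef f ξ‖) :
    δ ^ 4 * (S.card : ℝ) ^ 3 ≤ u2DualNorm f ^ 4 := by
  -- Testing against the unit phases of f̂ on S gives (δ|S|)⁴ ≤ T⁴|S|, where T is the dual norm.
  have h := norm_sum_fourierCoef_mul_conj_le f
    fun ξ ↦ if ξ ∈ S then fourierCoef f ξ / ‖fourierCoef f ξ‖ else 0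
  have hne : ∀ ξ ∈ S, ‖fourierCoef f ξ‖ ≠ 0 := fun ξ hξ ↦ (hδ.trans_le (hS ξ hξ)).ne'
  have h1 : ∑ ξ, fourierCoef f ξ * starRingEnd ℂ
        (if ξ ∈ S then fourierCoef f ξ / ‖fourierCoef f ξ‖ else 0) =
      ((∑ ξ ∈ S, ‖fourierCoef f ξ‖ : ℝ) : ℂ) := by
    rw [Complex.ofReal_sum, ← Finset.sum_filter_add_sum_filter_not univ (· ∈ S)]
    simp only [Finset.filter_univ_mem]
    rw [Finset.sum_eq_zero (s := univ.filter (· ∉ S)), add_zero]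
    · refine Finset.sum_congr rfl fun ξ hξ ↦ ?_
      have : ((‖fourierCoef f ξ‖ : ℝ) : ℂ) ≠ 0 := by exact_mod_cast hne ξ hξ
      rw [if_pos hξ, map_div₀, Complex.conj_ofReal, mul_div_assoc', Complex.mul_conj']
      field_simp
    · intro ξ hξ
      rw [if_neg (Finset.mem_filter.1 hξ).2]
      simp
  have h2 : ∑ ξ, ‖(if ξ ∈ S then fourierCoef f ξ / ‖fourierCoef f ξ‖ else 0 : ℂ)‖ ^ 4 =
      S.card := by
    rw [← Finset.sum_filter_add_sum_filter_not univ (· ∈ S)]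
    simp only [Finset.filter_univ_mem]
    rw [Finset.sum_eq_zero (s := univ.filter (· ∉ S)), add_zero]
    · rw [Finset.card_eq_sum_ones]
      push_cast
      refine Finset.sum_congr rfl fun ξ hξ ↦ ?_
      rw [if_pos hξ, norm_div, Complex.norm_real, norm_norm, div_self (hne ξ hξ), one_pow]
    · intro ξ hξ
      rw [if_neg (Finset.mem_filter.1 hξ).2]
      simp
  have h0 : (0 : ℝ) ≤ ∑ ξ ∈ S, ‖fourierCoef f ξ‖ := by positivity
  rw [h1, h2, Complex.norm_real, Real.norm_of_nonneg h0] at h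
  have h3 : (S.card : ℝ) * δ ≤ ∑ ξ ∈ S, ‖fourierCoef f ξ‖ := by
    rw [← nsmul_eq_mul]
    exact Finset.card_nsmul_le_sum _ _ _ hS
  have h4 := (pow_le_pow_left₀ (mul_nonneg (Nat.cast_nonneg _) hδ.le) h3 4).trans h
  rcases Nat.eq_zero_or_pos S.card with hc | hc
  · rw [hc]
    have := u2DualNorm_nonneg f
    simpa using pow_nonneg this 4
  · have hc' : (0 : ℝ) < S.card := by exact_mod_cast hc
    refine le_of_mul_le_mul_right ?_ hc'
    nlinarith [h4, show (S.card * δ : ℝ) ^ 4 = δ ^ 4 * (S.card : ℝ) ^ 3 * S.card by ring]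

/-- With f as its own test function, and since the ℓ⁴ norm of f̂ is at most its ℓ² norm, E = Σ|f̂|²
satisfies E⁴ ≤ T⁴E², where T is the dual norm. -/
lemma expect_norm_sq_le (f : ZMod N → ℂ) : 𝔼 x, ‖f x‖ ^ 2 ≤ u2DualNorm f ^ 2 := by
  have hT := u2DualNorm_nonneg f
  have h := norm_sum_fourierCoef_mul_conj_le f (fourierCoef f)
  set E := ∑ ξ, ‖fourierCoef f ξ‖ ^ 2 with hE
  have hE0 : 0 ≤ E := by positivity
  have h1 : ∑ ξ, fourierCoef f ξ * starRingEnd ℂ (fourierCoef f ξ) = ((E : ℝ) : ℂ) := by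
    rw [hE, Complex.ofReal_sum]
    exact Finset.sum_congr rfl fun ξ _ ↦ by rw [Complex.mul_conj', ← Complex.ofReal_pow]
  have h2 : ∑ ξ, ‖fourierCoef f ξ‖ ^ 4 ≤ E ^ 2 := by
    rw [sq, hE, Finset.sum_mul]
    refine Finset.sum_le_sum fun ξ _ ↦ ?_
    rw [show ‖fourierCoef f ξ‖ ^ 4 = ‖fourierCoef f ξ‖ ^ 2 * ‖fourierCoef f ξ‖ ^ 2 by ring]
    gcongr
    exact Finset.single_le_sum (f := fun ξ ↦ ‖fourierCoef f ξ‖ ^ 2) (fun _ _ ↦ by positivity)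
      (Finset.mem_univ ξ)
  rw [h1, Complex.norm_real, Real.norm_of_nonneg hE0] at h
  rw [expect_norm_sq, ← hE]
  have h3 : E ^ 2 * E ^ 2 ≤ E ^ 2 * u2DualNorm f ^ 4 := by
    calc E ^ 2 * E ^ 2 = E ^ 4 := by ring
      _ ≤ _ := h.trans (by rw [mul_comm (E ^ 2)]; gcongr)
  rcases hE0.eq_or_lt with h0 | hpos
  · rw [← h0]; positivity
  · have h4 := le_of_mul_le_mul_left h3 (by positivity)
    refine le_of_pow_le_pow_left₀ (n := 2) (by norm_num) (by positivity) ?_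
    linarith [show (u2DualNorm f ^ 2) ^ 2 = u2DualNorm f ^ 4 by ring]

end Fourier

/-! ### Approximation in L² by functions with summable Fourier coefficients. -/

section Truncation

variable {N : ℕ} [NeZero N]

lemma norm_expect_le {ι : Type*} (s : Finset ι) (f : ι → ℂ) :
    ‖𝔼 i ∈ s, f i‖ ≤ 𝔼 i ∈ s, ‖f i‖ := by
  rw [Finset.expect_eq_sum_div_card, Finset.expect_eq_sum_div_card, norm_div, Complex.norm_natCast]
  gcongr
  exact norm_sum_le _ _

lemma norm_expect_le_of_le {ι : Type*} {s : Finset ι} {f : ι → ℂ} {b : ℝ} (hb : 0 ≤ b)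
    (h : ∀ i ∈ s, ‖f i‖ ≤ b) : ‖𝔼 i ∈ s, f i‖ ≤ b := by
  rcases s.eq_empty_or_nonempty with rfl | hs
  · simpa using hb
  · exact (norm_expect_le s f).trans (Finset.expect_le hs h)

lemma norm_stdAddChar_sub_le (x y : ZMod N) :
    ‖(ZMod.stdAddChar x : ℂ) - ZMod.stdAddChar y‖ ≤
      2 * Real.pi * |(x.val : ℝ) - y.val| / N := by
  have hN : (0 : ℝ) < N := by exact_mod_cast NeZero.pos N
  have key : ∀ z : ZMod N, (ZMod.stdAddChar z : ℂ) =
      Complex.exp (Complex.I * ((2 * Real.pi * z.val / N : ℝ) : ℂ)) := by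
    intro z
    have := ZMod.stdAddChar_coe (N := N) (z.val : ℤ)
    rw [show (((z.val : ℤ) : ZMod N)) = z by simp] at this
    rw [this]
    congr 1
    push_cast
    ring
  have h1 : (ZMod.stdAddChar x : ℂ) - ZMod.stdAddChar y = ZMod.stdAddChar y *
      (Complex.exp (Complex.I *
        ((2 * Real.pi * x.val / N - 2 * Real.pi * y.val / N : ℝ) : ℂ)) - 1) := by
    rw [key x, key y, mul_sub, ← Complex.exp_add, mul_one]
    congr 2
    push_cast
    ring
  rw [h1, norm_mul, norm_stdAddChar, one_mul]
  refine (Real.norm_exp_I_mul_ofReal_sub_one_le).trans ?_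
  rw [Real.norm_eq_abs, show (2 * Real.pi * x.val / N - 2 * Real.pi * y.val / N : ℝ) =
    2 * Real.pi / N * ((x.val : ℝ) - y.val) by ring, abs_mul,
    abs_of_nonneg (by positivity : (0 : ℝ) ≤ 2 * Real.pi / N)]
  exact le_of_eq (by ring)

/-- A dense set on which the characters with frequencies in `S` are almost constant. -/
lemma exists_almost_periods (S : Finset (ZMod N)) (m : ℕ) (hm : 0 < m) :
    ∃ A : Finset (ZMod N), (N : ℝ) ≤ A.card * (m : ℝ) ^ S.card ∧
      ∀ ξ ∈ S, ∀ x ∈ A, ∀ y ∈ A,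
        ‖(ZMod.stdAddChar (ξ * (x - y)) : ℂ) - 1‖ ≤ 2 * Real.pi / m := by
  classical
  have hN : 0 < N := NeZero.pos N
  have hlt : ∀ z : ZMod N, z.val * m / N < m := fun z ↦ by
    rw [Nat.div_lt_iff_lt_mul hN, mul_comm]
    exact Nat.mul_lt_mul_of_pos_left (ZMod.val_lt z) hm
  -- Each circle coordinate ξx is cut into m arcs; A is the most popular of the m^|S| cells.
  let F : ZMod N → S → Fin m := fun x ξ ↦ ⟨((ξ : ZMod N) * x).val * m / N, hlt _⟩
  have : Nonempty (Fin m) := ⟨⟨0, hm⟩⟩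
  have hmS : (0 : ℝ) < (m : ℝ) ^ S.card := by positivity
  obtain ⟨y, hy⟩ := Fintype.exists_le_card_fiber_of_nsmul_le_card F (b := (N : ℝ) / m ^ S.card)
    (by
      rw [Fintype.card_fun, Fintype.card_fin, Fintype.card_coe, ZMod.card, nsmul_eq_mul]
      push_cast
      rw [mul_div_cancel₀ _ hmS.ne'])
  refine ⟨_, (div_le_iff₀ hmS).1 hy, ?_⟩
  intro ξ hξ x hx x' hx'
  have h1 : ((ξ * x).val * m / N : ℕ) = (ξ * x').val * m / N := by
    have h1 := congrArg Fin.val (congrFun (Finset.mem_filter.1 hx).2 ⟨ξ, hξ⟩)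
    have h2 := congrArg Fin.val (congrFun (Finset.mem_filter.1 hx').2 ⟨ξ, hξ⟩)
    exact h1.trans h2.symm
  have h2 : ‖(ZMod.stdAddChar (ξ * (x - x')) : ℂ) - 1‖ =
      ‖(ZMod.stdAddChar (ξ * x) : ℂ) - ZMod.stdAddChar (ξ * x')‖ := by
    rw [← mul_one ‖(ZMod.stdAddChar (ξ * (x - x')) : ℂ) - 1‖, ← norm_stdAddChar (ξ * x'),
      ← norm_mul, sub_mul, ← AddChar.map_add_eq_mul, one_mul]
    congr 3
    ring_nf
  rw [h2]
  refine (norm_stdAddChar_sub_le _ _).trans ?_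
  have hN' : (0 : ℝ) < N := by exact_mod_cast hN
  have hm' : (0 : ℝ) < m := by exact_mod_cast hm
  rw [div_le_div_iff₀ hN' hm', mul_assoc]
  refine mul_le_mul_of_nonneg_left ?_ (by positivity)
  set u := (ξ * x).val
  set v := (ξ * x').val
  have e1 := Nat.div_add_mod (u * m) N
  have e2 := Nat.div_add_mod (v * m) N
  have l1 := Nat.mod_lt (u * m) hN
  have l2 := Nat.mod_lt (v * m) hN
  rw [h1] at e1
  have e1' : (N : ℝ) * ((v * m / N : ℕ) : ℝ) + ((u * m % N : ℕ) : ℝ) = u * m := by exact_mod_cast e1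
  have e2' : (N : ℝ) * ((v * m / N : ℕ) : ℝ) + ((v * m % N : ℕ) : ℝ) = v * m := by exact_mod_cast e2
  have l1' : ((u * m % N : ℕ) : ℝ) < N := by exact_mod_cast l1
  have l2' : ((v * m % N : ℕ) : ℝ) < N := by exact_mod_cast l2
  have p1 : (0 : ℝ) ≤ ((u * m % N : ℕ) : ℝ) := Nat.cast_nonneg _
  have p2 : (0 : ℝ) ≤ ((v * m % N : ℕ) : ℝ) := Nat.cast_nonneg _
  rw [← abs_of_pos hm', ← abs_mul, sub_mul, abs_le]
  constructor <;> linarith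

/-- `∑ |μ̂(ξ)|² = N / |A|` for the uniform probability measure `μ` on `A`. -/
lemma sum_norm_expect_stdAddChar_sq (A : Finset (ZMod N)) (hA : A.Nonempty) :
    ∑ ξ : ZMod N, ‖𝔼 a ∈ A, (ZMod.stdAddChar (ξ * a) : ℂ)‖ ^ 2 = N / A.card := by
  have hN : (N : ℝ) ≠ 0 := by exact_mod_cast NeZero.ne N
  have hA' : (A.card : ℝ) ≠ 0 := by exact_mod_cast hA.card_pos.ne'
  have h := expect_norm_sq fun x : ZMod N ↦ if x ∈ A then (1 : ℂ) else 0
  have h1 : 𝔼 x : ZMod N, ‖(if x ∈ A then (1 : ℂ) else 0)‖ ^ 2 = A.card / N := by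
    rw [Fintype.expect_eq_sum_div_card, ZMod.card]
    congr 1
    simp [apply_ite]
  have h2 : ∀ ξ : ZMod N, ‖fourierCoef (fun x : ZMod N ↦ if x ∈ A then (1 : ℂ) else 0) ξ‖ ^ 2 =
      (A.card / N) ^ 2 * ‖𝔼 a ∈ A, (ZMod.stdAddChar (ξ * a) : ℂ)‖ ^ 2 := by
    intro ξ
    have : fourierCoef (fun x : ZMod N ↦ if x ∈ A then (1 : ℂ) else 0) ξ =
        ((A.card / N : ℝ) : ℂ) * starRingEnd ℂ (𝔼 a ∈ A, (ZMod.stdAddChar (ξ * a) : ℂ)) := by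
      rw [conj_expect, Finset.expect_eq_sum_div_card, fourierCoef, Fintype.expect_eq_sum_div_card,
        ZMod.card]
      simp only [conj_stdAddChar, ite_mul, one_mul, zero_mul, Finset.sum_ite_mem, univ_inter]
      push_cast
      have : (A.card : ℂ) ≠ 0 := by exact_mod_cast hA'
      field_simp
    rw [this, norm_mul, RCLike.norm_conj, Complex.norm_real, mul_pow,
      Real.norm_of_nonneg (by positivity)]
  rw [h1] at h
  simp only [h2, ← Finset.mul_sum] at h
  field_simp at h ⊢
  linarith

lemma fourierCoef_average (U : ZMod N → ℂ) (A : Finset (ZMod N)) (ξ : ZMod N) :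
    fourierCoef (fun z ↦ 𝔼 a ∈ A, 𝔼 a' ∈ A, U (z + (a - a'))) ξ =
      fourierCoef U ξ * 𝔼 a ∈ A, 𝔼 a' ∈ A, ZMod.stdAddChar (ξ * (a - a')) := by
  have h : fourierCoef (fun z ↦ 𝔼 a ∈ A, 𝔼 a' ∈ A, U (z + (a - a'))) ξ =
      𝔼 a ∈ A, 𝔼 a' ∈ A, fourierCoef (fun z ↦ U (z + (a - a'))) ξ := by
    simp only [fourierCoef, Finset.expect_mul]
    rw [Finset.expect_comm]
    exact Finset.expect_congr rfl fun a _ ↦ by rw [Finset.expect_comm]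
  rw [h]
  simp only [fourierCoef_add_right, Finset.mul_expect]

/-- Averaging over differences a - a', rather than over A, makes the Fourier multiplier a real
number in [0, 1]. -/
lemma expect_stdAddChar_sub (A : Finset (ZMod N)) (ξ : ZMod N) :
    𝔼 a ∈ A, 𝔼 a' ∈ A, (ZMod.stdAddChar (ξ * (a - a')) : ℂ) =
      ((‖𝔼 a ∈ A, (ZMod.stdAddChar (ξ * a) : ℂ)‖ ^ 2 : ℝ) : ℂ) := by
  rw [Complex.ofReal_pow, ← Complex.mul_conj', conj_expect, Finset.expect_mul_expect]
  refine Finset.expect_congr rfl fun a _ ↦ Finset.expect_congr rfl fun a' _ ↦ ?_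
  rw [conj_stdAddChar, ← AddChar.map_add_eq_mul]
  congr 1
  ring

lemma norm_fourierCoef_le {U : ZMod N → ℂ} {b : ℝ} (hU : ∀ x, ‖U x‖ ≤ b) (ξ : ZMod N) :
    ‖fourierCoef U ξ‖ ≤ b := by
  refine norm_expect_le_of_le ((norm_nonneg _).trans (hU 0)) fun x _ ↦ ?_
  rw [norm_mul, norm_stdAddChar, mul_one]
  exact hU x

/-- A function with small `U²`-dual norm is close in `L²` to a function with absolutely summable
Fourier transform, with an explicit bound, which is obtained by averaging. -/
lemma exists_truncation (U : ZMod N → ℂ) {T e b : ℝ} (hT : u2DualNorm U ≤ T) (he : 0 < e)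
    (heT : e ≤ T) (hU : ∀ x, ‖U x‖ ≤ b) :
    ∃ V : ZMod N → ℂ, (∀ x, ‖V x‖ ≤ b) ∧ 𝔼 x, ‖U x - V x‖ ^ 2 ≤ e ^ 2 ∧
      ∑ ξ, ‖fourierCoef V ξ‖ ≤ b * (11 * (T / e)) ^ (8 * (T / e) ^ 4) := by
  have hT0 : 0 < T := he.trans_le heT
  have hb : 0 ≤ b := (norm_nonneg _).trans (hU 0)
  set t := T / e with ht
  have ht1 : 1 ≤ t := (one_le_div he).2 heT
  have hTe : T = t * e := by rw [ht]; field_simp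
  -- With this threshold the frequencies outside S carry mass at most (T⁴δ²)^{1/3} = (e⁶/16)^{1/3} ≤
  -- e²/2, while |S|³ ≤ T⁴/δ⁴ = 256 t¹².
  set δ := e ^ 3 / (4 * T ^ 2) with hδ
  have hδ0 : 0 < δ := by positivity
  have hnn := u2DualNorm_nonneg U
  set S : Finset (ZMod N) := univ.filter fun ξ ↦ δ ≤ ‖fourierCoef U ξ‖ with hS
  have hScard : (S.card : ℝ) ≤ 8 * t ^ 4 := by
    have h := (pow_mul_card_pow_three_le U S hδ0 fun ξ hξ ↦ (Finset.mem_filter.1 hξ).2).trans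
      (pow_le_pow_left₀ hnn hT 4)
    refine le_of_pow_le_pow_left₀ (n := 3) (by norm_num) (by positivity) ?_
    have hδe : δ = e / (4 * t ^ 2) := by rw [hδ, hTe]; field_simp
    rw [hδe, hTe, div_pow, div_mul_eq_mul_div, div_le_iff₀ (by positivity)] at h
    have h' : e ^ 4 * (S.card : ℝ) ^ 3 ≤ e ^ 4 * (256 * t ^ 12) := h.trans (by ring_nf; rfl)
    have h'' := le_of_mul_le_mul_left h' (by positivity)
    have : (0 : ℝ) ≤ t ^ 12 := by positivity
    calc _ ≤ _ := h''
      _ ≤ _ := by ring_nf; linarith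
  -- Ten arcs per unit of t give 2π/m ≤ 0.7/t, so the frequencies in S, of total mass at most T²,
  -- contribute at most 0.49 e² to the error.
  set m := ⌈10 * t⌉₊ with hm
  have hm1 : 10 * t ≤ m := Nat.le_ceil _
  have hm2 : (m : ℝ) ≤ 11 * t := (Nat.ceil_lt_add_one (by positivity)).le.trans (by linarith)
  have hm0 : 0 < m := Nat.ceil_pos.2 (by positivity)
  obtain ⟨A, hA, hAS⟩ := exists_almost_periods S m hm0
  have hm0' : (0 : ℝ) < m := by exact_mod_cast hm0
  have hN : (0 : ℝ) < N := by exact_mod_cast NeZero.pos N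
  have hAne : A.Nonempty := by
    by_contra hcon
    rw [Finset.not_nonempty_iff_eq_empty.1 hcon] at hA
    simp at hA
    exact absurd hA (NeZero.ne N)
  have hAc : (0 : ℝ) < A.card := by exact_mod_cast hAne.card_pos
  have hcoef : ∀ ξ, fourierCoef (fun z ↦ 𝔼 a ∈ A, 𝔼 a' ∈ A, U (z + (a - a'))) ξ =
      fourierCoef U ξ * ((‖𝔼 a ∈ A, (ZMod.stdAddChar (ξ * a) : ℂ)‖ ^ 2 : ℝ) : ℂ) := fun ξ ↦ by
    rw [fourierCoef_average, expect_stdAddChar_sub]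
  refine ⟨fun z ↦ 𝔼 a ∈ A, 𝔼 a' ∈ A, U (z + (a - a')), ?_, ?_, ?_⟩
  · intro x
    exact norm_expect_le_of_le hb fun a _ ↦ norm_expect_le_of_le hb fun a' _ ↦ hU _
  · rw [expect_norm_sq]
    have hsub : ∀ ξ, fourierCoef (fun x ↦ U x - 𝔼 a ∈ A, 𝔼 a' ∈ A, U (x + (a - a'))) ξ =
        fourierCoef U ξ * (1 - ((‖𝔼 a ∈ A, (ZMod.stdAddChar (ξ * a) : ℂ)‖ ^ 2 : ℝ) : ℂ)) := by
      intro ξ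
      rw [mul_sub, mul_one, ← hcoef]
      simp only [fourierCoef, sub_mul, Finset.expect_sub_distrib]
    rw [← Finset.sum_filter_add_sum_filter_not univ (fun ξ ↦ δ ≤ ‖fourierCoef U ξ‖), ← hS]
    have hpart : ∑ ξ ∈ S, ‖fourierCoef U ξ‖ ^ 2 ≤ T ^ 2 := by
      calc _ ≤ ∑ ξ, ‖fourierCoef U ξ‖ ^ 2 :=
            Finset.sum_le_sum_of_subset_of_nonneg (Finset.subset_univ _) fun _ _ _ ↦ by positivity
        _ = 𝔼 x, ‖U x‖ ^ 2 := (expect_norm_sq U).symm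
        _ ≤ u2DualNorm U ^ 2 := expect_norm_sq_le U
        _ ≤ T ^ 2 := pow_le_pow_left₀ hnn hT 2
    have h1 : ∑ ξ ∈ S, ‖fourierCoef
        (fun x ↦ U x - 𝔼 a ∈ A, 𝔼 a' ∈ A, U (x + (a - a'))) ξ‖ ^ 2 ≤ e ^ 2 / 2 := by
      have hw : ∀ ξ ∈ S,
          ‖1 - ((‖𝔼 a ∈ A, (ZMod.stdAddChar (ξ * a) : ℂ)‖ ^ 2 : ℝ) : ℂ)‖ ≤ 0.7 / t := by
        intro ξ hξ
        rw [← expect_stdAddChar_sub]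
        have : (1 : ℂ) - 𝔼 a ∈ A, 𝔼 a' ∈ A, (ZMod.stdAddChar (ξ * (a - a')) : ℂ) =
            𝔼 a ∈ A, 𝔼 a' ∈ A, ((1 : ℂ) - ZMod.stdAddChar (ξ * (a - a'))) := by
          simp only [Finset.expect_sub_distrib, Finset.expect_const hAne]
        rw [this]
        refine norm_expect_le_of_le (by positivity) fun a ha ↦
          norm_expect_le_of_le (by positivity) fun a' ha' ↦ ?_
        rw [norm_sub_rev]
        refine (hAS ξ hξ a ha a' ha').trans ?_
        rw [div_le_div_iff₀ hm0' (by positivity)]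
        nlinarith [Real.pi_lt_d2]
      calc _ ≤ ∑ ξ ∈ S, ‖fourierCoef U ξ‖ ^ 2 * (0.7 / t) ^ 2 := by
            refine Finset.sum_le_sum fun ξ hξ ↦ ?_
            rw [hsub, norm_mul, mul_pow]
            gcongr
            exact hw ξ hξ
        _ ≤ T ^ 2 * (0.7 / t) ^ 2 := by rw [← Finset.sum_mul]; gcongr
        _ = 0.49 * e ^ 2 := by rw [hTe]; field_simp; norm_num
        _ ≤ _ := by nlinarith [sq_nonneg e]
    have h2 : ∑ ξ ∈ univ.filter (fun ξ ↦ ¬ δ ≤ ‖fourierCoef U ξ‖), ‖fourierCoef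
        (fun x ↦ U x - 𝔼 a ∈ A, 𝔼 a' ∈ A, U (x + (a - a'))) ξ‖ ^ 2 ≤ e ^ 2 / 2 := by
      have hE := sum_norm_sq_pow_three_le U (univ.filter fun ξ ↦ ¬ δ ≤ ‖fourierCoef U ξ‖) (δ := δ)
        fun ξ hξ ↦ (not_le.1 (Finset.mem_filter.1 hξ).2).le
      have hE2 : ∑ ξ ∈ univ.filter (fun ξ ↦ ¬ δ ≤ ‖fourierCoef U ξ‖), ‖fourierCoef U ξ‖ ^ 2 ≤
          e ^ 2 / 2 := by
        refine le_of_pow_le_pow_left₀ (n := 3) (by norm_num) (by positivity) ?_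
        calc _ ≤ _ := hE
          _ ≤ T ^ 4 * δ ^ 2 := by gcongr
          _ = e ^ 6 / 16 := by rw [hδ]; field_simp; norm_num
          _ ≤ (e ^ 2 / 2) ^ 3 := by
            have : 0 < e ^ 6 := by positivity
            ring_nf; linarith
      refine le_trans (Finset.sum_le_sum fun ξ _ ↦ ?_) hE2
      rw [hsub, norm_mul, mul_pow]
      refine mul_le_of_le_one_right (by positivity) ?_
      have hle : ‖𝔼 a ∈ A, (ZMod.stdAddChar (ξ * a) : ℂ)‖ ^ 2 ≤ 1 := by
        refine pow_le_one₀ (norm_nonneg _) (norm_expect_le_of_le zero_le_one fun a _ ↦ ?_)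
        rw [norm_stdAddChar]
      have hnn2 : 0 ≤ ‖𝔼 a ∈ A, (ZMod.stdAddChar (ξ * a) : ℂ)‖ ^ 2 := by positivity
      rw [← Complex.ofReal_one, ← Complex.ofReal_sub, Complex.norm_real,
        Real.norm_of_nonneg (by linarith)]
      exact pow_le_one₀ (by linarith) (by linarith)
    linarith
  -- Here |V̂(ξ)| ≤ b|μ̂(ξ)|² for the uniform measure μ on A, and Parseval sums |μ̂|² to N/|A| ≤
  -- m^|S|.
  · calc ∑ ξ, ‖fourierCoef (fun z ↦ 𝔼 a ∈ A, 𝔼 a' ∈ A, U (z + (a - a'))) ξ‖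
        ≤ ∑ ξ : ZMod N, b * ‖𝔼 a ∈ A, (ZMod.stdAddChar (ξ * a) : ℂ)‖ ^ 2 := by
          refine Finset.sum_le_sum fun ξ _ ↦ ?_
          rw [hcoef, norm_mul, Complex.norm_real, Real.norm_of_nonneg (by positivity)]
          gcongr
          exact norm_fourierCoef_le hU ξ
      _ = b * (N / A.card) := by rw [← Finset.mul_sum, sum_norm_expect_stdAddChar_sq A hAne]
      _ ≤ b * (m : ℝ) ^ S.card := by
          gcongr
          rw [div_le_iff₀ hAc]
          linarith
      _ ≤ b * (11 * t) ^ (8 * t ^ 4) := by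
          gcongr
          rw [← Real.rpow_natCast]
          calc (m : ℝ) ^ (S.card : ℝ) ≤ (11 * t) ^ (S.card : ℝ) :=
                Real.rpow_le_rpow hm0'.le hm2 (Nat.cast_nonneg _)
            _ ≤ _ := Real.rpow_le_rpow_of_exponent_le (by linarith) hScard

end Truncation

/-! ### Locally bilinear forms. -/

section Biadd

variable {N : ℕ}

/-- `β` is additive in both variables as long as all arguments stay in `S`. -/
def BiaddOn (S : Set (ZMod N)) (β : ZMod N → ZMod N → ZMod N) : Prop :=
  (∀ u u' v, u ∈ S → u' ∈ S → u + u' ∈ S → v ∈ S → β (u + u') v = β u v + β u' v) ∧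
    ∀ u v v', u ∈ S → v ∈ S → v' ∈ S → v + v' ∈ S → β u (v + v') = β u v + β u v'

lemma BiaddOn.mono {S S' : Set (ZMod N)} {β : ZMod N → ZMod N → ZMod N} (h : BiaddOn S β)
    (hS : S' ⊆ S) : BiaddOn S' β :=
  ⟨fun u u' v hu hu' huu' hv ↦ h.1 u u' v (hS hu) (hS hu') (hS huu') (hS hv),
    fun u v v' hu hv hv' hvv' ↦ h.2 u v v' (hS hu) (hS hv) (hS hv') (hS hvv')⟩

lemma BiaddOn.sum {ι : Type*} (s : Finset ι) {S : Set (ZMod N)}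
    {β : ι → ZMod N → ZMod N → ZMod N} (c : ι → ZMod N) (h : ∀ i ∈ s, BiaddOn S (β i)) :
    BiaddOn S fun u v ↦ ∑ i ∈ s, c i * β i u v := by
  constructor
  · intro u u' v hu hu' huu' hv
    rw [← Finset.sum_add_distrib]
    exact Finset.sum_congr rfl fun i hi ↦ by rw [(h i hi).1 u u' v hu hu' huu' hv, mul_add]
  · intro u v v' hu hv hv' hvv'
    rw [← Finset.sum_add_distrib]
    exact Finset.sum_congr rfl fun i hi ↦ by rw [(h i hi).2 u v v' hu hv hv' hvv', mul_add]

variable {S : Set (ZMod N)} {Y : Finset (ZMod N)} {β : ZMod N → ZMod N → ZMod N} {y₀ : ZMod N}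

/-- A base point y₀ separates a from a', which turns sums over pairs (a, a') into squared moduli of
single sums. -/
lemma BiaddOn.sub_left (h : BiaddOn S β) (hS : ∀ a ∈ Y, ∀ b ∈ Y, a - b ∈ S) (hy₀ : y₀ ∈ Y)
    {a a' v : ZMod N} (ha : a ∈ Y) (ha' : a' ∈ Y) (hv : v ∈ S) :
    β (a - a') v = β (a - y₀) v - β (a' - y₀) v := by
  have := h.1 (a - a') (a' - y₀) v (hS _ ha _ ha') (hS _ ha' _ hy₀)
    (by rw [sub_add_sub_cancel]; exact hS _ ha _ hy₀) hv
  rw [sub_add_sub_cancel] at this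
  rw [this, add_sub_cancel_right]

lemma BiaddOn.sub_right (h : BiaddOn S β) (hS : ∀ a ∈ Y, ∀ b ∈ Y, a - b ∈ S) (hy₀ : y₀ ∈ Y)
    {b b' u : ZMod N} (hu : u ∈ S) (hb : b ∈ Y) (hb' : b' ∈ Y) :
    β u (b - b') = β u (b - y₀) - β u (b' - y₀) := by
  have := h.2 u (b - b') (b' - y₀) hu (hS _ hb _ hb') (hS _ hb' _ hy₀)
    (by rw [sub_add_sub_cancel]; exact hS _ hb _ hy₀)
  rw [sub_add_sub_cancel] at this
  rw [this, add_sub_cancel_right]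

end Biadd

/-! ### The bias of a bilinear form and its behaviour under sums. -/

section Bias

variable {N : ℕ} [NeZero N]

/-- The (unnormalized) bias of `β` on differences of `Y`. -/
noncomputable def bias (β : ZMod N → ZMod N → ZMod N) (Y : Finset (ZMod N)) : ℝ :=
  (∑ a ∈ Y, ∑ a' ∈ Y, ∑ b ∈ Y, ∑ b' ∈ Y, (ZMod.stdAddChar (β (a - a') (b - b')) : ℂ)).re

lemma norm_sum_sq_eq {ι : Type*} (s : Finset ι) (g : ι → ℂ) :
    ((‖∑ i ∈ s, g i‖ ^ 2 : ℝ) : ℂ) = ∑ i ∈ s, ∑ j ∈ s, g i * starRingEnd ℂ (g j) := by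
  rw [Complex.ofReal_pow, ← Complex.mul_conj', map_sum, Finset.sum_mul_sum]

lemma stdAddChar_sum {ι : Type*} (s : Finset ι) (f : ι → ZMod N) :
    (ZMod.stdAddChar (∑ i ∈ s, f i) : ℂ) = ∏ i ∈ s, ZMod.stdAddChar (f i) := by
  classical
  induction s using Finset.induction_on with
  | empty => simp
  | insert i s hi ih => rw [Finset.sum_insert hi, Finset.prod_insert hi, AddChar.map_add_eq_mul, ih]

lemma stdAddChar_mul_conj (x y : ZMod N) :
    (ZMod.stdAddChar x : ℂ) * starRingEnd ℂ (ZMod.stdAddChar y) = ZMod.stdAddChar (x - y) := by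
  rw [conj_stdAddChar, ← AddChar.map_add_eq_mul, sub_eq_add_neg]

variable {S : Set (ZMod N)} {Y : Finset (ZMod N)} {β : ZMod N → ZMod N → ZMod N} {y₀ : ZMod N}

lemma BiaddOn.sum_left_eq (h : BiaddOn S β) (hS : ∀ a ∈ Y, ∀ b ∈ Y, a - b ∈ S) (hy₀ : y₀ ∈ Y)
    {v : ZMod N} (hv : v ∈ S) :
    ∑ a ∈ Y, ∑ a' ∈ Y, (ZMod.stdAddChar (β (a - a') v) : ℂ) =
      ((‖∑ a ∈ Y, (ZMod.stdAddChar (β (a - y₀) v) : ℂ)‖ ^ 2 : ℝ) : ℂ) := by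
  rw [norm_sum_sq_eq]
  refine Finset.sum_congr rfl fun a ha ↦ Finset.sum_congr rfl fun a' ha' ↦ ?_
  rw [stdAddChar_mul_conj, h.sub_left hS hy₀ ha ha' hv]

lemma BiaddOn.sum_right_eq (h : BiaddOn S β) (hS : ∀ a ∈ Y, ∀ b ∈ Y, a - b ∈ S) (hy₀ : y₀ ∈ Y)
    {u : ZMod N} (hu : u ∈ S) :
    ∑ b ∈ Y, ∑ b' ∈ Y, (ZMod.stdAddChar (β u (b - b')) : ℂ) =
      ((‖∑ b ∈ Y, (ZMod.stdAddChar (β u (b - y₀)) : ℂ)‖ ^ 2 : ℝ) : ℂ) := by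
  rw [norm_sum_sq_eq]
  refine Finset.sum_congr rfl fun b hb ↦ Finset.sum_congr rfl fun b' hb' ↦ ?_
  rw [stdAddChar_mul_conj, h.sub_right hS hy₀ hu hb hb']

/-- The bias is a sum of squares. This positivity is what permits enlarging domains of summation
later. -/
lemma BiaddOn.bias_eq_left (h : BiaddOn S β) (hS : ∀ a ∈ Y, ∀ b ∈ Y, a - b ∈ S) (hy₀ : y₀ ∈ Y) :
    bias β Y = ∑ b ∈ Y, ∑ b' ∈ Y, ‖∑ a ∈ Y, (ZMod.stdAddChar (β (a - y₀) (b - b')) : ℂ)‖ ^ 2 := by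
  have : ∑ a ∈ Y, ∑ a' ∈ Y, ∑ b ∈ Y, ∑ b' ∈ Y, (ZMod.stdAddChar (β (a - a') (b - b')) : ℂ) =
      ∑ b ∈ Y, ∑ b' ∈ Y, ∑ a ∈ Y, ∑ a' ∈ Y, (ZMod.stdAddChar (β (a - a') (b - b')) : ℂ) := by
    have := Finset.sum_comm (s := Y ×ˢ Y) (t := Y ×ˢ Y)
      (f := fun p q ↦ (ZMod.stdAddChar (β (p.1 - p.2) (q.1 - q.2)) : ℂ))
    simpa only [Finset.sum_product] using this
  rw [bias, this, Finset.sum_congr rfl fun b hb ↦ Finset.sum_congr rfl fun b' hb' ↦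
    h.sum_left_eq hS hy₀ (hS b hb b' hb')]
  simp only [← Complex.ofReal_sum, Complex.ofReal_re]

lemma BiaddOn.bias_eq_right (h : BiaddOn S β) (hS : ∀ a ∈ Y, ∀ b ∈ Y, a - b ∈ S) (hy₀ : y₀ ∈ Y) :
    bias β Y = ∑ a ∈ Y, ∑ a' ∈ Y, ‖∑ b ∈ Y, (ZMod.stdAddChar (β (a - a') (b - y₀)) : ℂ)‖ ^ 2 := by
  rw [bias, Finset.sum_congr rfl fun a ha ↦ Finset.sum_congr rfl fun a' ha' ↦
    h.sum_right_eq hS hy₀ (hS a ha a' ha')]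
  simp only [← Complex.ofReal_sum, Complex.ofReal_re]

lemma sum_comp_le {ι κ : Type*} [DecidableEq κ] {s : Finset ι} {t : Finset κ} {f : ι → κ}
    (hf : ∀ x ∈ s, f x ∈ t) {D : ℕ} (hD : ∀ y ∈ t, (s.filter fun x ↦ f x = y).card ≤ D)
    {g : κ → ℝ} (hg : ∀ y ∈ t, 0 ≤ g y) : ∑ x ∈ s, g (f x) ≤ D * ∑ y ∈ t, g y := by
  rw [← Finset.sum_fiberwise_of_maps_to hf, Finset.mul_sum]
  refine Finset.sum_le_sum fun y hy ↦ ?_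
  rw [Finset.sum_congr rfl fun x hx ↦ by rw [(Finset.mem_filter.1 hx).2], Finset.sum_const,
    nsmul_eq_mul]
  exact mul_le_mul_of_nonneg_right (by exact_mod_cast hD y hy) (hg y hy)

/-- Monotonicity of sums of nonnegative functions over difference sets. -/
lemma sum_sum_sub_le {ι κ : Type*} [DecidableEq κ] [AddCommGroup κ] {s : Finset ι} {t : Finset κ}
    {f : ι → κ} (hf : ∀ x ∈ s, f x ∈ t) {D : ℕ}
    (hD : ∀ y ∈ t, (s.filter fun x ↦ f x = y).card ≤ D) {W : κ → ℝ}
    (hW : ∀ y ∈ t, ∀ y' ∈ t, 0 ≤ W (y - y')) :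
    ∑ x ∈ s, ∑ x' ∈ s, W (f x - f x') ≤ D ^ 2 * ∑ y ∈ t, ∑ y' ∈ t, W (y - y') := by
  calc ∑ x ∈ s, ∑ x' ∈ s, W (f x - f x') ≤ ∑ x ∈ s, D * ∑ y' ∈ t, W (f x - y') :=
        Finset.sum_le_sum fun x hx ↦ sum_comp_le (g := fun y' ↦ W (f x - y')) hf hD
          (hW _ (hf x hx))
    _ = D * ∑ x ∈ s, ∑ y' ∈ t, W (f x - y') := by rw [Finset.mul_sum]
    _ ≤ D * (D * ∑ y ∈ t, ∑ y' ∈ t, W (y - y')) := by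
        refine mul_le_mul_of_nonneg_left ?_ (Nat.cast_nonneg _)
        exact sum_comp_le (g := fun y ↦ ∑ y' ∈ t, W (y - y')) hf hD
          fun y hy ↦ Finset.sum_nonneg (hW y hy)
    _ = _ := by ring

/-- The product of sums is a sum over tuples p. Writing p i = b + h i counts every tuple N times,
and Cauchy–Schwarz over h leaves a single variable b common to all factors. -/
lemma prod_norm_sum_sq_le {ι : Type*} [Fintype ι] [DecidableEq ι] (Y : Finset (ZMod N))
    (χ : ι → ZMod N → ℂ) :
    (N : ℝ) ^ 2 * ∏ i, ‖∑ b ∈ Y, χ i b‖ ^ 2 ≤ (N : ℝ) ^ Fintype.card ι *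
      ∑ h : ι → ZMod N, ‖∑ b ∈ univ.filter (fun b ↦ ∀ i, b + h i ∈ Y), ∏ i, χ i (b + h i)‖ ^ 2 := by
  set F : (ι → ZMod N) → ℂ := fun p ↦ ∏ i, if p i ∈ Y then χ i (p i) else 0 with hF
  have h1 : ∏ i, ∑ b ∈ Y, χ i b = ∑ p, F p := by
    have : ∀ i, ∑ b ∈ Y, χ i b = ∑ b : ZMod N, if b ∈ Y then χ i b else 0 := fun i ↦ by simp
    simp only [this]
    rw [Finset.prod_univ_sum, Fintype.piFinset_univ]
  have h2 : (N : ℂ) * ∑ p, F p = ∑ h : ι → ZMod N, ∑ b : ZMod N, F (fun i ↦ b + h i) := by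
    have e : ∀ b : ZMod N, ∑ h : ι → ZMod N, F (fun i ↦ b + h i) = ∑ p, F p := fun b ↦
      Fintype.sum_equiv (Equiv.addLeft fun _ ↦ b) _ F fun h ↦ rfl
    rw [Finset.sum_comm' (t' := univ) (s' := fun _ ↦ univ) (by simp)]
    simp only [e]
    simp
  have h3 : ∀ h : ι → ZMod N, ∑ b : ZMod N, F (fun i ↦ b + h i) =
      ∑ b ∈ univ.filter (fun b ↦ ∀ i, b + h i ∈ Y), ∏ i, χ i (b + h i) := by
    intro h
    rw [Finset.sum_filter]
    refine Finset.sum_congr rfl fun b _ ↦ ?_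
    split_ifs with hb
    · exact Finset.prod_congr rfl fun i _ ↦ if_pos (hb i)
    · push Not at hb
      obtain ⟨i, hi⟩ := hb
      exact Finset.prod_eq_zero (Finset.mem_univ i) (if_neg hi)
  have h4 : (N : ℝ) ^ 2 * ∏ i, ‖∑ b ∈ Y, χ i b‖ ^ 2 = ‖∑ h : ι → ZMod N,
      ∑ b ∈ univ.filter (fun b ↦ ∀ i, b + h i ∈ Y), ∏ i, χ i (b + h i)‖ ^ 2 := by
    simp only [← h3]
    rw [← h2, ← h1, norm_mul, norm_prod, mul_pow, Complex.norm_natCast, Finset.prod_pow]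
  rw [h4]
  calc _ ≤ (∑ h : ι → ZMod N,
        ‖∑ b ∈ univ.filter (fun b ↦ ∀ i, b + h i ∈ Y), ∏ i, χ i (b + h i)‖) ^ 2 :=
        pow_le_pow_left₀ (norm_nonneg _) (norm_sum_le _ _) 2
    _ ≤ _ := by
        refine sq_sum_le_card_mul_sum_sq.trans (le_of_eq ?_)
        rw [Finset.card_univ, Fintype.card_fun, ZMod.card]
        push_cast
        rfl

/-- If the characters `∏ i, χ ω i` average over `ω` to a nonnegative function `W` of the
difference, then the averages of products of squares of sums of the characters over `Y` are
controlled by the sum of `W` over differences of `Y`. -/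
lemma sum_prod_norm_sum_sq_le {ι Ω : Type*} [Fintype ι] [DecidableEq ι] [Nonempty ι]
    (Y : Finset (ZMod N)) (T : Finset Ω) (χ : Ω → ι → ZMod N → ℂ) (W : ZMod N → ℝ)
    (hW0 : ∀ b ∈ Y, ∀ b' ∈ Y, 0 ≤ W (b - b'))
    (hW : ∀ (h : ι → ZMod N) (b b' : ZMod N), (∀ i, b + h i ∈ Y) → (∀ i, b' + h i ∈ Y) →
      ∑ ω ∈ T, ∏ i, (χ ω i (b + h i) * starRingEnd ℂ (χ ω i (b' + h i))) = W (b - b')) :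
    (N : ℝ) ^ 2 * ∑ ω ∈ T, ∏ i, ‖∑ b ∈ Y, χ ω i b‖ ^ 2 ≤
      ((N : ℝ) ^ Fintype.card ι) ^ 2 * ∑ b ∈ Y, ∑ b' ∈ Y, W (b - b') := by
  obtain ⟨i₀⟩ := ‹Nonempty ι›
  have hsum : ∀ h : ι → ZMod N,
      ∑ ω ∈ T, ‖∑ b ∈ univ.filter (fun b ↦ ∀ i, b + h i ∈ Y), ∏ i, χ ω i (b + h i)‖ ^ 2 ≤
        ∑ b ∈ Y, ∑ b' ∈ Y, W (b - b') := by
    intro h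
    have e : ∑ ω ∈ T, ‖∑ b ∈ univ.filter (fun b ↦ ∀ i, b + h i ∈ Y), ∏ i, χ ω i (b + h i)‖ ^ 2 =
        ∑ b ∈ univ.filter (fun b ↦ ∀ i, b + h i ∈ Y),
          ∑ b' ∈ univ.filter (fun b ↦ ∀ i, b + h i ∈ Y), W ((b + h i₀) - (b' + h i₀)) := by
      rw [← Complex.ofReal_inj]
      push_cast
      simp only [← Complex.ofReal_pow, norm_sum_sq_eq]
      rw [Finset.sum_comm]
      refine Finset.sum_congr rfl fun b hb ↦ ?_
      rw [Finset.sum_comm]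
      refine Finset.sum_congr rfl fun b' hb' ↦ ?_
      rw [add_sub_add_right_eq_sub,
        ← hW h b b' (Finset.mem_filter.1 hb).2 (Finset.mem_filter.1 hb').2]
      simp only [map_prod, Finset.prod_mul_distrib]
    rw [e]
    -- The shift by `h i₀` embeds the admissible b into Y and does not change b - b', so
    -- nonnegativity of W allows summing over all of Y.
    refine (sum_sum_sub_le (s := univ.filter (fun b ↦ ∀ i, b + h i ∈ Y)) (f := fun b ↦ b + h i₀)
      (t := Y) (D := 1)
      (fun b hb ↦ (Finset.mem_filter.1 hb).2 i₀) (fun y _ ↦ ?_) hW0).trans (by simp)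
    refine Finset.card_le_one.2 fun x hx x' hx' ↦ ?_
    exact add_right_cancel ((Finset.mem_filter.1 hx).2.trans (Finset.mem_filter.1 hx').2.symm)
  calc _ = ∑ ω ∈ T, (N : ℝ) ^ 2 * ∏ i, ‖∑ b ∈ Y, χ ω i b‖ ^ 2 := by rw [Finset.mul_sum]
    _ ≤ ∑ ω ∈ T, (N : ℝ) ^ Fintype.card ι * ∑ h : ι → ZMod N,
        ‖∑ b ∈ univ.filter (fun b ↦ ∀ i, b + h i ∈ Y), ∏ i, χ ω i (b + h i)‖ ^ 2 :=
        Finset.sum_le_sum fun ω _ ↦ prod_norm_sum_sq_le Y (χ ω)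
    _ = (N : ℝ) ^ Fintype.card ι * ∑ h : ι → ZMod N, ∑ ω ∈ T,
        ‖∑ b ∈ univ.filter (fun b ↦ ∀ i, b + h i ∈ Y), ∏ i, χ ω i (b + h i)‖ ^ 2 := by
        rw [← Finset.mul_sum, Finset.sum_comm]
    _ ≤ (N : ℝ) ^ Fintype.card ι * ∑ _h : ι → ZMod N, ∑ b ∈ Y, ∑ b' ∈ Y, W (b - b') := by
        gcongr with h _
        exact hsum h
    _ = _ := by
        rw [Finset.sum_const, Finset.card_univ, Fintype.card_fun, ZMod.card, nsmul_eq_mul]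
        push_cast
        ring

/-- The bias of a sum of bilinear forms is bounded below by the product of the biases. -/
lemma prod_bias_le {ι : Type*} [Fintype ι] [Nonempty ι] {γ : ι → ZMod N → ZMod N → ZMod N}
    (hγ : ∀ i, BiaddOn S (γ i)) (hS : ∀ a ∈ Y, ∀ b ∈ Y, a - b ∈ S) (hY : Y.Nonempty) :
    (N : ℝ) ^ 4 * ∏ i, bias (γ i) Y ≤
      ((N : ℝ) ^ Fintype.card ι) ^ 4 * bias (fun u v ↦ ∑ i, γ i u v) Y := by
  classical
  obtain ⟨y₀, hy₀⟩ := hY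
  have hΓ : BiaddOn S fun u v ↦ ∑ i, γ i u v := by
    simpa using BiaddOn.sum univ (fun _ ↦ 1) fun i _ ↦ hγ i
  -- The half-collapsed form: the first variable is already common to all γ i, the second variables
  -- are still independent. Going from the product of biases to W₁ merges the first variables
  -- (`h1`); going from W₁ to the bias of the sum merges the second ones (`h2`).
  obtain ⟨W₁, hW₁⟩ : ∃ W₁ : ZMod N → ℝ, ∀ t, W₁ t =
    ∏ i, ‖∑ b ∈ Y, (ZMod.stdAddChar (γ i t (b - y₀)) : ℂ)‖ ^ 2 := ⟨_, fun _ ↦ rfl⟩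
  have h1 : (N : ℝ) ^ 2 * ∏ i, bias (γ i) Y ≤
      ((N : ℝ) ^ Fintype.card ι) ^ 2 * ∑ a ∈ Y, ∑ a' ∈ Y, W₁ (a - a') := by
    have e : ∏ i, bias (γ i) Y = ∑ ω ∈ Fintype.piFinset (fun _ : ι ↦ Y ×ˢ Y),
        ∏ i, ‖∑ a ∈ Y, (ZMod.stdAddChar (γ i (a - y₀) ((ω i).1 - (ω i).2)) : ℂ)‖ ^ 2 := by
      refine Eq.trans (Finset.prod_congr rfl fun i _ ↦ ?_)
        (Finset.prod_univ_sum (κ := fun _ : ι ↦ ZMod N × ZMod N) (fun _ : ι ↦ Y ×ˢ Y)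
          (fun i ω ↦ ‖∑ a ∈ Y, (ZMod.stdAddChar (γ i (a - y₀) (ω.1 - ω.2)) : ℂ)‖ ^ 2))
      rw [(hγ i).bias_eq_left hS hy₀, Finset.sum_product]
    rw [e]
    refine sum_prod_norm_sum_sq_le Y (Fintype.piFinset (fun _ : ι ↦ Y ×ˢ Y))
      (fun ω i a ↦ ZMod.stdAddChar (γ i (a - y₀) ((ω i).1 - (ω i).2))) W₁
      (fun b _ b' _ ↦ by rw [hW₁]; exact Finset.prod_nonneg fun i _ ↦ by positivity) ?_
    intro h b b' hb hb'
    have hbb' : b - b' ∈ S := by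
      obtain ⟨i⟩ := ‹Nonempty ι›
      have := hS _ (hb i) _ (hb' i)
      rwa [add_sub_add_right_eq_sub] at this
    rw [hW₁]
    push_cast
    rw [Finset.prod_congr rfl fun i _ ↦ by
      rw [← Complex.ofReal_pow, ← (hγ i).sum_right_eq hS hy₀ hbb', ← Finset.sum_product'],
      Finset.prod_univ_sum]
    refine Finset.sum_congr rfl fun ω hω ↦ Finset.prod_congr rfl fun i _ ↦ ?_
    have hωi := Finset.mem_product.1 (Fintype.mem_piFinset.1 hω i)
    rw [stdAddChar_mul_conj, ← (hγ i).sub_left hS hy₀ (hb i) (hb' i) (hS _ hωi.1 _ hωi.2),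
      add_sub_add_right_eq_sub]
  have h2 : (N : ℝ) ^ 2 * ∑ a ∈ Y, ∑ a' ∈ Y, W₁ (a - a') ≤
      ((N : ℝ) ^ Fintype.card ι) ^ 2 * bias (fun u v ↦ ∑ i, γ i u v) Y := by
    rw [hΓ.bias_eq_left hS hy₀, ← Finset.sum_product']
    simp only [hW₁]
    refine sum_prod_norm_sum_sq_le Y (Y ×ˢ Y)
      (fun ω i b ↦ ZMod.stdAddChar (γ i (ω.1 - ω.2) (b - y₀)))
      (fun t ↦ ‖∑ a ∈ Y, (ZMod.stdAddChar (∑ i, γ i (a - y₀) t) : ℂ)‖ ^ 2)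
      (fun b _ b' _ ↦ by positivity) ?_
    intro h b b' hb hb'
    have hbb' : b - b' ∈ S := by
      obtain ⟨i⟩ := ‹Nonempty ι›
      have := hS _ (hb i) _ (hb' i)
      rwa [add_sub_add_right_eq_sub] at this
    rw [← hΓ.sum_left_eq hS hy₀ hbb', ← Finset.sum_product']
    refine Finset.sum_congr rfl fun ω hω ↦ ?_
    have hω' := Finset.mem_product.1 hω
    rw [stdAddChar_sum]
    refine Finset.prod_congr rfl fun i _ ↦ ?_
    rw [stdAddChar_mul_conj, ← (hγ i).sub_right hS hy₀ (hS _ hω'.1 _ hω'.2) (hb i) (hb' i),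
      add_sub_add_right_eq_sub]
  calc _ = (N : ℝ) ^ 2 * ((N : ℝ) ^ 2 * ∏ i, bias (γ i) Y) := by ring
    _ ≤ (N : ℝ) ^ 2 * (((N : ℝ) ^ Fintype.card ι) ^ 2 * ∑ a ∈ Y, ∑ a' ∈ Y, W₁ (a - a')) := by
        gcongr
    _ = ((N : ℝ) ^ Fintype.card ι) ^ 2 * ((N : ℝ) ^ 2 * ∑ a ∈ Y, ∑ a' ∈ Y, W₁ (a - a')) := by ring
    _ ≤ ((N : ℝ) ^ Fintype.card ι) ^ 2 *
        (((N : ℝ) ^ Fintype.card ι) ^ 2 * bias (fun u v ↦ ∑ i, γ i u v) Y) := by gcongr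
    _ = _ := by ring

/-- Two applications of the Cauchy–Schwarz inequality. -/
lemma norm_sum_pow_four_le (f : ZMod N → ZMod N → ℂ)
    (hf : ∀ a ∈ Y, ∀ a' ∈ Y, ∀ b ∈ Y, ∀ b' ∈ Y,
      f a b * starRingEnd ℂ (f a' b) * starRingEnd ℂ (f a b') * f a' b' =
        ZMod.stdAddChar (β (a - a') (b - b'))) :
    ‖∑ a ∈ Y, ∑ b ∈ Y, f a b‖ ^ 4 ≤ (Y.card : ℝ) ^ 4 * bias β Y := by
  have h1 : ‖∑ a ∈ Y, ∑ b ∈ Y, f a b‖ ^ 2 ≤ Y.card *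
      ∑ p ∈ Y ×ˢ Y, ‖∑ b ∈ Y, f p.1 b * starRingEnd ℂ (f p.2 b)‖ := by
    rw [Finset.sum_comm]
    calc _ ≤ (∑ b ∈ Y, ‖∑ a ∈ Y, f a b‖) ^ 2 :=
          pow_le_pow_left₀ (norm_nonneg _) (norm_sum_le _ _) 2
      _ ≤ Y.card * ∑ b ∈ Y, ‖∑ a ∈ Y, f a b‖ ^ 2 := sq_sum_le_card_mul_sum_sq
      _ ≤ _ := by
        gcongr
        have e : ((∑ b ∈ Y, ‖∑ a ∈ Y, f a b‖ ^ 2 : ℝ) : ℂ) =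
            ∑ p ∈ Y ×ˢ Y, ∑ b ∈ Y, f p.1 b * starRingEnd ℂ (f p.2 b) := by
          rw [Finset.sum_comm]
          push_cast
          refine Finset.sum_congr rfl fun b _ ↦ ?_
          rw [← Complex.ofReal_pow, norm_sum_sq_eq, Finset.sum_product]
        rw [← Real.norm_of_nonneg (show 0 ≤ ∑ b ∈ Y, ‖∑ a ∈ Y, f a b‖ ^ 2 by positivity),
          ← Complex.norm_real, e]
        exact norm_sum_le _ _
  calc _ = (‖∑ a ∈ Y, ∑ b ∈ Y, f a b‖ ^ 2) ^ 2 := by ring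
    _ ≤ (Y.card * ∑ p ∈ Y ×ˢ Y, ‖∑ b ∈ Y, f p.1 b * starRingEnd ℂ (f p.2 b)‖) ^ 2 := by gcongr
    _ = (Y.card : ℝ) ^ 2 *
        (∑ p ∈ Y ×ˢ Y, ‖∑ b ∈ Y, f p.1 b * starRingEnd ℂ (f p.2 b)‖) ^ 2 := by ring
    _ ≤ (Y.card : ℝ) ^ 2 * ((Y ×ˢ Y).card *
        ∑ p ∈ Y ×ˢ Y, ‖∑ b ∈ Y, f p.1 b * starRingEnd ℂ (f p.2 b)‖ ^ 2) := by
        gcongr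
        exact sq_sum_le_card_mul_sum_sq
    _ = _ := by
        have e : ((∑ p ∈ Y ×ˢ Y, ‖∑ b ∈ Y, f p.1 b * starRingEnd ℂ (f p.2 b)‖ ^ 2 : ℝ) : ℂ) =
            ∑ a ∈ Y, ∑ a' ∈ Y, ∑ b ∈ Y, ∑ b' ∈ Y,
              (ZMod.stdAddChar (β (a - a') (b - b')) : ℂ) := by
          rw [Finset.sum_product]
          push_cast
          refine Finset.sum_congr rfl fun a ha ↦ Finset.sum_congr rfl fun a' ha' ↦ ?_
          rw [← Complex.ofReal_pow, norm_sum_sq_eq]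
          refine Finset.sum_congr rfl fun b hb ↦ Finset.sum_congr rfl fun b' hb' ↦ ?_
          rw [← hf a ha a' ha' b hb b' hb', map_mul, Complex.conj_conj]
          ring
        rw [bias, ← e, Complex.ofReal_re, Finset.card_product]
        push_cast
        ring

end Bias

/-! ### Shrinking progressions, and second differences of quadratic maps. -/

section Progressions

variable {N : ℕ}

/-- The differences of elements of `P`. -/
def diffSet (P : Finset (ZMod N)) : Set (ZMod N) :=
  {x | ∃ p ∈ P, ∃ p' ∈ P, x = p - p'}

/-- A generalized arithmetic progression contains a large piece whose small multiples stay inside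
it. -/
lemma IsGAP.exists_shrink {P : Finset (ZMod N)} {d : ℕ} (hP : IsGAP P d) {κ : ℕ} (hκ : 0 < κ) :
    ∃ (P' : Finset (ZMod N)) (t : ZMod N), P.card ≤ κ ^ d * P'.card ∧
      (∀ {ι : Type} (s : Finset ι) (m : ι → ℤ) (y y' : ι → ZMod N), (∀ i ∈ s, y i ∈ P') →
        (∀ i ∈ s, y' i ∈ P') → ∑ i ∈ s, |m i| ≤ κ →
        ∑ i ∈ s, (m i : ZMod N) * (y i - y' i) ∈ diffSet P) ∧
      ∀ D : ℕ, D ≤ κ → ∀ y ∈ P', t + D * y ∈ P := by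
  classical
  obtain ⟨x₀, v, l, hl, hP⟩ := hP
  -- The side is chosen so that κ(l' - 1) ≤ l - 1, which keeps κ-fold combinations inside, and l ≤ κ
  -- l', which keeps the density. The offset x₀ is dropped so that `Q` starts at 0.
  set l' : Fin d → ℕ := fun i ↦ (l i - 1) / κ + 1 with hl'
  have h1 : ∀ i, κ * (l' i - 1) ≤ l i - 1 := fun i ↦ by
    simp only [hl', Nat.add_sub_cancel]
    exact Nat.mul_div_le _ _
  have h2 : ∀ i, l i ≤ κ * l' i := fun i ↦ by
    have := Nat.lt_mul_div_succ (l i - 1) hκ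
    have := hl i
    simp only [hl']
    omega
  have h0 : ∀ i, 0 < l' i := fun i ↦ Nat.succ_pos _
  let F : (Fin d → ℕ) → ZMod N := fun a ↦ ∑ i, (a i : ZMod N) * v i
  let Q := (Fintype.piFinset fun i ↦ range (l' i)).image F
  have hQ : ∀ y, y ∈ Q ↔ ∃ a : Fin d → ℕ, (∀ i, a i < l' i) ∧ F a = y := fun y ↦ by
    simp [Q]
  refine ⟨Q, x₀, ?_, ?_, ?_⟩
  -- Division with remainder by l' i leaves quotients below κ, so κ^d translates of `Q` cover P.
  · have hsub : P ⊆ ((Fintype.piFinset fun _ : Fin d ↦ range κ) ×ˢ Q).image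
        fun p ↦ x₀ + F (fun i ↦ p.1 i * l' i) + p.2 := by
      intro x hx
      obtain ⟨a, ha, rfl⟩ := (hP x).1 hx
      refine Finset.mem_image.2 ⟨(fun i ↦ a i / l' i, F fun i ↦ a i % l' i), ?_, ?_⟩
      · refine Finset.mem_product.2 ⟨Fintype.mem_piFinset.2 fun i ↦ Finset.mem_range.2 ?_,
          (hQ _).2 ⟨_, fun i ↦ Nat.mod_lt _ (h0 i), rfl⟩⟩
        rw [Nat.div_lt_iff_lt_mul (h0 i)]
        exact (ha i).trans_le (h2 i)
      · simp only [F, add_assoc, ← Finset.sum_add_distrib, ← add_mul]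
        congr 1
        refine Finset.sum_congr rfl fun i _ ↦ ?_
        congr 1
        have := Nat.div_add_mod' (a i) (l' i)
        exact_mod_cast congrArg (Nat.cast : ℕ → ZMod N) this
    calc P.card ≤ _ := Finset.card_le_card hsub
      _ ≤ _ := Finset.card_image_le
      _ = _ := by simp
  · intro ι s m y y' hy hy' hm
    choose! a ha hya using fun i hi ↦ (hQ _).1 (hy i hi)
    choose! a' ha' hya' using fun i hi ↦ (hQ _).1 (hy' i hi)
    set e : Fin d → ℤ := fun n ↦ ∑ i ∈ s, m i * ((a i n : ℤ) - a' i n) with he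
    have hle : ∀ n, |e n| ≤ l n - 1 := by
      intro n
      have hb : ∀ i ∈ s, |m i * ((a i n : ℤ) - a' i n)| ≤ |m i| * ((l' n - 1 : ℕ) : ℤ) := by
        intro i hi
        rw [abs_mul]
        refine mul_le_mul_of_nonneg_left ?_ (abs_nonneg _)
        have := ha i hi n
        have := ha' i hi n
        rw [abs_le]
        constructor <;> omega
      calc |e n| ≤ ∑ i ∈ s, |m i * ((a i n : ℤ) - a' i n)| := Finset.abs_sum_le_sum_abs _ _
        _ ≤ ∑ i ∈ s, |m i| * ((l' n - 1 : ℕ) : ℤ) := Finset.sum_le_sum hb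
        _ = (∑ i ∈ s, |m i|) * ((l' n - 1 : ℕ) : ℤ) := by rw [Finset.sum_mul]
        _ ≤ κ * ((l' n - 1 : ℕ) : ℤ) := mul_le_mul_of_nonneg_right hm (by positivity)
        _ ≤ ((l n - 1 : ℕ) : ℤ) := by exact_mod_cast h1 n
        _ = _ := by have := hl n; omega
    have hlt : ∀ n, (e n).toNat < l n ∧ (-e n).toNat < l n := by
      intro n
      have := abs_le.1 (hle n)
      have := hl n
      constructor <;> omega
    -- A coordinate vector with entries in (-l, l) is the difference of its positive and negative
    -- parts, both of which are admissible for P; x₀ cancels.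
    refine ⟨_, (hP _).2 ⟨fun n ↦ (e n).toNat, fun n ↦ (hlt n).1, rfl⟩,
      _, (hP _).2 ⟨fun n ↦ (-e n).toNat, fun n ↦ (hlt n).2, rfl⟩, ?_⟩
    rw [add_sub_add_left_eq_sub, ← Finset.sum_sub_distrib]
    have hE : ∀ n, ((e n).toNat : ZMod N) * v n - ((-e n).toNat : ZMod N) * v n =
        (e n : ZMod N) * v n := by
      intro n
      rw [← sub_mul]
      congr 1
      have : ((e n).toNat : ℤ) - ((-e n).toNat : ℤ) = e n := by omega
      exact_mod_cast congrArg (Int.cast : ℤ → ZMod N) this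
    refine Eq.trans ?_ (Finset.sum_congr rfl fun n _ ↦ (hE n).symm)
    simp only [he]
    push_cast
    simp only [Finset.sum_mul]
    rw [Finset.sum_comm]
    refine Finset.sum_congr rfl fun i hi ↦ ?_
    rw [← hya i hi, ← hya' i hi, ← Finset.sum_sub_distrib, Finset.mul_sum]
    exact Finset.sum_congr rfl fun n _ ↦ by ring
  · intro D hD y hy
    obtain ⟨a, ha, rfl⟩ := (hQ y).1 hy
    refine (hP _).2 ⟨fun i ↦ D * a i, fun i ↦ ?_, ?_⟩
    · have h3 : a i ≤ l' i - 1 := by have := ha i; omega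
      have := (Nat.mul_le_mul hD h3).trans (h1 i)
      have := hl i
      show D * a i < l i
      omega
    · simp only [F, Finset.mul_sum]
      push_cast
      simp only [mul_assoc]

/-- Some intersection of translates of given sets is large. -/
lemma exists_large_inter [NeZero N] {ι : Type*} [Fintype ι] [DecidableEq ι]
    (P : ι → Finset (ZMod N)) :
    ∃ (t : ι → ZMod N) (Y : Finset (ZMod N)), (∀ j, ∀ y ∈ Y, y + t j ∈ P j) ∧
      N * ∏ j, (P j).card ≤ N ^ Fintype.card ι * Y.card := by
  -- For fixed y the tuples t correspond to tuples in ∏ P j via t ↦ y + t, so an intersection of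
  -- translates has average size N ∏|P j| / N^|ι|.
  have h : ∑ t : ι → ZMod N, (univ.filter fun y : ZMod N ↦ ∀ j, y + t j ∈ P j).card =
      N * ∏ j, (P j).card := by
    simp only [Finset.card_filter]
    rw [Finset.sum_comm, Finset.sum_congr rfl (g := fun _ ↦ ∏ j, (P j).card)]
    · simp
    · intro y _
      rw [← Finset.card_filter, ← Fintype.card_piFinset]
      refine Finset.card_nbij' (fun t j ↦ y + t j) (fun p j ↦ p j - y) ?_ ?_ ?_ ?_
      · intro t ht
        simpa using ht
      · intro p hp
        simpa using hp
      · intro t _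
        ext j
        simp
      · intro p _
        ext j
        simp
  obtain ⟨t, -, ht⟩ := Finset.exists_max_image univ
    (fun t : ι → ZMod N ↦ (univ.filter fun y : ZMod N ↦ ∀ j, y + t j ∈ P j).card) univ_nonempty
  refine ⟨t, univ.filter fun y : ZMod N ↦ ∀ j, y + t j ∈ P j, fun j y hy ↦ (Finset.mem_filter.1 hy).2 j, ?_⟩
  rw [← h]
  refine (Finset.sum_le_card_nsmul _ _ _ ht).trans (le_of_eq ?_)
  rw [Finset.card_univ, Fintype.card_fun, ZMod.card, smul_eq_mul]

/-- The second difference of `q` at `0`. -/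
def polar (q : ZMod N → ZMod N) (u v : ZMod N) : ZMod N :=
  q (u + v) - q u - q v + q 0

lemma diffSet_add_mem {P B : Finset (ZMod N)}
    (h : ∀ a ∈ P, ∀ a' ∈ P, ∀ b ∈ P, ∀ b' ∈ P, a + b - a' - b' ∈ B) {u v : ZMod N}
    (hu : u ∈ diffSet P) (hv : v ∈ diffSet P) : u + v ∈ B := by
  obtain ⟨a, ha, a', ha', rfl⟩ := hu
  obtain ⟨b, hb, b', hb', rfl⟩ := hv
  have := h a ha a' ha' b hb b' hb'
  rwa [show a - a' + (b - b') = a + b - a' - b' by ring]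

lemma zero_mem_diffSet {P : Finset (ZMod N)} (hP : P.Nonempty) : (0 : ZMod N) ∈ diffSet P := by
  obtain ⟨p, hp⟩ := hP
  exact ⟨p, hp, p, hp, (sub_self p).symm⟩

lemma diffSet_mem {P B : Finset (ZMod N)}
    (h : ∀ a ∈ P, ∀ a' ∈ P, ∀ b ∈ P, ∀ b' ∈ P, a + b - a' - b' ∈ B) {u : ZMod N}
    (hu : u ∈ diffSet P) : u ∈ B := by
  have h0 : (0 : ZMod N) ∈ diffSet P := by
    obtain ⟨a, ha, -⟩ := hu
    exact zero_mem_diffSet ⟨a, ha⟩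
  simpa using diffSet_add_mem h hu h0

/-- Additivity in the first variable is the vanishing third difference on the cube at 0 with edges
u, u', v; all its vertices are sums of two elements of `diffSet P`, hence in B. The second variable
follows by symmetry. -/
lemma biaddOn_polar {P B : Finset (ZMod N)} {q : ZMod N → ZMod N}
    (hq : IsQuadraticOn (B : Set (ZMod N)) q)
    (h : ∀ a ∈ P, ∀ a' ∈ P, ∀ b ∈ P, ∀ b' ∈ P, a + b - a' - b' ∈ B) :
    BiaddOn (diffSet P) (polar q) := by
  have key : ∀ u u' v, u ∈ diffSet P → u' ∈ diffSet P → u + u' ∈ diffSet P → v ∈ diffSet P →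
      polar q (u + u') v = polar q u v + polar q u' v := by
    intro u u' v hu hu' huu' hv
    have h0 : (0 : ZMod N) ∈ B := by
      obtain ⟨a, ha, -⟩ := hu
      exact diffSet_mem h (zero_mem_diffSet ⟨a, ha⟩)
    have := hq 0 u u' v h0 (by simpa using diffSet_mem h hu) (by simpa using diffSet_mem h hu')
      (by simpa using diffSet_mem h hv) (by simpa using diffSet_mem h huu')
      (by simpa using diffSet_add_mem h hu hv) (by simpa using diffSet_add_mem h hu' hv)
      (by simpa using diffSet_add_mem h huu' hv)
    simp only [zero_add] at this
    unfold polar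
    linear_combination -this
  refine ⟨key, fun u v v' hu hv hv' hvv' ↦ ?_⟩
  have hsymm : ∀ x y, polar q x y = polar q y x := fun x y ↦ by
    unfold polar; rw [add_comm x y]; ring
  rw [hsymm u, hsymm u, hsymm u]
  exact key v v' u hv hv' hvv' hu

/-- The second difference of `q` at a point of a translate. -/
lemma IsQuadraticOn.sub_eq_polar {A : Set (ZMod N)} {q : ZMod N → ZMod N}
    (hq : IsQuadraticOn A q) {w u v : ZMod N} (h0 : (0 : ZMod N) ∈ A) (hu : u ∈ A) (hv : v ∈ A)
    (huv : u + v ∈ A) (hw : w ∈ A) (hwu : w + u ∈ A) (hwv : w + v ∈ A) (hwuv : w + u + v ∈ A) :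
    q (w + u + v) - q (w + u) - q (w + v) + q w = polar q u v := by
  have := hq 0 u v w h0 (by simpa using hu) (by simpa using hv) (by simpa using hw)
    (by simpa using huv) (by rw [zero_add, add_comm]; exact hwu)
    (by rw [zero_add, add_comm]; exact hwv)
    (by rw [zero_add, add_comm, ← add_assoc]; exact hwuv)
  simp only [zero_add] at this
  rw [show u + w = w + u by ring, show v + w = w + v by ring,
    show u + v + w = w + u + v by ring] at this
  unfold polar
  linear_combination -this

lemma BiaddOn.flip {S : Set (ZMod N)} {β : ZMod N → ZMod N → ZMod N} (h : BiaddOn S β) :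
    BiaddOn S fun u v ↦ β v u :=
  ⟨fun u u' v hu hu' huu' hv ↦ h.2 v u u' hv hu hu' huu',
    fun u v v' hu hv hv' hvv' ↦ h.1 v v' u hv hv' hvv' hu⟩

/-- Additivity is only local, so every intermediate multiple of u has to lie in S; this is why all
|m| ≤ κ appear in the hypothesis. -/
lemma BiaddOn.intCast_mul_left {S : Set (ZMod N)} {β : ZMod N → ZMod N → ZMod N}
    (h : BiaddOn S β) {κ : ℕ} {u v : ZMod N}
    (hu : ∀ m : ℤ, |m| ≤ κ → (m : ZMod N) * u ∈ S) (hv : v ∈ S) (m : ℤ) (hm : |m| ≤ κ) :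
    β (m * u) v = m * β u v := by
  have h0 : β 0 v = 0 := by
    have hz : (0 : ZMod N) ∈ S := by simpa using hu 0 (by simp)
    have := h.1 0 0 v hz hz (by simpa using hz) hv
    simpa using this
  have hnat : ∀ n : ℕ, n ≤ κ → β (n * u) v = n * β u v := by
    intro n
    induction n with
    | zero => intro _; simp [h0]
    | succ n ih =>
      intro hn
      have e : ((n + 1 : ℕ) : ZMod N) * u = (n : ℕ) * u + u := by push_cast; ring
      have h1 : ((n : ℕ) : ZMod N) * u ∈ S := by
        have := hu n (by rw [abs_of_nonneg (by positivity)]; omega)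
        simpa using this
      have h2 : u ∈ S := by
        have := hu 1 (by simp; omega)
        simpa using this
      have h3 : ((n : ℕ) : ZMod N) * u + u ∈ S := by
        have := hu (n + 1 : ℕ) (by rw [abs_of_nonneg (by positivity)]; omega)
        rw [← e]
        simpa using this
      rw [e, h.1 _ _ _ h1 h2 h3 hv, ih (by omega)]
      push_cast
      ring
  rcases le_total 0 m with hm0 | hm0
  · obtain ⟨n, rfl⟩ := Int.eq_ofNat_of_zero_le hm0
    have := hnat n (by rw [abs_of_nonneg hm0] at hm; exact_mod_cast hm)
    simpa using this
  · obtain ⟨n, hn⟩ := Int.eq_ofNat_of_zero_le (neg_nonneg.2 hm0)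
    have hnκ : n ≤ κ := by rw [abs_of_nonpos hm0, hn] at hm; exact_mod_cast hm
    have hmn : m = -(n : ℤ) := by omega
    subst hmn
    have h1 : ((n : ℕ) : ZMod N) * u ∈ S := by
      have := hu n (by rw [abs_of_nonneg (by positivity)]; exact_mod_cast hnκ)
      simpa using this
    have h2 := hu _ hm
    have h3 : ((n : ℕ) : ZMod N) * u + ((-(n : ℤ) : ℤ) : ZMod N) * u = 0 := by push_cast; ring
    have h4 := h.1 _ _ v h1 h2 (by rw [h3]; simpa using hu 0 (by simp)) hv
    rw [h3, h0, hnat n hnκ] at h4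
    push_cast at h4 ⊢
    linear_combination -h4

/-- Multiplication by `D` has fibres of size at most `D`. -/
lemma card_filter_add_mul_eq_le [NeZero N] (Y : Finset (ZMod N)) (t x : ZMod N) {D : ℕ}
    (hD : 0 < D) : (Y.filter fun y ↦ t + D * y = x).card ≤ D := by
  classical
  rcases (Y.filter fun y ↦ t + D * y = x).eq_empty_or_nonempty with h | ⟨y₁, hy₁⟩
  · simp [h]
  -- N may share factors with D, so multiplication by D need not be injective; a cyclic group still
  -- has at most D elements annihilated by D.
  · refine le_trans ?_ (IsAddCyclic.card_nsmul_eq_zero_le (α := ZMod N) hD)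
    refine Finset.card_le_card_of_injOn (fun y ↦ y - y₁) ?_ fun a _ b _ hab ↦ sub_left_injective hab
    intro y hy
    have e1 := (Finset.mem_filter.1 hy).2
    have e2 := (Finset.mem_filter.1 hy₁).2
    refine Finset.mem_coe.2 (Finset.mem_filter.2 ⟨Finset.mem_univ _, ?_⟩)
    rw [nsmul_eq_mul]
    linear_combination e1 - e2

end Progressions

/-! ### Rank in terms of bias. -/

section Rank

variable {N : ℕ} [NeZero N]

lemma BiaddOn.bias_nonneg {S : Set (ZMod N)} {β : ZMod N → ZMod N → ZMod N} {Y : Finset (ZMod N)}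
    (h : BiaddOn S β) (hS : ∀ a ∈ Y, ∀ b ∈ Y, a - b ∈ S) : 0 ≤ bias β Y := by
  rcases Y.eq_empty_or_nonempty with rfl | ⟨y₀, hy₀⟩
  · simp [bias]
  · rw [h.bias_eq_left hS hy₀]
    positivity

/-- The bias of a multiple of `β` on a small set is at most that of `β` on a larger set. -/
lemma BiaddOn.bias_natCast_mul_le {P Y : Finset (ZMod N)} {β : ZMod N → ZMod N → ZMod N}
    (h : BiaddOn (diffSet P) β) {D : ℕ} (hD : 0 < D) {t t' : ZMod N}
    (hY : ∀ y ∈ Y, t' + y ∈ P) (hDY : ∀ y ∈ Y, t + D * y ∈ P)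
    (hmul : ∀ a ∈ Y, ∀ a' ∈ Y, ∀ v ∈ diffSet P, β (D * (a - a')) v = D * β (a - a') v) :
    bias (fun u v ↦ D * β u v) Y ≤ D ^ 2 * bias β P := by
  rcases Y.eq_empty_or_nonempty with rfl | ⟨y₀, hy₀⟩
  · have := h.bias_nonneg (Y := P) fun a ha b hb ↦ ⟨a, ha, b, hb, rfl⟩
    simp only [bias, Finset.sum_empty, Complex.zero_re]
    positivity
  have hYΔ : ∀ a ∈ Y, ∀ b ∈ Y, a - b ∈ diffSet P := fun a ha b hb ↦
    ⟨t' + a, hY a ha, t' + b, hY b hb, by ring⟩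
  have hPΔ : ∀ a ∈ P, ∀ b ∈ P, a - b ∈ diffSet P := fun a ha b hb ↦ ⟨a, ha, b, hb, rfl⟩
  have hp₀ := hY y₀ hy₀
  -- The factor D moves into the first variable, and y ↦ t + Dy maps Y to P with fibres of size at
  -- most D. Since the summands are squares, the first variable may then run over P; after
  -- exchanging the roles, a translation does the same for the second.
  calc bias (fun u v ↦ D * β u v) Y
      = ∑ a ∈ Y, ∑ a' ∈ Y, ‖∑ b ∈ Y,
          (ZMod.stdAddChar (β ((t + D * a) - (t + D * a')) (b - y₀)) : ℂ)‖ ^ 2 := by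
        have h' : BiaddOn (diffSet P) fun u v ↦ D * β u v := by
          simpa using BiaddOn.sum (univ : Finset Unit) (fun _ ↦ (D : ZMod N)) fun _ _ ↦ h
        rw [h'.bias_eq_right hYΔ hy₀]
        refine Finset.sum_congr rfl fun a ha ↦ Finset.sum_congr rfl fun a' ha' ↦ ?_
        congr 2
        refine Finset.sum_congr rfl fun b hb ↦ ?_
        rw [← hmul a ha a' ha' _ (hYΔ b hb y₀ hy₀)]
        congr 2
        ring
    _ ≤ D ^ 2 * ∑ p ∈ P, ∑ p' ∈ P, ‖∑ b ∈ Y,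
          (ZMod.stdAddChar (β (p - p') (b - y₀)) : ℂ)‖ ^ 2 :=
        sum_sum_sub_le (f := fun y ↦ t + D * y)
          (W := fun x ↦ ‖∑ b ∈ Y, (ZMod.stdAddChar (β x (b - y₀)) : ℂ)‖ ^ 2) hDY
          (fun x _ ↦ card_filter_add_mul_eq_le Y t x hD) fun _ _ _ _ ↦ by positivity
    _ = D ^ 2 * ∑ b ∈ Y, ∑ b' ∈ Y, ‖∑ p ∈ P,
          (ZMod.stdAddChar (β (p - (t' + y₀)) ((t' + b) - (t' + b'))) : ℂ)‖ ^ 2 := by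
        congr 1
        rw [← Complex.ofReal_inj]
        push_cast
        have e1 : ∀ p ∈ P, ∀ p' ∈ P,
            ((‖∑ b ∈ Y, (ZMod.stdAddChar (β (p - p') (b - y₀)) : ℂ)‖ : ℂ)) ^ 2 =
            ∑ b ∈ Y, ∑ b' ∈ Y, (ZMod.stdAddChar (β (p - p') (b - b')) : ℂ) := by
          intro p hp p' hp'
          rw [h.sum_right_eq hYΔ hy₀ (hPΔ p hp p' hp'), Complex.ofReal_pow]
        have e2 : ∀ b ∈ Y, ∀ b' ∈ Y,
            ((‖∑ p ∈ P, (ZMod.stdAddChar (β (p - (t' + y₀)) ((t' + b) - (t' + b'))) : ℂ)‖ : ℂ)) ^ 2 =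
            ∑ p ∈ P, ∑ p' ∈ P, (ZMod.stdAddChar (β (p - p') (b - b')) : ℂ) := by
          intro b hb b' hb'
          rw [add_sub_add_left_eq_sub, h.sum_left_eq hPΔ hp₀ (hYΔ b hb b' hb'), Complex.ofReal_pow]
        rw [Finset.sum_congr rfl fun p hp ↦ Finset.sum_congr rfl fun p' hp' ↦ e1 p hp p' hp',
          Finset.sum_congr rfl fun b hb ↦ Finset.sum_congr rfl fun b' hb' ↦ e2 b hb b' hb']
        have := Finset.sum_comm (s := P ×ˢ P) (t := Y ×ˢ Y)
          (f := fun p b ↦ (ZMod.stdAddChar (β (p.1 - p.2) (b.1 - b.2)) : ℂ))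
        simpa only [Finset.sum_product] using this
    _ ≤ D ^ 2 * (((1 : ℕ) : ℝ) ^ 2 * ∑ b ∈ P, ∑ b' ∈ P, ‖∑ p ∈ P,
          (ZMod.stdAddChar (β (p - (t' + y₀)) (b - b')) : ℂ)‖ ^ 2) := by
        gcongr
        refine sum_sum_sub_le (f := fun y ↦ t' + y)
          (W := fun x ↦ ‖∑ p ∈ P, (ZMod.stdAddChar (β (p - (t' + y₀)) x) : ℂ)‖ ^ 2) hY
          (fun x _ ↦ ?_) fun _ _ _ _ ↦ by positivity
        refine Finset.card_le_one.2 fun y hy y' hy' ↦ ?_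
        exact add_left_cancel ((Finset.mem_filter.1 hy).2.trans (Finset.mem_filter.1 hy').2.symm)
    _ = D ^ 2 * bias β P := by
        rw [h.bias_eq_left hPΔ hp₀]
        norm_num

/-- The rank, expressed by the bias of the associated bilinear form. -/
lemma rank_eq_log {P B : Finset (ZMod N)} {q : ZMod N → ZMod N}
    (hq : IsQuadraticOn (B : Set (ZMod N)) q)
    (h : ∀ a ∈ P, ∀ a' ∈ P, ∀ b ∈ P, ∀ b' ∈ P, a + b - a' - b' ∈ B) :
    rank P q = Real.log (1 / (bias (polar q) P / (P.card : ℝ) ^ 4)) := by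
  have hβ := biaddOn_polar hq h
  rcases P.eq_empty_or_nonempty with rfl | ⟨p₀, hp₀⟩
  · simp [rank, bias]
  have hb0 := hβ.bias_nonneg (Y := P) fun a ha b hb ↦ ⟨a, ha, b, hb, rfl⟩
  have hreal : ∑ a ∈ P, ∑ a' ∈ P, ∑ b ∈ P, ∑ b' ∈ P,
      (ZMod.stdAddChar (polar q (a - a') (b - b')) : ℂ) = ((bias (polar q) P : ℝ) : ℂ) := by
    rw [hβ.bias_eq_right (fun a ha b hb ↦ ⟨a, ha, b, hb, rfl⟩) hp₀]
    push_cast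
    refine Finset.sum_congr rfl fun a ha ↦ Finset.sum_congr rfl fun a' ha' ↦ ?_
    rw [hβ.sum_right_eq (fun a ha b hb ↦ ⟨a, ha, b, hb, rfl⟩) hp₀ ⟨a, ha, a', ha', rfl⟩,
      Complex.ofReal_pow]
  -- The phase defining the rank differs from `polar q` only by the constant q 0, which the modulus
  -- ignores.
  have hsplit : ∀ a a' b b' : ZMod N,
      (ZMod.stdAddChar (q (a + b - a' - b') - q (a - a') - q (b - b')) : ℂ) =
        ZMod.stdAddChar (-q 0) * ZMod.stdAddChar (polar q (a - a') (b - b')) := by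
    intro a a' b b'
    rw [← AddChar.map_add_eq_mul, polar, show a - a' + (b - b') = a + b - a' - b' by ring]
    congr 1
    ring
  rw [rank]
  congr 2
  simp only [hsplit, Finset.expect_eq_sum_div_card, ← Finset.mul_sum, ← Finset.sum_div,
    mul_div_assoc]
  rw [hreal, norm_mul, norm_stdAddChar, one_mul]
  simp only [norm_div, Complex.norm_real, Complex.norm_natCast, Real.norm_of_nonneg hb0]
  field_simp

lemma bias_le (β : ZMod N → ZMod N → ZMod N) (Y : Finset (ZMod N)) :
    bias β Y ≤ (Y.card : ℝ) ^ 4 := by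
  refine (Complex.re_le_norm _).trans ?_
  have : ∀ (g : ZMod N → ℂ) (M : ℝ), (∀ a ∈ Y, ‖g a‖ ≤ M) → ‖∑ a ∈ Y, g a‖ ≤ Y.card * M :=
    fun g M hg ↦ (norm_sum_le_of_le _ hg).trans (by simp)
  refine (this _ (Y.card * (Y.card * (Y.card * 1))) fun a _ ↦ this _ _ fun a' _ ↦
    this _ _ fun b _ ↦ this _ _ fun b' _ ↦ (norm_stdAddChar _).le).trans (le_of_eq (by ring))

/-- A power of the normalized bias is controlled by the rank. -/
lemma bias_rpow_le {P B : Finset (ZMod N)} {q : ZMod N → ZMod N}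
    (hq : IsQuadraticOn (B : Set (ZMod N)) q)
    (h : ∀ a ∈ P, ∀ a' ∈ P, ∀ b ∈ P, ∀ b' ∈ P, a + b - a' - b' ∈ B) {R : ℝ} (hR : R ≤ rank P q)
    {r : ℕ} (hr : 0 < r) :
    (bias (polar q) P / (P.card : ℝ) ^ 4) ^ (1 / (4 * (r : ℝ))) ≤
      Real.exp (-R / (4 * (r : ℝ) ^ 3)) := by
  have hr1 : (1 : ℝ) ≤ r := by exact_mod_cast hr
  have hb0 : 0 ≤ bias (polar q) P / (P.card : ℝ) ^ 4 :=
    div_nonneg ((biaddOn_polar hq h).bias_nonneg fun a ha b hb ↦ ⟨a, ha, b, hb, rfl⟩)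
      (by positivity)
  have hb1 : bias (polar q) P / (P.card : ℝ) ^ 4 ≤ 1 :=
    div_le_one_of_le₀ (bias_le _ _) (by positivity)
  rw [rank_eq_log hq h] at hR
  set α := bias (polar q) P / (P.card : ℝ) ^ 4 with hα
  -- For zero bias the rank is log(1/0) = 0 by convention and `hR` says nothing about α, but then
  -- the left side is 0.
  rcases hb0.eq_or_lt with h0 | hpos
  · rw [← h0, Real.zero_rpow (by positivity)]
    positivity
  · have h1 : α ≤ Real.exp (-R) := by
      rw [one_div, Real.log_inv] at hR
      calc α = Real.exp (Real.log α) := (Real.exp_log hpos).symm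
        _ ≤ _ := Real.exp_le_exp.2 (by linarith)
    -- As α ≤ 1, the exponent may be lowered before inserting α ≤ e^{-R}; this works for either sign
    -- of R.
    calc α ^ (1 / (4 * (r : ℝ))) ≤ α ^ (1 / (4 * (r : ℝ) ^ 3)) := by
          refine Real.rpow_le_rpow_of_exponent_ge hpos hb1 ?_
          refine one_div_le_one_div_of_le (by positivity) ?_
          gcongr
          exact le_self_pow₀ hr1 (by norm_num)
      _ ≤ (Real.exp (-R)) ^ (1 / (4 * (r : ℝ) ^ 3)) := by gcongr
      _ = _ := by
          rw [← Real.exp_mul]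
          congr 1
          ring

end Rank

/-! ### Integer coefficients isolating one form. -/

section SquareIndependence

variable {r s : ℕ}

/-- The linear map Φ sends an array w to Σ w(u,v) X_u X_v, hence the array of products of
coefficients to L_j²; independence of images lifts to the arrays. -/
lemma SquareIndependent.linearIndependent {c : Fin r → Fin s → ℤ} (hc : SquareIndependent c) :
    LinearIndependent ℚ fun (j : Fin r) (p : Fin s × Fin s) ↦ ((c j p.1 * c j p.2 : ℤ) : ℚ) := by
  let Φ : (Fin s × Fin s → ℚ) →ₗ[ℚ] MvPolynomial (Fin s) ℚ :=
    ∑ p : Fin s × Fin s,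
      (LinearMap.proj p : (Fin s × Fin s → ℚ) →ₗ[ℚ] ℚ).smulRight
        (MvPolynomial.X p.1 * MvPolynomial.X p.2)
  refine LinearIndependent.of_comp Φ ?_
  unfold SquareIndependent at hc
  convert hc using 1
  funext j
  simp only [Function.comp, Φ, LinearMap.sum_apply, LinearMap.smulRight_apply, LinearMap.proj_apply]
  rw [sq, Finset.sum_mul_sum, Fintype.sum_prod_type]
  refine Finset.sum_congr rfl fun u _ ↦ Finset.sum_congr rfl fun v _ ↦ ?_
  rw [MvPolynomial.smul_eq_C_mul]
  push_cast
  rw [map_mul]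
  ring

lemma exists_det_ne_zero_of_linearIndependent {ι : Type*} [Fintype ι] {w : Fin r → ι → ℚ}
    (hw : LinearIndependent ℚ w) :
    ∃ e : Fin r → ι, (Matrix.of fun j i ↦ w j (e i)).det ≠ 0 := by
  classical
  have hrank : (Matrix.of w).rank = r := by
    simpa using LinearIndependent.rank_matrix (M := Matrix.of w) hw
  obtain ⟨κ, a, -, hspan, hli⟩ := exists_linearIndependent' ℚ (Matrix.of w).col
  have hfin : Finite κ := hli.finite
  have := Fintype.ofFinite κ
  have hcard : Fintype.card κ = r := by
    rw [← finrank_span_eq_card hli, hspan, ← Matrix.rank_eq_finrank_span_cols, hrank]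
  let f : Fin r ≃ κ := (Fintype.equivFinOfCardEq hcard).symm
  refine ⟨a ∘ f, ?_⟩
  have hli' : LinearIndependent ℚ (Matrix.of fun j i ↦ w j ((a ∘ f) i)).col :=
    hli.comp f f.injective
  exact ((Matrix.isUnit_iff_isUnit_det _).1
    (Matrix.linearIndependent_cols_iff_isUnit.1 hli')).ne_zero

/-- Explicit integer coefficients that isolate one form of a square independent system. -/
lemma SquareIndependent.exists_coefficients {c : Fin r → Fin s → ℤ} (hc : SquareIndependent c)
    {M : ℕ} (hM : ∀ j, ∑ u, |c j u| ≤ M) (hM1 : 1 ≤ M) (j₀ : Fin r) :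
    ∃ (u v : Fin r → Fin s) (n : Fin r → ℤ) (D : ℕ), 0 < D ∧ D ≤ r.factorial * M ^ (2 * r) ∧
      (∀ i, |n i| ≤ ((r.factorial * M ^ (2 * r) : ℕ) : ℤ)) ∧
      ∀ j, ∑ i, n i * (c j (u i) * c j (v i)) = if j = j₀ then (D : ℤ) else 0 := by
  obtain ⟨e, he⟩ := exists_det_ne_zero_of_linearIndependent hc.linearIndependent
  set A : Matrix (Fin r) (Fin r) ℤ := Matrix.of fun j i ↦ c j (e i).1 * c j (e i).2 with hA
  have hdet : A.det ≠ 0 := by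
    intro h0
    apply he
    have := congrArg (Int.cast : ℤ → ℚ) h0
    rw [Int.cast_det] at this
    simpa [hA, Matrix.map] using this
  have hcM : ∀ j u, |c j u| ≤ M := fun j u ↦
    (Finset.single_le_sum (f := fun u ↦ |c j u|) (fun _ _ ↦ abs_nonneg _) (mem_univ u)).trans (hM j)
  have hentry : ∀ j i, |A j i| ≤ (M : ℤ) ^ 2 := fun j i ↦ by
    rw [hA, Matrix.of_apply, abs_mul, sq]
    exact mul_le_mul (hcM _ _) (hcM _ _) (abs_nonneg _) (by positivity)
  have hbound : ∀ A' : Matrix (Fin r) (Fin r) ℤ, (∀ j i, |A' j i| ≤ (M : ℤ) ^ 2) →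
      |A'.det| ≤ ((r.factorial * M ^ (2 * r) : ℕ) : ℤ) := by
    intro A' hA'
    have := Matrix.det_le (abv := AbsoluteValue.abs) hA'
    rw [Fintype.card_fin, nsmul_eq_mul] at this
    refine this.trans (le_of_eq ?_)
    push_cast
    rw [pow_mul]
  have hM1' : (1 : ℤ) ≤ (M : ℤ) ^ 2 := one_le_pow₀ (by exact_mod_cast hM1)
  -- Cramer's rule: column j₀ of the adjugate solves the system with right side det A at j₀ and 0
  -- elsewhere; the sign makes D positive.
  refine ⟨fun i ↦ (e i).1, fun i ↦ (e i).2, fun i ↦ A.det.sign * A.adjugate i j₀, A.det.natAbs,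
    Int.natAbs_pos.2 hdet, ?_, ?_, ?_⟩
  · have := hbound A hentry
    rw [← Int.natCast_natAbs] at this
    exact_mod_cast this
  · intro i
    -- An adjugate entry is the determinant of A with one row replaced by a unit vector, whose
    -- entries obey the bound M² because M ≥ 1.
    rw [abs_mul, Int.abs_sign_of_ne_zero hdet, one_mul, Matrix.adjugate_apply]
    refine hbound _ fun j k ↦ ?_
    rw [Matrix.updateRow_apply]
    split_ifs
    · rw [Pi.single_apply]
      split_ifs
      · simpa using hM1'
      · simp
    · exact hentry j k
  · intro j
    have h := congrFun (congrFun (Matrix.mul_adjugate A) j) j₀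
    rw [Matrix.mul_apply, Matrix.smul_apply, Matrix.one_apply, smul_eq_mul] at h
    have h2 : ∑ i, A.det.sign * A.adjugate i j₀ * (c j (e i).1 * c j (e i).2) =
        A.det.sign * ∑ i, A j i * A.adjugate i j₀ := by
      rw [Finset.mul_sum]
      exact Finset.sum_congr rfl fun i _ ↦ by rw [hA, Matrix.of_apply]; ring
    rw [h2, h]
    split_ifs
    · rw [mul_one, Int.sign_mul_self_eq_natAbs]
    · simp

end SquareIndependence

/-! ### The local average of quadratic phases. -/

section LocalEstimate

variable {N : ℕ}

/-- Resampling one coordinate: the involution exchanging p i with an independent a ∈ Y preserves Y^ι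
× Y. -/
lemma card_mul_sum_piFinset {ι : Type*} [Fintype ι] [DecidableEq ι] (Y : Finset (ZMod N)) (i : ι)
    (f : (ι → ZMod N) → ℂ) :
    (Y.card : ℂ) * ∑ p ∈ Fintype.piFinset (fun _ : ι ↦ Y), f p =
      ∑ p ∈ Fintype.piFinset (fun _ : ι ↦ Y), ∑ a ∈ Y, f (Function.update p i a) := by
  have h : ∑ x ∈ Fintype.piFinset (fun _ : ι ↦ Y) ×ˢ Y, f (Function.update x.1 i x.2) =
      ∑ x ∈ Fintype.piFinset (fun _ : ι ↦ Y) ×ˢ Y, f x.1 := by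
    have hmem : ∀ x ∈ Fintype.piFinset (fun _ : ι ↦ Y) ×ˢ Y,
        (Function.update x.1 i x.2, x.1 i) ∈ Fintype.piFinset (fun _ : ι ↦ Y) ×ˢ Y := by
      intro x hx
      obtain ⟨h1, h2⟩ := Finset.mem_product.1 hx
      refine Finset.mem_product.2 ⟨Fintype.mem_piFinset.2 fun j ↦ ?_, Fintype.mem_piFinset.1 h1 i⟩
      by_cases hj : j = i
      · subst hj
        simpa using h2
      · simpa [hj] using Fintype.mem_piFinset.1 h1 j
    refine Finset.sum_nbij' (fun x ↦ (Function.update x.1 i x.2, x.1 i))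
      (fun x ↦ (Function.update x.1 i x.2, x.1 i)) hmem hmem ?_ ?_ ?_ <;>
    · intro x _
      simp
  rw [Finset.sum_product, Finset.sum_product] at h
  rw [h, Finset.mul_sum]
  simp

/-- The increment of the `j`-th linear form in the localized average. -/
def localForm {r s : ℕ} (c : Fin r → Fin s → ℤ) (u v : Fin r → Fin s) (n : Fin r → ℤ)
    (y₀ : ZMod N) (j : Fin r) (p p' : Fin r → ZMod N) : ZMod N :=
  ∑ i, ((c j (u i) : ZMod N) * (p i - y₀) +
    ((n i * c j (v i) : ℤ) : ZMod N) * (p' i - y₀))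

lemma localForm_update {r s : ℕ} (c : Fin r → Fin s → ℤ) (u v : Fin r → Fin s) (n : Fin r → ℤ)
    (y₀ : ZMod N) (j : Fin r) (p p' : Fin r → ZMod N) (i : Fin r) (a a' b b' : ZMod N) :
    localForm c u v n y₀ j (Function.update p i a) (Function.update p' i b) =
      localForm c u v n y₀ j (Function.update p i a') (Function.update p' i b') +
        (c j (u i) : ZMod N) * (a - a') + ((n i * c j (v i) : ℤ) : ZMod N) * (b - b') := by
  simp only [localForm]
  rw [Fintype.sum_eq_add_sum_compl i, Fintype.sum_eq_add_sum_compl i]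
  have : ∀ a b : ZMod N, ∑ k ∈ ({i} : Finset (Fin r))ᶜ,
      ((c j (u k) : ZMod N) * (Function.update p i a k - y₀) +
        ((n k * c j (v k) : ℤ) : ZMod N) * (Function.update p' i b k - y₀)) =
      ∑ k ∈ ({i} : Finset (Fin r))ᶜ, ((c j (u k) : ZMod N) * (p k - y₀) +
        ((n k * c j (v k) : ℤ) : ZMod N) * (p' k - y₀)) := by
    intro a b
    refine Finset.sum_congr rfl fun k hk ↦ ?_
    have hk' : k ≠ i := by simpa using hk
    rw [Function.update_of_ne hk', Function.update_of_ne hk']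
  rw [this, this]
  simp only [Function.update_self]
  ring

/-- The hypotheses on a set `Y` on which the quadratic phases are analysed. -/
structure IsLocalDomain {r s : ℕ} (c : Fin r → Fin s → ℤ) (u v : Fin r → Fin s) (n : Fin r → ℤ)
    (D κ : ℕ) (j₀ : Fin r) (P : Fin r → Finset (ZMod N)) (Y : Finset (ZMod N)) : Prop where
  D_pos : 0 < D
  D_le : D ≤ κ
  isolate : ∀ j, ∑ i, n i * (c j (u i) * c j (v i)) = if j = j₀ then (D : ℤ) else 0
  coeff_le : ∀ j, ∑ i, (|c j (u i)| + |n i * c j (v i)|) ≤ (κ : ℤ)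
  -- This keeps `localForm` and all its increments where the polar form of each q j is defined and
  -- bilinear.
  comb : ∀ j {ι : Type} (s : Finset ι) (m : ι → ℤ) (y y' : ι → ZMod N), (∀ i ∈ s, y i ∈ Y) →
    (∀ i ∈ s, y' i ∈ Y) → ∑ i ∈ s, |m i| ≤ κ →
    ∑ i ∈ s, (m i : ZMod N) * (y i - y' i) ∈ diffSet (P j)
  mul_mem : ∀ k : ℕ, k ≤ κ → ∃ t : ZMod N, ∀ y ∈ Y, t + k * y ∈ P j₀

section

variable {r s : ℕ} {c : Fin r → Fin s → ℤ} {u v : Fin r → Fin s} {n : Fin r → ℤ} {D κ : ℕ}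
  {j₀ : Fin r} {P : Fin r → Finset (ZMod N)} {Y : Finset (ZMod N)} {y₀ : ZMod N}

lemma IsLocalDomain.mul_sub_mem (h : IsLocalDomain c u v n D κ j₀ P Y) (j : Fin r) {m : ℤ}
    (hm : |m| ≤ κ) {a a' : ZMod N} (ha : a ∈ Y) (ha' : a' ∈ Y) :
    (m : ZMod N) * (a - a') ∈ diffSet (P j) := by
  simpa using h.comb j (univ : Finset Unit) (fun _ ↦ m) (fun _ ↦ a) (fun _ ↦ a')
    (fun _ _ ↦ ha) (fun _ _ ↦ ha') (by simpa using hm)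

lemma IsLocalDomain.localForm_mem (h : IsLocalDomain c u v n D κ j₀ P Y) (hy₀ : y₀ ∈ Y)
    (j : Fin r) {p p' : Fin r → ZMod N} (hp : ∀ i, p i ∈ Y) (hp' : ∀ i, p' i ∈ Y) :
    localForm c u v n y₀ j p p' ∈ diffSet (P j) := by
  have := h.comb j (univ : Finset (Fin r ⊕ Fin r))
    (Sum.elim (fun i ↦ c j (u i)) fun i ↦ n i * c j (v i)) (Sum.elim p p') (fun _ ↦ y₀)
    (by rintro (i | i) -; exacts [hp i, hp' i]) (fun _ _ ↦ hy₀)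
    (by simpa [Finset.sum_add_distrib] using h.coeff_le j)
  rw [Fintype.sum_sum_type] at this
  simpa only [localForm, Finset.sum_add_distrib, Sum.elim_inl, Sum.elim_inr] using this

variable {B : Fin r → Finset (ZMod N)} {A : Fin r → Set (ZMod N)} {q : Fin r → ZMod N → ZMod N}
  {z ξ : Fin r → ZMod N}

/-- A local average of quadratic phases along linear forms is bounded by the rank. -/
lemma IsLocalDomain.norm_sum_le [NeZero N] (h : IsLocalDomain c u v n D κ j₀ P Y) (hy₀ : y₀ ∈ Y)
    (hBA : ∀ j, (B j : Set (ZMod N)) ⊆ A j) (hq : ∀ j, IsQuadraticOn (A j) (q j))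
    (hPB2 : ∀ j, ∀ a ∈ P j, ∀ a' ∈ P j, ∀ b ∈ P j, ∀ b' ∈ P j, a + b - a' - b' ∈ B j)
    (hz : ∀ j, ∀ b ∈ B j, z j + b ∈ A j) {R : ℝ} (hR : R ≤ rank (P j₀) (q j₀)) :
    ‖∑ p ∈ Fintype.piFinset (fun _ : Fin r ↦ Y), ∑ p' ∈ Fintype.piFinset (fun _ : Fin r ↦ Y),
      ∏ j, (ZMod.stdAddChar (q j (z j + localForm c u v n y₀ j p p') +
        ξ j * localForm c u v n y₀ j p p') : ℂ)‖ ≤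
      ((Y.card : ℝ) ^ r) ^ 2 * (N / Y.card * D * Real.exp (-R / (4 * (r : ℝ) ^ 3))) := by
  have hr : 0 < r := j₀.pos
  have hNe : Nonempty (Fin r) := ⟨j₀⟩
  have hYc : (0 : ℝ) < Y.card := by exact_mod_cast Finset.card_pos.2 ⟨y₀, hy₀⟩
  have hN : (0 : ℝ) < N := by exact_mod_cast NeZero.pos N
  have hD : (1 : ℝ) ≤ D := by exact_mod_cast h.D_pos
  have hκ1 : 1 ≤ κ := h.D_pos.trans_le h.D_le
  have hqB : ∀ j, IsQuadraticOn (B j : Set (ZMod N)) (q j) := fun j x a b c h1 h2 h3 h4 h5 h6 h7 h8 ↦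
    hq j x a b c (hBA j h1) (hBA j h2) (hBA j h3) (hBA j h4) (hBA j h5) (hBA j h6) (hBA j h7)
      (hBA j h8)
  have hbi : ∀ j, BiaddOn (diffSet (P j)) (polar (q j)) := fun j ↦ biaddOn_polar (hqB j) (hPB2 j)
  have hYΔ : ∀ j, ∀ a ∈ Y, ∀ b ∈ Y, a - b ∈ diffSet (P j) := fun j a ha b hb ↦ by
    simpa using h.mul_sub_mem j (m := 1) (by simpa using hκ1) ha hb
  have hcu : ∀ i j, |c j (u i)| ≤ κ ∧ |n i * c j (v i)| ≤ κ := by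
    intro i j
    have h1 := Finset.single_le_sum (f := fun i ↦ |c j (u i)| + |n i * c j (v i)|)
      (fun _ _ ↦ by positivity) (mem_univ i)
    have h2 := h1.trans (h.coeff_le j)
    have := abs_nonneg (c j (u i))
    have := abs_nonneg (n i * c j (v i))
    constructor <;> linarith
  set G : (Fin r → ZMod N) → (Fin r → ZMod N) → ℂ := fun p p' ↦
    ∏ j, (ZMod.stdAddChar (q j (z j + localForm c u v n y₀ j p p') +
        ξ j * localForm c u v n y₀ j p p') : ℂ) with hG
  set γ : Fin r → ZMod N → ZMod N → ZMod N := fun i x y ↦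
    ∑ j, ((c j (u i) * (n i * c j (v i)) : ℤ) : ZMod N) * polar (q j) x y with hγ
  set S : Set (ZMod N) := {x | ∃ a ∈ Y, ∃ b ∈ Y, x = a - b} with hS
  have hSΔ : ∀ j, S ⊆ diffSet (P j) := by
    rintro j x ⟨a, ha, b, hb, rfl⟩
    exact hYΔ j a ha b hb
  have hγbi : ∀ i, BiaddOn S (γ i) := fun i ↦
    BiaddOn.sum univ _ fun j _ ↦ (hbi j).mono (hSΔ j)
  have hYS : ∀ a ∈ Y, ∀ b ∈ Y, a - b ∈ S := fun a ha b hb ↦ ⟨a, ha, b, hb, rfl⟩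
  have hmem : ∀ {p : Fin r → ZMod N} {i : Fin r} {a : ZMod N},
      p ∈ Fintype.piFinset (fun _ : Fin r ↦ Y) → a ∈ Y → ∀ k, Function.update p i a k ∈ Y := by
    intro p i a hp ha k
    by_cases hk : k = i
    · subst hk; simpa using ha
    · simpa [hk] using Fintype.mem_piFinset.1 hp k
  -- Alternating over a, a' and b, b' in coordinate i removes the linear phases and leaves the
  -- second difference of q j, independent of the base point.
  have hdiff : ∀ i, ∀ p ∈ Fintype.piFinset (fun _ : Fin r ↦ Y),
      ∀ p' ∈ Fintype.piFinset (fun _ : Fin r ↦ Y), ∀ a ∈ Y, ∀ a' ∈ Y, ∀ b ∈ Y, ∀ b' ∈ Y,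
      G (Function.update p i a) (Function.update p' i b) *
        starRingEnd ℂ (G (Function.update p i a') (Function.update p' i b)) *
        starRingEnd ℂ (G (Function.update p i a) (Function.update p' i b')) *
        G (Function.update p i a') (Function.update p' i b') =
      ZMod.stdAddChar (γ i (a - a') (b - b')) := by
    intro i p hp p' hp' a ha a' ha' b hb b' hb'
    rw [hG, hγ, stdAddChar_sum]
    simp only [map_prod, ← Finset.prod_mul_distrib]
    refine Finset.prod_congr rfl fun j _ ↦ ?_
    set w := localForm c u v n y₀ j (Function.update p i a') (Function.update p' i b') with hw
    set x := (c j (u i) : ZMod N) * (a - a') with hx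
    set y := ((n i * c j (v i) : ℤ) : ZMod N) * (b - b') with hy
    have e1 : localForm c u v n y₀ j (Function.update p i a) (Function.update p' i b) = w + x + y :=
      localForm_update c u v n y₀ j p p' i a a' b b'
    have e2 : localForm c u v n y₀ j (Function.update p i a') (Function.update p' i b) = w + y := by
      have := localForm_update c u v n y₀ j p p' i a' a' b b'
      rwa [sub_self, mul_zero, add_zero] at this
    have e3 : localForm c u v n y₀ j (Function.update p i a) (Function.update p' i b') = w + x := by
      have := localForm_update c u v n y₀ j p p' i a a' b' b'
      rwa [sub_self, mul_zero, add_zero] at this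
    have hxΔ : x ∈ diffSet (P j) := h.mul_sub_mem j (hcu i j).1 ha ha'
    have hyΔ : y ∈ diffSet (P j) := h.mul_sub_mem j (hcu i j).2 hb hb'
    have hwB : ∀ {t}, t ∈ diffSet (P j) → z j + t ∈ A j := fun ht ↦
      hz j _ (diffSet_mem (hPB2 j) ht)
    have m1 : w + x + y ∈ diffSet (P j) := by
      rw [← e1]; exact h.localForm_mem hy₀ j (hmem hp ha) (hmem hp' hb)
    have m2 : w + y ∈ diffSet (P j) := by
      rw [← e2]; exact h.localForm_mem hy₀ j (hmem hp ha') (hmem hp' hb)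
    have m3 : w + x ∈ diffSet (P j) := by
      rw [← e3]; exact h.localForm_mem hy₀ j (hmem hp ha) (hmem hp' hb')
    have m4 : w ∈ diffSet (P j) := h.localForm_mem hy₀ j (hmem hp ha') (hmem hp' hb')
    have hP : (P j).Nonempty := by obtain ⟨t, ht, -⟩ := m4; exact ⟨t, ht⟩
    have hquad := (hq j).sub_eq_polar (w := z j + w) (u := x) (v := y)
      (hBA j (diffSet_mem (hPB2 j) (zero_mem_diffSet hP))) (hBA j (diffSet_mem (hPB2 j) hxΔ))
      (hBA j (diffSet_mem (hPB2 j) hyΔ)) (hBA j (diffSet_add_mem (hPB2 j) hxΔ hyΔ)) (hwB m4)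
      (by rw [add_assoc]; exact hwB m3) (by rw [add_assoc]; exact hwB m2)
      (by rw [add_assoc, add_assoc, ← add_assoc w]; exact hwB m1)
    have hpol : polar (q j) x y =
        ((c j (u i) * (n i * c j (v i)) : ℤ) : ZMod N) * polar (q j) (a - a') (b - b') := by
      rw [hx, (hbi j).intCast_mul_left (fun m hm ↦ h.mul_sub_mem j hm ha ha') hyΔ _ (hcu i j).1, hy,
        (hbi j).flip.intCast_mul_left (fun m hm ↦ h.mul_sub_mem j hm hb hb') (hYΔ j a ha a' ha') _
          (hcu i j).2]
      push_cast
      ring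
    rw [← hpol, ← hquad, e1, e2, e3, conj_stdAddChar, conj_stdAddChar, ← AddChar.map_add_eq_mul,
      ← AddChar.map_add_eq_mul, ← AddChar.map_add_eq_mul]
    congr 1
    rw [show z j + (w + x + y) = z j + w + x + y by ring, show z j + (w + y) = z j + w + y by ring,
      show z j + (w + x) = z j + w + x by ring]
    ring
  set X := ‖∑ p ∈ Fintype.piFinset (fun _ : Fin r ↦ Y),
    ∑ p' ∈ Fintype.piFinset (fun _ : Fin r ↦ Y), G p p'‖ with hX
  set η := X / ((Y.card : ℝ) ^ r) ^ 2 with hη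
  have hη0 : 0 ≤ η := by positivity
  -- For each i only the coordinates p i and p' i are resampled; the others are frozen and the two
  -- Cauchy–Schwarz steps apply to the inner sum.
  have hηi : ∀ i, η ^ 4 ≤ bias (γ i) Y / (Y.card : ℝ) ^ 4 := by
    intro i
    set m := (Y.card : ℝ) ^ 4 * bias (γ i) Y with hm
    have hm0 : 0 ≤ m := mul_nonneg (by positivity) ((hγbi i).bias_nonneg hYS)
    have hg : ∀ p ∈ Fintype.piFinset (fun _ : Fin r ↦ Y),
        ∀ p' ∈ Fintype.piFinset (fun _ : Fin r ↦ Y),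
        ‖∑ a ∈ Y, ∑ b ∈ Y, G (Function.update p i a) (Function.update p' i b)‖ ≤
          m ^ ((4 : ℕ) : ℝ)⁻¹ := by
      intro p hp p' hp'
      rw [← Real.pow_rpow_inv_natCast (norm_nonneg _) (n := 4) (by norm_num)]
      exact Real.rpow_le_rpow (by positivity)
        (norm_sum_pow_four_le _ (hdiff i p hp p' hp')) (by positivity)
    have hcomb : (Y.card : ℂ) * ((Y.card : ℂ) * ∑ p ∈ Fintype.piFinset (fun _ : Fin r ↦ Y),
        ∑ p' ∈ Fintype.piFinset (fun _ : Fin r ↦ Y), G p p') =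
        ∑ p ∈ Fintype.piFinset (fun _ : Fin r ↦ Y), ∑ p' ∈ Fintype.piFinset (fun _ : Fin r ↦ Y),
          ∑ a ∈ Y, ∑ b ∈ Y, G (Function.update p i a) (Function.update p' i b) := by
      rw [card_mul_sum_piFinset Y i, Finset.mul_sum]
      refine Finset.sum_congr rfl fun p _ ↦ ?_
      rw [Finset.mul_sum, Finset.sum_congr rfl fun a _ ↦ card_mul_sum_piFinset Y i _,
        Finset.sum_comm]
    have hX2 : (Y.card : ℝ) ^ 2 * X ≤ ((Y.card : ℝ) ^ r) ^ 2 * m ^ ((4 : ℕ) : ℝ)⁻¹ := by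
      have e : (Y.card : ℝ) ^ 2 * X = ‖(Y.card : ℂ) * ((Y.card : ℂ) *
          ∑ p ∈ Fintype.piFinset (fun _ : Fin r ↦ Y),
            ∑ p' ∈ Fintype.piFinset (fun _ : Fin r ↦ Y), G p p')‖ := by
        rw [norm_mul, norm_mul, Complex.norm_natCast]
        ring
      rw [e, hcomb]
      refine (norm_sum_le_of_le _ fun p hp ↦ norm_sum_le_of_le _ (hg p hp)).trans (le_of_eq ?_)
      simp
      ring
    have hX3 : (Y.card : ℝ) ^ 2 * η ≤ m ^ ((4 : ℕ) : ℝ)⁻¹ := by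
      rw [hη, mul_div_assoc', div_le_iff₀ (by positivity)]
      linarith
    have hX4 := pow_le_pow_left₀ (by positivity) hX3 4
    rw [Real.rpow_inv_natCast_pow hm0 (by norm_num), hm] at hX4
    rw [le_div_iff₀ (by positivity)]
    refine le_of_mul_le_mul_left ?_ (show (0 : ℝ) < (Y.card : ℝ) ^ 4 by positivity)
    linarith [hX4, show ((Y.card : ℝ) ^ 2 * η) ^ 4 =
      (Y.card : ℝ) ^ 4 * (η ^ 4 * (Y.card : ℝ) ^ 4) by ring]
  set α := bias (polar (q j₀)) (P j₀) / ((P j₀).card : ℝ) ^ 4 with hα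
  have hPc : (0 : ℝ) < (P j₀).card := by
    obtain ⟨t, ht⟩ := h.mul_mem 0 (Nat.zero_le _)
    exact_mod_cast Finset.card_pos.2 ⟨_, ht y₀ hy₀⟩
  have hα0 : 0 ≤ α := div_nonneg ((hbi j₀).bias_nonneg fun a ha b hb ↦ ⟨a, ha, b, hb, rfl⟩)
    (by positivity)
  -- Summed over i, the coefficient of every polar form with j ≠ j₀ vanishes by `isolate`, and that
  -- of j₀ is D.
  have hΓ : bias (fun x y ↦ ∑ i, γ i x y) Y ≤ D ^ 2 * ((N : ℝ) ^ 4 * α) := by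
    have e : (fun x y ↦ ∑ i, γ i x y) = fun x y ↦ (D : ZMod N) * polar (q j₀) x y := by
      funext x y
      rw [hγ, Finset.sum_comm]
      simp only [← Finset.sum_mul]
      rw [Finset.sum_eq_single j₀]
      · have := congrArg (Int.cast : ℤ → ZMod N) (h.isolate j₀)
        rw [if_pos rfl] at this
        push_cast at this ⊢
        rw [← this]
        congr 1
        exact Finset.sum_congr rfl fun i _ ↦ by ring
      · intro j _ hj
        have := congrArg (Int.cast : ℤ → ZMod N) (h.isolate j)
        rw [if_neg hj] at this
        push_cast at this ⊢
        rw [show ∑ i, (c j (u i) : ZMod N) * (n i * c j (v i)) = 0 by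
          rw [← this]; exact Finset.sum_congr rfl fun i _ ↦ by ring, zero_mul]
      · simp
    obtain ⟨t, ht⟩ := h.mul_mem D h.D_le
    obtain ⟨t', ht'⟩ := h.mul_mem 1 hκ1
    rw [e]
    refine ((hbi j₀).bias_natCast_mul_le h.D_pos (t := t) (t' := t') (fun y hy ↦ by
      have := ht' y hy
      rwa [Nat.cast_one, one_mul] at this) ht ?_).trans ?_
    · intro a ha a' ha' w hw
      have := (hbi j₀).intCast_mul_left (fun m hm ↦ h.mul_sub_mem j₀ hm ha ha') hw (D : ℤ)
        (by rw [abs_of_nonneg (by positivity)]; exact_mod_cast h.D_le)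
      rwa [Int.cast_natCast] at this
    · have : bias (polar (q j₀)) (P j₀) = ((P j₀).card : ℝ) ^ 4 * α := by
        rw [hα]; field_simp
      rw [this]
      have hPN : ((P j₀).card : ℝ) ≤ N := by
        have := Finset.card_le_univ (P j₀)
        rw [ZMod.card] at this
        exact_mod_cast this
      exact mul_le_mul_of_nonneg_left
        (mul_le_mul_of_nonneg_right (pow_le_pow_left₀ hPc.le hPN 4) hα0) (by positivity)
  -- The r bounds on η⁴ are multiplied and `prod_bias_le` is applied. The factors N⁴ cancel, and D²
  -- is relaxed to D^{4r} so that a 4r-th root can be taken.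
  have hmain : η ^ (4 * r) ≤ (N / Y.card * D * α ^ (1 / (4 * (r : ℝ)))) ^ (4 * r) := by
    have h1 : η ^ (4 * r) ≤ ∏ i, (bias (γ i) Y / (Y.card : ℝ) ^ 4) := by
      have := Finset.prod_le_prod (s := (univ : Finset (Fin r))) (f := fun _ ↦ η ^ 4)
        (fun _ _ ↦ by positivity) fun i _ ↦ hηi i
      simpa [pow_mul] using this
    have h2 := prod_bias_le hγbi hYS ⟨y₀, hy₀⟩
    rw [Fintype.card_fin] at h2
    have h3 : (N : ℝ) ^ 4 * η ^ (4 * r) ≤ (N : ℝ) ^ 4 * ((N / Y.card : ℝ) ^ (4 * r) * (D ^ 2 * α)) := by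
      rw [Finset.prod_div_distrib, Finset.prod_const, Finset.card_univ, Fintype.card_fin] at h1
      calc (N : ℝ) ^ 4 * η ^ (4 * r)
          ≤ (N : ℝ) ^ 4 * ((∏ i, bias (γ i) Y) / ((Y.card : ℝ) ^ 4) ^ r) := by gcongr
        _ = ((N : ℝ) ^ 4 * ∏ i, bias (γ i) Y) / ((Y.card : ℝ) ^ 4) ^ r := by ring
        _ ≤ (((N : ℝ) ^ r) ^ 4 * (D ^ 2 * ((N : ℝ) ^ 4 * α))) / ((Y.card : ℝ) ^ 4) ^ r := by
            refine div_le_div_of_nonneg_right (h2.trans ?_) (by positivity)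
            exact mul_le_mul_of_nonneg_left hΓ (by positivity)
        _ = _ := by
            rw [div_pow, ← pow_mul, ← pow_mul, mul_comm r 4]
            ring
    have h4 := le_of_mul_le_mul_left h3 (by positivity)
    refine h4.trans ?_
    rw [mul_pow, mul_pow, mul_assoc]
    have h5 : (α ^ (1 / (4 * (r : ℝ)))) ^ (4 * r) = α := by
      have h45 := Real.rpow_inv_natCast_pow hα0 (n := 4 * r) (by omega)
      push_cast at h45
      rw [one_div]
      exact h45
    rw [h5]
    gcongr
    omega
  have hfin : η ≤ N / Y.card * D * α ^ (1 / (4 * (r : ℝ))) :=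
    le_of_pow_le_pow_left₀ (by omega) (by positivity) hmain
  have hfin2 : η ≤ N / Y.card * D * Real.exp (-R / (4 * (r : ℝ) ^ 3)) :=
    hfin.trans (mul_le_mul_of_nonneg_left (bias_rpow_le (hqB j₀) (hPB2 j₀) hR hr) (by positivity))
  rw [hη, div_le_iff₀ (by positivity)] at hfin2
  linarith

end

end LocalEstimate

/-! ### Passing from the global average to local ones. -/

section Localization

variable {N : ℕ} {r s : ℕ}

lemma IsGAP.nonempty {P : Finset (ZMod N)} {d : ℕ} (hP : IsGAP P d) : P.Nonempty := by
  obtain ⟨x₀, v, l, hl, h⟩ := hP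
  exact ⟨_, (h _).2 ⟨fun _ ↦ 0, hl, rfl⟩⟩

/-- This κ bounds the total size of the coefficients in `localForm`. Each P j is shrunk by κ, and Y
lies in a translate of every shrunk piece; translations cancel in differences and the density loss
is recorded in the last clause. -/
lemma exists_isLocalDomain [NeZero N] {c : Fin r → Fin s → ℤ} (hc : SquareIndependent c)
    {M : ℕ} (hM : ∀ j, ∑ u, |c j u| ≤ M) (hM1 : 1 ≤ M) (j₀ : Fin r)
    {P : Fin r → Finset (ZMod N)} {d : Fin r → ℕ} (hP : ∀ j, IsGAP (P j) (d j)) {κ : ℕ}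
    (hκ : κ = r * (M + r.factorial * M ^ (2 * r) * M)) :
    ∃ (u v : Fin r → Fin s) (n : Fin r → ℤ) (D : ℕ) (Y : Finset (ZMod N)),
      IsLocalDomain c u v n D κ j₀ P Y ∧ Y.Nonempty ∧
      N * ∏ j, (P j).card ≤ κ ^ (∑ j, d j) * (N ^ r * Y.card) := by
  obtain ⟨u, v, n, D, hD, hDle, hn, hiso⟩ := hc.exists_coefficients hM hM1 j₀
  set F := r.factorial * M ^ (2 * r) with hF
  have hr : 0 < r := j₀.pos
  have hFκ : F ≤ κ := by
    rw [hκ]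
    calc F ≤ M + F * M := (Nat.le_mul_of_pos_right F hM1).trans (Nat.le_add_left _ _)
      _ ≤ _ := Nat.le_mul_of_pos_left _ hr
  have hκ0 : 0 < κ := hD.trans_le (hDle.trans hFκ)
  choose P' t hcard hcomb hmul using fun j ↦ (hP j).exists_shrink hκ0
  obtain ⟨t', Y, hY, hYcard⟩ := exists_large_inter P'
  rw [Fintype.card_fin] at hYcard
  have hcM : ∀ j u, |c j u| ≤ M := fun j u ↦
    (Finset.single_le_sum (f := fun u ↦ |c j u|) (fun _ _ ↦ abs_nonneg _) (mem_univ u)).trans (hM j)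
  have hsize : N * ∏ j, (P j).card ≤ κ ^ (∑ j, d j) * (N ^ r * Y.card) := by
    calc N * ∏ j, (P j).card ≤ N * ∏ j, (κ ^ d j * (P' j).card) :=
          Nat.mul_le_mul_left _ (Finset.prod_le_prod' fun j _ ↦ hcard j)
      _ = κ ^ (∑ j, d j) * (N * ∏ j, (P' j).card) := by
          rw [Finset.prod_mul_distrib, Finset.prod_pow_eq_pow_sum]
          ring
      _ ≤ _ := Nat.mul_le_mul_left _ hYcard
  refine ⟨u, v, n, D, Y, ⟨hD, hDle.trans hFκ, hiso, ?_, ?_, ?_⟩, ?_, hsize⟩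
  · intro j
    calc ∑ i, (|c j (u i)| + |n i * c j (v i)|) ≤ ∑ _i : Fin r, ((M : ℤ) + F * M) := by
          refine Finset.sum_le_sum fun i _ ↦ add_le_add (hcM _ _) ?_
          rw [abs_mul]
          exact mul_le_mul (hn i) (hcM _ _) (abs_nonneg _) (by positivity)
      _ = κ := by rw [hκ]; simp
  · intro j ι S m y y' hy hy' hm
    have := hcomb j S m (fun i ↦ y i + t' j) (fun i ↦ y' i + t' j) (fun i hi ↦ hY j _ (hy i hi))
      (fun i hi ↦ hY j _ (hy' i hi)) hm
    simpa only [add_sub_add_right_eq_sub] using this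
  · intro k hk
    refine ⟨t j₀ + k * t' j₀, fun y hy ↦ ?_⟩
    have := hmul j₀ k hk _ (hY j₀ y hy)
    rwa [show t j₀ + k * (y + t' j₀) = t j₀ + k * t' j₀ + k * y by ring] at this
  · rw [← Finset.card_pos]
    by_contra h0
    rw [Nat.eq_zero_of_not_pos h0, Nat.mul_zero, Nat.mul_zero] at hsize
    have : 0 < N * ∏ j, (P j).card :=
      Nat.mul_pos (NeZero.pos N) (Finset.prod_pos fun j _ ↦ (hP j).nonempty.card_pos)
    omega

lemma linForm_add (c : Fin s → ℤ) (x y : Fin s → ZMod N) :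
    linForm c (x + y) = linForm c x + linForm c y := by
  simp only [linForm, Pi.add_apply, mul_add, Finset.sum_add_distrib]

lemma expect_add_right [NeZero N] (g : (Fin s → ZMod N) → ℂ) (y : Fin s → ZMod N) :
    𝔼 x, g (x + y) = 𝔼 x, g x :=
  Fintype.expect_equiv (Equiv.addRight y) _ _ fun _ ↦ rfl

/-- A surjective linear form is equidistributed. -/
lemma expect_comp_linForm [NeZero N] {c : Fin s → ℤ}
    (hc : Function.Surjective fun x : Fin s → ZMod N ↦ linForm c x) (g : ZMod N → ℝ) :
    𝔼 x : Fin s → ZMod N, g (linForm c x) = 𝔼 z, g z := by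
  choose σ hσ using hc
  have h : ∀ h : ZMod N, 𝔼 x : Fin s → ZMod N, g (linForm c x) =
      𝔼 x : Fin s → ZMod N, g (linForm c x + h) := fun h ↦
    (Fintype.expect_equiv (Equiv.addRight (σ h)) _ _ fun x ↦ by
      rw [Equiv.coe_addRight, linForm_add, ← hσ h]
      simp only [hσ]).symm
  calc 𝔼 x : Fin s → ZMod N, g (linForm c x)
      = 𝔼 _h : ZMod N, 𝔼 x : Fin s → ZMod N, g (linForm c x) :=
        (Finset.expect_const univ_nonempty _).symm
    _ = 𝔼 h : ZMod N, 𝔼 x : Fin s → ZMod N, g (linForm c x + h) :=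
        Finset.expect_congr rfl fun k _ ↦ h k
    _ = 𝔼 x : Fin s → ZMod N, 𝔼 h : ZMod N, g (linForm c x + h) := Finset.expect_comm _ _ _
    _ = 𝔼 _x : Fin s → ZMod N, 𝔼 z, g z := Finset.expect_congr rfl fun x _ ↦
        Fintype.expect_equiv (Equiv.addLeft (linForm c x)) _ _ fun _ ↦ rfl
    _ = _ := Finset.expect_const univ_nonempty _

lemma IsQuadraticAverage.norm_le_one [NeZero N] {B : Finset (ZMod N)} {q : ZMod N → ZMod N}
    {Q : ZMod N → ℂ} (h : IsQuadraticAverage B q Q) (x : ZMod N) : ‖Q x‖ ≤ 1 := by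
  obtain ⟨-, -, φ, -, hQ⟩ := h
  rw [hQ]
  exact norm_expect_le_of_le zero_le_one fun y _ ↦ (norm_stdAddChar _).le

/-- The vector by which the localization shifts. -/
def localShift (u v : Fin r → Fin s) (n : Fin r → ℤ) (y₀ : ZMod N) (p p' : Fin r → ZMod N) :
    Fin s → ZMod N :=
  ∑ i, (Pi.single (u i) (p i - y₀) + Pi.single (v i) ((n i : ZMod N) * (p' i - y₀)))

lemma linForm_localShift (c : Fin r → Fin s → ℤ) (u v : Fin r → Fin s) (n : Fin r → ℤ)
    (y₀ : ZMod N) (j : Fin r) (p p' : Fin r → ZMod N) :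
    linForm (c j) (localShift u v n y₀ p p') = localForm c u v n y₀ j p p' := by
  simp only [linForm, localShift, localForm, Finset.sum_apply, Pi.add_apply, Finset.mul_sum]
  rw [Finset.sum_comm]
  refine Finset.sum_congr rfl fun i _ ↦ ?_
  simp only [mul_add, Finset.sum_add_distrib, Pi.single_apply, mul_ite, mul_zero,
    Finset.sum_ite_eq', mem_univ, if_true]
  push_cast
  ring

/-- The average of a product of special quadratic averages of high rank, multiplied by functions
with summable Fourier transforms. -/
lemma norm_expect_special_le [NeZero N] {c : Fin r → Fin s → ℤ} {u v : Fin r → Fin s} {n : Fin r → ℤ}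
    {D κ : ℕ} {j₀ : Fin r} {P : Fin r → Finset (ZMod N)} {Y : Finset (ZMod N)}
    (h : IsLocalDomain c u v n D κ j₀ P Y) (hY : Y.Nonempty)
    (hsurj : ∀ j, Function.Surjective fun x : Fin s → ZMod N ↦ linForm (c j) x)
    {B : Fin r → Finset (ZMod N)} {q : Fin r → ZMod N → ZMod N} {Q V : Fin r → ZMod N → ℂ}
    {ε : ℝ} {m : Fin r → ℕ}
    (hQ : ∀ j, IsSpecialQuadraticAverage ε (m j) (B j) (q j) (Q j))
    (hPB2 : ∀ j, ∀ a ∈ P j, ∀ a' ∈ P j, ∀ b ∈ P j, ∀ b' ∈ P j, a + b - a' - b' ∈ B j)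
    {R : ℝ} (hR : R ≤ rank (P j₀) (q j₀)) {b W : Fin r → ℝ} (hV : ∀ j x, ‖V j x‖ ≤ b j)
    (hW : ∀ j, ∑ ξ, ‖fourierCoef (V j) ξ‖ ≤ W j) :
    ‖𝔼 x : Fin s → ZMod N, ∏ j, (Q j (linForm (c j) x) * V j (linForm (c j) x))‖ ≤
      r * ε * ∏ j, b j +
        (∏ j, W j) * (N / Y.card * D * Real.exp (-R / (4 * (r : ℝ) ^ 3))) := by
  obtain ⟨y₀, hy₀⟩ := hY
  have hYc : (0 : ℝ) < Y.card := by exact_mod_cast Finset.card_pos.2 ⟨y₀, hy₀⟩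
  have hN : (0 : ℝ) < N := by exact_mod_cast NeZero.pos N
  have hb0 : ∀ j, 0 ≤ b j := fun j ↦ (norm_nonneg _).trans (hV j 0)
  have hQ1 : ∀ j x, ‖Q j x‖ ≤ 1 := fun j ↦ (hQ j).1.norm_le_one
  choose A X E hBA hqA hX hE hgood using fun j ↦ (hQ j).2
  set F : (Fin s → ZMod N) → ℂ := fun x ↦ ∏ j, (Q j (linForm (c j) x) * V j (linForm (c j) x))
    with hF
  set η : ℝ := N / Y.card * D * Real.exp (-R / (4 * (r : ℝ) ^ 3)) with hη
  have hη0 : 0 ≤ η := by positivity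
  have hW0 : 0 ≤ ∏ j, W j := Finset.prod_nonneg fun j _ ↦
    (Finset.sum_nonneg fun _ _ ↦ norm_nonneg _).trans (hW j)
  have hFb : ∀ x, ‖F x‖ ≤ ∏ j, b j := fun x ↦ by
    rw [hF, norm_prod]
    refine Finset.prod_le_prod (fun _ _ ↦ norm_nonneg _) fun j _ ↦ ?_
    rw [norm_mul]
    exact (mul_le_of_le_one_left (norm_nonneg _) (hQ1 j _)).trans (hV j _)
  set YY := Fintype.piFinset (fun _ : Fin r ↦ Y) with hYY
  have hYYc : (YY.card : ℝ) = (Y.card : ℝ) ^ r := by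
    rw [hYY, Fintype.card_piFinset_const]
    push_cast
    rfl
  set bad : (Fin s → ZMod N) → ℝ := fun x ↦ ∑ j, if linForm (c j) x ∈ E j then 1 else 0 with hbad
  have hpoint : ∀ x, ‖∑ p ∈ YY, ∑ p' ∈ YY, F (x + localShift u v n y₀ p p')‖ ≤
      ((Y.card : ℝ) ^ r) ^ 2 * (bad x * ∏ j, b j + (∏ j, W j) * η) := by
    intro x
    -- An exceptional x is estimated trivially and charged to `bad`. For the others each Q j is one
    -- quadratic phase on the translate of B j, and the Fourier series of V j contributes only
    -- linear phases.
    by_cases hx : ∃ j, linForm (c j) x ∈ E j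
    · have h1 : 1 ≤ bad x := by
        obtain ⟨j, hj⟩ := hx
        calc (1 : ℝ) = if linForm (c j) x ∈ E j then 1 else 0 := (if_pos hj).symm
          _ ≤ bad x := Finset.single_le_sum (f := fun j ↦ if linForm (c j) x ∈ E j then (1 : ℝ)
            else 0) (fun _ _ ↦ by positivity) (mem_univ j)
      have h2 : ‖∑ p ∈ YY, ∑ p' ∈ YY, F (x + localShift u v n y₀ p p')‖ ≤
          ∑ _p ∈ YY, ∑ _p' ∈ YY, ∏ j, b j :=
        norm_sum_le_of_le _ fun p _ ↦ norm_sum_le_of_le _ fun p' _ ↦ hFb _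
      refine h2.trans ?_
      rw [Finset.sum_const, Finset.sum_const, nsmul_eq_mul, nsmul_eq_mul, hYYc, ← mul_assoc, ← sq]
      refine mul_le_mul_of_nonneg_left ?_ (by positivity)
      have := mul_le_mul_of_nonneg_right h1 (Finset.prod_nonneg fun j (_ : j ∈ univ) ↦ hb0 j)
      have := mul_nonneg hW0 hη0
      linarith
    · push Not at hx
      have h0 : bad x = 0 := Finset.sum_eq_zero fun j _ ↦ if_neg (hx j)
      choose t ht htA using fun j ↦ hgood j _ (hx j)
      have hexp : ∀ p ∈ YY, ∀ p' ∈ YY, F (x + localShift u v n y₀ p p') =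
          ∑ Ξ : Fin r → ZMod N,
            (∏ j, (fourierCoef (V j) (Ξ j) * ZMod.stdAddChar (Ξ j * linForm (c j) x))) *
            ∏ j, (ZMod.stdAddChar (q j (linForm (c j) x - t j + localForm c u v n y₀ j p p') +
              Ξ j * localForm c u v n y₀ j p p') : ℂ) := by
        intro p hp p' hp'
        have hfac : ∀ j, Q j (linForm (c j) (x + localShift u v n y₀ p p')) *
            V j (linForm (c j) (x + localShift u v n y₀ p p')) =
            ∑ ξ : ZMod N, (fourierCoef (V j) ξ * ZMod.stdAddChar (ξ * linForm (c j) x)) *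
              (ZMod.stdAddChar (q j (linForm (c j) x - t j + localForm c u v n y₀ j p p') +
                ξ * localForm c u v n y₀ j p p') : ℂ) := by
          intro j
          have hmem : localForm c u v n y₀ j p p' ∈ B j := diffSet_mem (hPB2 j)
            (h.localForm_mem hy₀ j (Fintype.mem_piFinset.1 hp) (Fintype.mem_piFinset.1 hp'))
          rw [linForm_add, linForm_localShift, (htA j _ hmem).2, ← sum_fourierCoef_mul (V j),
            Finset.mul_sum]
          refine Finset.sum_congr rfl fun ξ _ ↦ ?_
          rw [show linForm (c j) x - t j + localForm c u v n y₀ j p p' =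
            linForm (c j) x + localForm c u v n y₀ j p p' - t j by ring, mul_add,
            AddChar.map_add_eq_mul, AddChar.map_add_eq_mul]
          ring
        simp only [hF, hfac]
        rw [Finset.prod_univ_sum, Fintype.piFinset_univ]
        simp only [Finset.prod_mul_distrib]
      rw [Finset.sum_congr rfl fun p hp ↦ Finset.sum_congr rfl fun p' hp' ↦ hexp p hp p' hp']
      have hswap : ∑ p ∈ YY, ∑ p' ∈ YY, ∑ Ξ : Fin r → ZMod N,
            (∏ j, (fourierCoef (V j) (Ξ j) * ZMod.stdAddChar (Ξ j * linForm (c j) x))) *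
            ∏ j, (ZMod.stdAddChar (q j (linForm (c j) x - t j + localForm c u v n y₀ j p p') +
              Ξ j * localForm c u v n y₀ j p p') : ℂ) =
          ∑ Ξ : Fin r → ZMod N,
            (∏ j, (fourierCoef (V j) (Ξ j) * ZMod.stdAddChar (Ξ j * linForm (c j) x))) *
            ∑ p ∈ YY, ∑ p' ∈ YY,
            ∏ j, (ZMod.stdAddChar (q j (linForm (c j) x - t j + localForm c u v n y₀ j p p') +
              Ξ j * localForm c u v n y₀ j p p') : ℂ) := by
        simp only [Finset.mul_sum]
        rw [Finset.sum_congr rfl fun p _ ↦ Finset.sum_comm, Finset.sum_comm]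
      rw [hswap]
      have hterm : ∀ Ξ : Fin r → ZMod N, ‖(∏ j, (fourierCoef (V j) (Ξ j) *
          ZMod.stdAddChar (Ξ j * linForm (c j) x))) * ∑ p ∈ YY, ∑ p' ∈ YY,
            ∏ j, (ZMod.stdAddChar (q j (linForm (c j) x - t j + localForm c u v n y₀ j p p') +
              Ξ j * localForm c u v n y₀ j p p') : ℂ)‖ ≤
          (∏ j, ‖fourierCoef (V j) (Ξ j)‖) * (((Y.card : ℝ) ^ r) ^ 2 * η) := by
        intro Ξ
        rw [norm_mul, norm_prod]
        simp only [norm_mul, norm_stdAddChar, mul_one]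
        refine mul_le_mul_of_nonneg_left ?_ (by positivity)
        exact h.norm_sum_le hy₀ hBA hqA hPB2
          (fun j b' hb' ↦ by
            have := (htA j b' hb').1
            rwa [show linForm (c j) x + b' - t j = linForm (c j) x - t j + b' by ring] at this) hR
      refine (norm_sum_le_of_le _ fun Ξ _ ↦ hterm Ξ).trans ?_
      rw [← Finset.sum_mul, h0, zero_mul, zero_add]
      have hprod : ∑ Ξ : Fin r → ZMod N, ∏ j, ‖fourierCoef (V j) (Ξ j)‖ ≤ ∏ j, W j := by
        have := Finset.prod_univ_sum (κ := fun _ : Fin r ↦ ZMod N) (fun _ ↦ univ)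
          fun j ξ ↦ ‖fourierCoef (V j) ξ‖
        rw [Fintype.piFinset_univ] at this
        rw [← this]
        exact Finset.prod_le_prod (fun _ _ ↦ Finset.sum_nonneg fun _ _ ↦ norm_nonneg _)
          fun j _ ↦ hW j
      calc _ ≤ (∏ j, W j) * (((Y.card : ℝ) ^ r) ^ 2 * η) := by gcongr
        _ = _ := by ring
  have havg : ((Y.card : ℂ) ^ r) ^ 2 * 𝔼 x, F x =
      𝔼 x, ∑ p ∈ YY, ∑ p' ∈ YY, F (x + localShift u v n y₀ p p') := by
    rw [Finset.expect_sum_comm]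
    simp only [Finset.expect_sum_comm, expect_add_right, Finset.sum_const, nsmul_eq_mul]
    have : (YY.card : ℂ) = (Y.card : ℂ) ^ r := by exact_mod_cast hYYc
    rw [this]
    ring
  -- Surjective forms are equidistributed, so each exceptional set E j is hit with probability at
  -- most ε.
  have hbadavg : 𝔼 x, bad x ≤ r * ε := by
    rw [hbad, Finset.expect_sum_comm]
    calc ∑ j, 𝔼 x : Fin s → ZMod N, (if linForm (c j) x ∈ E j then (1 : ℝ) else 0)
        ≤ ∑ _j : Fin r, ε := by
          refine Finset.sum_le_sum fun j _ ↦ ?_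
          rw [expect_comp_linForm (hsurj j) fun z ↦ if z ∈ E j then (1 : ℝ) else 0,
            Fintype.expect_eq_sum_div_card, ZMod.card, div_le_iff₀ hN]
          simpa using hE j
      _ = _ := by simp
  have hfinal : ((Y.card : ℝ) ^ r) ^ 2 * ‖𝔼 x, F x‖ ≤
      ((Y.card : ℝ) ^ r) ^ 2 * (r * ε * ∏ j, b j + (∏ j, W j) * η) := by
    have e : ((Y.card : ℝ) ^ r) ^ 2 * ‖𝔼 x, F x‖ = ‖((Y.card : ℂ) ^ r) ^ 2 * 𝔼 x, F x‖ := by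
      simp
    rw [e, havg]
    calc _ ≤ 𝔼 x, ‖∑ p ∈ YY, ∑ p' ∈ YY, F (x + localShift u v n y₀ p p')‖ := norm_expect_le _ _
      _ ≤ 𝔼 x, ((Y.card : ℝ) ^ r) ^ 2 * (bad x * ∏ j, b j + (∏ j, W j) * η) :=
          Finset.expect_le_expect fun x _ ↦ hpoint x
      _ = ((Y.card : ℝ) ^ r) ^ 2 * ((𝔼 x, bad x) * ∏ j, b j + (∏ j, W j) * η) := by
          rw [← Finset.mul_expect, Finset.expect_add_distrib, ← Finset.expect_mul,
            Finset.expect_const univ_nonempty]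
      _ ≤ _ := by
          have := Finset.prod_nonneg fun j (_ : j ∈ univ) ↦ hb0 j
          gcongr
  exact le_of_mul_le_mul_left hfinal (by positivity)

end Localization

/-! ### Elementary inequalities and the size of `chi`. -/

section Conclusion

/-- Telescoping, one factor at a time; the power |s| instead of |s| - 1 is affordable since L ≥ 1.
-/
lemma norm_prod_sub_prod_le {ι : Type*} (s : Finset ι) (a b : ι → ℂ) {L : ℝ} (hL : 1 ≤ L)
    (ha : ∀ i ∈ s, ‖a i‖ ≤ L) (hb : ∀ i ∈ s, ‖b i‖ ≤ L) :
    ‖∏ i ∈ s, a i - ∏ i ∈ s, b i‖ ≤ L ^ s.card * ∑ i ∈ s, ‖a i - b i‖ := by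
  classical
  induction s using Finset.induction_on with
  | empty => simp
  | insert i s hi ih =>
    have ih' := ih (fun k hk ↦ ha k (Finset.mem_insert_of_mem hk))
      fun k hk ↦ hb k (Finset.mem_insert_of_mem hk)
    have hpa : ‖∏ k ∈ s, a k‖ ≤ L ^ s.card := by
      rw [norm_prod]
      refine (Finset.prod_le_prod (fun _ _ ↦ norm_nonneg _)
        fun k hk ↦ ha k (Finset.mem_insert_of_mem hk)).trans (by simp)
    rw [Finset.prod_insert hi, Finset.prod_insert hi, Finset.sum_insert hi,
      Finset.card_insert_of_notMem hi]
    have e : a i * ∏ k ∈ s, a k - b i * ∏ k ∈ s, b k =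
        (a i - b i) * ∏ k ∈ s, a k + b i * (∏ k ∈ s, a k - ∏ k ∈ s, b k) := by ring
    rw [e]
    have hbi := hb i (Finset.mem_insert_self i s)
    have hS : 0 ≤ ∑ k ∈ s, ‖a k - b k‖ := Finset.sum_nonneg fun _ _ ↦ norm_nonneg _
    calc _ ≤ ‖a i - b i‖ * L ^ s.card + L * (L ^ s.card * ∑ k ∈ s, ‖a k - b k‖) := by
          refine (norm_add_le _ _).trans ?_
          rw [norm_mul, norm_mul]
          gcongr
      _ ≤ ‖a i - b i‖ * L ^ (s.card + 1) + L ^ (s.card + 1) * ∑ k ∈ s, ‖a k - b k‖ := by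
          refine add_le_add ?_ (le_of_eq (by ring))
          exact mul_le_mul_of_nonneg_left (pow_le_pow_right₀ hL (Nat.le_succ _)) (norm_nonneg _)
      _ = _ := by ring

lemma expect_norm_le_of_expect_norm_sq_le {N : ℕ} [NeZero N] (g : ZMod N → ℂ) {e : ℝ} (he : 0 ≤ e)
    (h : 𝔼 x, ‖g x‖ ^ 2 ≤ e ^ 2) : 𝔼 x, ‖g x‖ ≤ e := by
  refine le_of_pow_le_pow_left₀ (n := 2) (by norm_num) he (le_trans ?_ h)
  have := Finset.expect_mul_sq_le_sq_mul_sq (univ : Finset (ZMod N)) (fun x ↦ ‖g x‖) fun _ ↦ 1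
  simpa using this

lemma mul_factorial_le {r M : ℕ} (hr : 1 ≤ r) (hM : 1 ≤ M) :
    r * (M + r.factorial * M ^ (2 * r) * M) ≤ (2 * r * M) ^ (3 * r) := by
  have h1 : 1 ≤ r.factorial * M ^ (2 * r) :=
    Nat.mul_pos r.factorial_pos (Nat.pow_pos hM)
  calc r * (M + r.factorial * M ^ (2 * r) * M)
      ≤ r * (r.factorial * M ^ (2 * r) * M + r.factorial * M ^ (2 * r) * M) := by
        gcongr
        exact Nat.le_mul_of_pos_left _ h1
    _ = 2 * r * r.factorial * M ^ (2 * r + 1) := by ring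
    _ ≤ 2 * r * (2 * r) ^ r * M ^ (3 * r) := by
        gcongr
        · exact (Nat.factorial_le_pow r).trans (Nat.pow_le_pow_left (by omega) _)
        · omega
    _ = (2 * r) ^ (r + 1) * M ^ (3 * r) := by ring
    _ ≤ (2 * r) ^ (3 * r) * M ^ (3 * r) := by
        gcongr
        · omega
        · omega
    _ = _ := by rw [← mul_pow]

/-- No sign of T, M or θ is assumed: they enter the base with even exponents. -/
lemma chi_nonneg {r k d : ℕ} {C T M γ ε ρ θ : ℝ} (hC : 0 ≤ C) (hγ : 0 ≤ γ) :
    0 ≤ chi r k d C T M γ ε ρ θ := by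
  unfold chi
  refine Real.rpow_nonneg ?_ _
  have hA : (0 : ℝ) ≤ 2 ^ 239 := pow_nonneg zero_le_two _
  generalize (2 : ℝ) ^ 239 = A at *
  refine div_nonneg (mul_nonneg (mul_nonneg (mul_nonneg ?_ (by positivity))
    (Even.pow_nonneg (by decide) _)) (Even.pow_nonneg (by decide) _))
    (mul_nonneg (by positivity) (Even.pow_nonneg (by decide) _))
  positivity

set_option maxHeartbeats 1000000 in
/-- The losses of the argument are absorbed by the constant `chi`. -/
lemma loss_le_chi {r k d : ℕ} (hr : 1 ≤ r) (hk : 1 ≤ k) (hd : 1 ≤ d) {C T M γ ε ρ θ t : ℝ}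
    (hC : 1 ≤ C) (hθ : 0 < θ) (hε : 0 < ε) (hγ : 0 < γ) (hγ1 : γ ≤ 1) (hρ : 0 < ρ) (hρ1 : ρ ≤ 1)
    {m κ : ℕ} (hm : 1 ≤ m) (hmM : (m : ℝ) ≤ M)
    (hκ : κ = r * (m + r.factorial * m ^ (2 * r) * m))
    (hεθ : r * (2 * k * C) ^ r * ε ≤ θ) (hA : 5 * θ < (2 * C) ^ r)
    (hB : 5 * θ < T * (2 * C) ^ (r - 1)) (ht : t = T * (r * k * (2 * C) ^ r) / θ) :
    (2 * C) ^ r * ((11 * t) ^ (8 * t ^ 4)) ^ r * ((κ : ℝ) ^ (r * k * d) / γ ^ r * κ) ≤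
      chi r k d C T M γ ε ρ θ := by
  unfold chi
  have hA₁ : (11 : ℝ) ≤ 2 ^ 239 := by norm_num
  have hA₂ : (20 : ℝ) ≤ 2 ^ 53 := by norm_num
  -- Only the lower bounds 11 and 20 are needed, so the huge numerals are kept opaque.
  generalize (2 : ℝ) ^ 239 = A₁ at *
  generalize (2 : ℝ) ^ 53 = A₂ at *
  have hr' : (1 : ℝ) ≤ r := by exact_mod_cast hr
  have hk' : (1 : ℝ) ≤ k := by exact_mod_cast hk
  have hd' : (1 : ℝ) ≤ d := by exact_mod_cast hd
  have hm' : (1 : ℝ) ≤ m := by exact_mod_cast hm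
  have hT : 0 < T := by
    by_contra hT
    have : T * (2 * C) ^ (r - 1) ≤ 0 :=
      mul_nonpos_of_nonpos_of_nonneg (not_lt.1 hT) (by positivity)
    linarith
  set Z : ℝ := (2 * k * C) ^ r with hZ
  have hZeq : Z = (k : ℝ) ^ r * (2 * C) ^ r := by rw [hZ, ← mul_pow]; ring
  have hkr : (k : ℝ) ≤ (k : ℝ) ^ r := le_self_pow₀ hk' (by omega)
  have hZ2 : (2 * C) ^ r ≤ Z := by
    rw [hZeq]
    exact le_mul_of_one_le_left (by positivity) (one_le_pow₀ hk')
  have hZ0 : 0 < Z := by positivity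
  -- Everything is measured by the ratios X and τ. The hypotheses `hA` and `hB`, which exclude the
  -- trivial cases, give X ≥ 1 and τ ≥ 10C.
  set X : ℝ := Z / θ with hX
  set τ : ℝ := T * Z / θ with hτ
  have hX1 : 1 ≤ X := by
    rw [hX, le_div_iff₀ hθ]; linarith
  have hτC : 10 * C ≤ τ := by
    rw [hτ, le_div_iff₀ hθ]
    have e : (2 * C) ^ r = (2 * C) ^ (r - 1) * (2 * C) := by
      rw [← pow_succ, Nat.sub_add_cancel hr]
    calc 10 * C * θ = 5 * θ * (2 * C) := by ring
      _ ≤ T * (2 * C) ^ (r - 1) * (2 * C) := by gcongr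
      _ = T * (2 * C) ^ r := by rw [e]; ring
      _ ≤ _ := by gcongr
  have hτ1 : 1 ≤ τ := by linarith
  have htτ : t ≤ r * τ := by
    rw [ht, hτ, mul_div_assoc', div_le_div_iff_of_pos_right hθ, hZeq]
    calc T * (r * k * (2 * C) ^ r) = r * (T * (k * (2 * C) ^ r)) := by ring
      _ ≤ _ := by gcongr
  have ht1 : 1 ≤ t := by
    rw [ht, le_div_iff₀ hθ]
    have e : (2 * C) ^ r = (2 * C) ^ (r - 1) * (2 * C) := by
      rw [← pow_succ, Nat.sub_add_cancel hr]
    have hrk : (1 : ℝ) ≤ r * k * (2 * C) := by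
      have : (1 : ℝ) ≤ r * k := one_le_mul_of_one_le_of_one_le hr' hk'
      nlinarith
    calc 1 * θ ≤ T * (2 * C) ^ (r - 1) * 1 := by linarith
      _ ≤ T * (2 * C) ^ (r - 1) * (r * k * (2 * C)) := by gcongr
      _ = _ := by rw [e]; ring
  have hε1 : ε ≤ 1 := by
    have h1 : θ * ε ≤ θ * 1 := by
      calc θ * ε ≤ Z * ε := by gcongr; linarith
        _ ≤ r * Z * ε := by
            gcongr
            exact le_mul_of_one_le_left hZ0.le hr'
        _ ≤ θ * 1 := by linarith
    exact le_of_mul_le_mul_left h1 hθ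
  set b : ℝ := A₁ * (r : ℝ) ^ 59 * (d : ℝ) ^ 6 * 5 ^ (2 * d) * (3 * k * C) ^ (50 * r) *
    T ^ 24 * M ^ 4 / (γ * ε ^ 2 * ρ ^ 2 * θ ^ 50) with hb
  set G : ℝ := (r : ℝ) ^ 22 * (k : ℝ) ^ 2 * (d : ℝ) ^ 4 * X ^ 4 * τ ^ 8 with hG
  have hexp : A₂ * (r : ℝ) ^ 22 * (k : ℝ) ^ 2 * (d : ℝ) ^ 4 * (2 * k * C) ^ (12 * r) * T ^ 8 /
      θ ^ 12 = A₂ * G := by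
    have : (2 * k * C) ^ (12 * r) = Z ^ 12 := by rw [hZ, ← pow_mul, mul_comm r 12]
    rw [this, hG, hX, hτ]
    field_simp
  -- The single product on the left dominates each of 2C, 11t, 2rm and 1/γ, so every loss becomes a
  -- power of the base b.
  have hbb : A₁ * r * m * τ * (1 / γ) ≤ b := by
    have hM1 : (m : ℝ) ≤ M ^ 4 := hmM.trans (le_self_pow₀ (hm'.trans hmM) (by norm_num))
    have h3 : Z ^ 50 ≤ (3 * k * C) ^ (50 * r) := by
      rw [hZ, ← pow_mul, mul_comm r 50]
      gcongr
      norm_num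
    have hTZ : τ * θ ^ 50 ≤ Z ^ 50 * T ^ 24 := by
      have e : Z ^ 50 * T ^ 24 = X ^ 26 * τ ^ 24 * θ ^ 50 := by
        rw [hX, hτ]
        field_simp
      rw [e]
      gcongr
      calc τ ≤ τ ^ 24 := le_self_pow₀ hτ1 (by norm_num)
        _ ≤ X ^ 26 * τ ^ 24 := le_mul_of_one_le_left (by positivity) (one_le_pow₀ hX1)
    rw [hb, le_div_iff₀ (by positivity)]
    calc A₁ * r * m * τ * (1 / γ) * (γ * ε ^ 2 * ρ ^ 2 * θ ^ 50)
        = A₁ * r * (ε ^ 2 * ρ ^ 2) * (τ * θ ^ 50) * m := by field_simp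
      _ ≤ A₁ * (r : ℝ) ^ 59 * 1 * (Z ^ 50 * T ^ 24) * M ^ 4 := by
          gcongr
          · exact le_self_pow₀ hr' (by norm_num)
          · exact mul_le_one₀ (pow_le_one₀ hε.le hε1) (by positivity) (pow_le_one₀ hρ.le hρ1)
      _ = A₁ * (r : ℝ) ^ 59 * 1 * 1 * Z ^ 50 * T ^ 24 * M ^ 4 := by ring
      _ ≤ _ := by
          gcongr
          · exact one_le_pow₀ hd'
          · exact one_le_pow₀ (by norm_num)
  have hγ' : 1 ≤ 1 / γ := (one_le_div hγ).2 hγ1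
  have hrm : (1 : ℝ) ≤ r * m := one_le_mul_of_one_le_of_one_le hr' hm'
  have hmτ : (1 : ℝ) ≤ m * τ := one_le_mul_of_one_le_of_one_le hm' hτ1
  have hlow : ∀ y : ℝ, y ≤ A₁ * (r * m * τ * (1 / γ)) → y ≤ b := fun y hy ↦
    hy.trans (le_trans (le_of_eq (by ring)) hbb)
  have hb2C : 2 * C ≤ b := hlow _ <| by
    have : τ ≤ r * m * τ * (1 / γ) := by
      calc τ = 1 * τ * 1 := by ring
        _ ≤ _ := by gcongr
    nlinarith
  have hb11 : 11 * t ≤ b := hlow _ <| by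
    have : r * τ ≤ r * m * τ * (1 / γ) := by
      calc r * τ = r * 1 * τ * 1 := by ring
        _ ≤ _ := by gcongr
    nlinarith
  have hb2rm : 2 * r * m ≤ b := hlow _ <| by
    have : r * m ≤ r * m * τ * (1 / γ) := by
      calc (r * m : ℝ) = r * m * 1 * 1 := by ring
        _ ≤ _ := by gcongr
    nlinarith
  have hbγ : 1 / γ ≤ b := hlow _ <| by
    have : 1 / γ ≤ r * m * τ * (1 / γ) := by
      calc (1 / γ : ℝ) = 1 * 1 * (1 / γ) := by ring
        _ ≤ _ := by gcongr
    nlinarith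
  have hb1 : 1 ≤ b := hγ'.trans hbγ
  have hb0 : 0 < b := by linarith
  have hκb : (κ : ℝ) ≤ b ^ (3 * r) := by
    calc (κ : ℝ) ≤ (2 * r * m : ℝ) ^ (3 * r) := by
          rw [hκ]; exact_mod_cast mul_factorial_le hr hm
      _ ≤ _ := by gcongr
  have h1 : (2 * C) ^ r ≤ b ^ (r : ℝ) := by
    rw [Real.rpow_natCast]; gcongr
  have h2 : ((11 * t) ^ (8 * t ^ 4)) ^ r ≤ b ^ (8 * ((r : ℝ) ^ 5 * τ ^ 4)) := by
    rw [← Real.rpow_natCast, ← Real.rpow_mul (by positivity)]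
    calc (11 * t) ^ (8 * t ^ 4 * (r : ℝ)) ≤ b ^ (8 * t ^ 4 * (r : ℝ)) := by gcongr
      _ ≤ _ := by
          refine Real.rpow_le_rpow_of_exponent_le hb1 ?_
          calc 8 * t ^ 4 * (r : ℝ) ≤ 8 * (r * τ) ^ 4 * r := by gcongr
            _ = _ := by ring
  have h3 : (κ : ℝ) ^ (r * k * d) / γ ^ r * κ ≤ b ^ (((3 * r) * (r * k * d) + r + 3 * r : ℕ) : ℝ) := by
    rw [Real.rpow_natCast, pow_add, pow_add, pow_mul b (3 * r)]
    gcongr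
    rw [div_eq_mul_one_div, ← one_div_pow]
    gcongr
  have hG1 : (r : ℝ) ≤ G := by
    calc (r : ℝ) ≤ (r : ℝ) ^ 22 := le_self_pow₀ hr' (by norm_num)
      _ = (r : ℝ) ^ 22 * 1 * 1 * 1 * 1 := by ring
      _ ≤ G := by
        rw [hG]
        gcongr <;> exact one_le_pow₀ (by assumption)
  have hG2 : (r : ℝ) ^ 5 * τ ^ 4 ≤ G := by
    calc (r : ℝ) ^ 5 * τ ^ 4 = (r : ℝ) ^ 5 * 1 * 1 * 1 * τ ^ 4 := by ring
      _ ≤ G := by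
        rw [hG]
        gcongr
        · norm_num
        · exact one_le_pow₀ hk'
        · exact one_le_pow₀ hd'
        · exact one_le_pow₀ hX1
        · norm_num
  have hG3 : (r : ℝ) * (r * k * d) ≤ G := by
    calc (r : ℝ) * (r * k * d) = (r : ℝ) ^ 2 * k ^ 1 * d ^ 1 * 1 * 1 := by ring
      _ ≤ G := by
        rw [hG]
        gcongr
        · norm_num
        · norm_num
        · norm_num
        · exact one_le_pow₀ hX1
        · exact one_le_pow₀ hτ1
  rw [hexp]
  calc _ ≤ b ^ (r : ℝ) * b ^ (8 * ((r : ℝ) ^ 5 * τ ^ 4)) *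
        b ^ (((3 * r) * (r * k * d) + r + 3 * r : ℕ) : ℝ) := by gcongr
    _ = b ^ ((r : ℝ) + 8 * ((r : ℝ) ^ 5 * τ ^ 4) +
        (((3 * r) * (r * k * d) + r + 3 * r : ℕ) : ℝ)) := by
        rw [Real.rpow_add hb0, Real.rpow_add hb0]
    _ ≤ _ := by
        -- The exponents are at most G, 8G and 3G + 4G respectively, hence 16G in total, below A₂G.
        refine Real.rpow_le_rpow_of_exponent_le hb1 ?_
        push_cast
        nlinarith

end Conclusion

/-! ### Assembling the decompositions. -/

section Main

variable {N : ℕ} [NeZero N] {r s : ℕ} {k : Fin r → ℕ} {Q U V : ∀ j, Fin (k j) → ZMod N → ℂ}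
  {L : ℝ}

lemma norm_sum_mul_le (hQ : ∀ j i x, ‖Q j i x‖ ≤ 1) (hU : ∀ j, ∑ i, ‖U j i‖ ≤ L)
    (hV : ∀ j i x, ‖V j i x‖ ≤ ‖U j i‖) (j : Fin r) (x : ZMod N) :
    ‖∑ i, Q j i x * V j i x‖ ≤ L := by
  refine (norm_sum_le_of_le _ fun i _ ↦ ?_).trans (hU j)
  rw [norm_mul]
  exact (mul_le_of_le_one_left (norm_nonneg _) (hQ j i x)).trans (hV j i x)

/-- A product of functions, one of which is small in `L¹`. -/
lemma norm_expect_prod_le_of_expect_le {c : Fin r → Fin s → ℤ}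
    (hsurj : ∀ j, Function.Surjective fun x : Fin s → ZMod N ↦ linForm (c j) x)
    {f : Fin r → ZMod N → ℂ} (hf : ∀ j x, ‖f j x‖ ≤ L) (j₀ : Fin r) {T : ℝ}
    (hT : 𝔼 x, ‖f j₀ x‖ ≤ T) :
    ‖𝔼 x : Fin s → ZMod N, ∏ j, f j (linForm (c j) x)‖ ≤ T * L ^ (r - 1) := by
  have hL : 0 ≤ L := (norm_nonneg _).trans (hf j₀ 0)
  calc _ ≤ 𝔼 x : Fin s → ZMod N, ‖∏ j, f j (linForm (c j) x)‖ := norm_expect_le _ _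
    _ ≤ 𝔼 x : Fin s → ZMod N, ‖f j₀ (linForm (c j₀) x)‖ * L ^ (r - 1) := by
        refine Finset.expect_le_expect fun x _ ↦ ?_
        rw [← Finset.mul_prod_erase univ _ (mem_univ j₀), norm_mul]
        refine mul_le_mul_of_nonneg_left ?_ (norm_nonneg _)
        rw [norm_prod]
        refine (Finset.prod_le_prod (fun _ _ ↦ norm_nonneg _) fun j _ ↦ hf j _).trans ?_
        simp
    _ = (𝔼 z, ‖f j₀ z‖) * L ^ (r - 1) := by
        rw [← Finset.expect_mul, expect_comp_linForm (hsurj j₀) fun z ↦ ‖f j₀ z‖]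
    _ ≤ _ := by gcongr

lemma expect_norm_sum_mul_le (hQ : ∀ j i x, ‖Q j i x‖ ≤ 1) (j : Fin r) {e : Fin (k j) → ℝ}
    (he : ∀ i, 𝔼 x, ‖V j i x‖ ≤ e i) : 𝔼 x, ‖∑ i, Q j i x * V j i x‖ ≤ ∑ i, e i := by
  calc 𝔼 x, ‖∑ i, Q j i x * V j i x‖ ≤ 𝔼 x, ∑ i, ‖V j i x‖ := by
        refine Finset.expect_le_expect fun x _ ↦ norm_sum_le_of_le _ fun i _ ↦ ?_
        rw [norm_mul]
        exact mul_le_of_le_one_left (norm_nonneg _) (hQ j i x)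
    _ = ∑ i, 𝔼 x, ‖V j i x‖ := Finset.expect_sum_comm _ _ _
    _ ≤ _ := Finset.sum_le_sum fun i _ ↦ he i

/-- Replacing the functions `U j i` by approximations in `L²`. -/
lemma norm_expect_prod_sub_le {c : Fin r → Fin s → ℤ}
    (hsurj : ∀ j, Function.Surjective fun x : Fin s → ZMod N ↦ linForm (c j) x)
    (hL : 1 ≤ L) (hQ : ∀ j i x, ‖Q j i x‖ ≤ 1) (hU : ∀ j, ∑ i, ‖U j i‖ ≤ L)
    (hV : ∀ j i x, ‖V j i x‖ ≤ ‖U j i‖) {e : ℝ} (he : 0 ≤ e)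
    (hUV : ∀ j i, 𝔼 x, ‖U j i x - V j i x‖ ^ 2 ≤ e ^ 2) {K : ℕ} (hK : ∀ j, k j ≤ K) :
    ‖(𝔼 x : Fin s → ZMod N, ∏ j, ∑ i, Q j i (linForm (c j) x) * U j i (linForm (c j) x)) -
      𝔼 x : Fin s → ZMod N, ∏ j, ∑ i, Q j i (linForm (c j) x) * V j i (linForm (c j) x)‖ ≤
      L ^ r * (r * (K * e)) := by
  rw [← Finset.expect_sub_distrib]
  have hd : ∀ j, 𝔼 z, ‖∑ i, Q j i z * U j i z - ∑ i, Q j i z * V j i z‖ ≤ K * e := by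
    intro j
    have h := expect_norm_sum_mul_le (V := fun j i x ↦ U j i x - V j i x) hQ j (e := fun _ ↦ e)
      fun i ↦ expect_norm_le_of_expect_norm_sq_le _ he (hUV j i)
    simp only [mul_sub, Finset.sum_sub_distrib, Finset.sum_const, Finset.card_univ,
      Fintype.card_fin, nsmul_eq_mul] at h
    refine h.trans ?_
    have : (k j : ℝ) ≤ K := by exact_mod_cast hK j
    gcongr
  calc _ ≤ 𝔼 x : Fin s → ZMod N, L ^ r * ∑ j,
        ‖∑ i, Q j i (linForm (c j) x) * U j i (linForm (c j) x) -
          ∑ i, Q j i (linForm (c j) x) * V j i (linForm (c j) x)‖ := by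
        refine (norm_expect_le _ _).trans (Finset.expect_le_expect fun x _ ↦ ?_)
        refine (norm_prod_sub_prod_le _ _ _ hL
          (fun j _ ↦ norm_sum_mul_le hQ hU (fun j i x ↦ norm_le_pi_norm _ _) j _)
          (fun j _ ↦ norm_sum_mul_le hQ hU hV j _)).trans (le_of_eq ?_)
        simp
    _ = L ^ r * ∑ j, 𝔼 z, ‖∑ i, Q j i z * U j i z - ∑ i, Q j i z * V j i z‖ := by
        rw [← Finset.mul_expect, Finset.expect_sum_comm]
        congr 1
        refine Finset.sum_congr rfl fun j _ ↦ ?_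
        exact expect_comp_linForm (hsurj j)
          fun z ↦ ‖∑ i, Q j i z * U j i z - ∑ i, Q j i z * V j i z‖
    _ ≤ L ^ r * ∑ _j : Fin r, K * e := by
        gcongr with j _
        exact hd j
    _ = _ := by simp

/-- Expanding the product of sums of special quadratic averages of high rank. -/
lemma norm_expect_prod_sum_le {c : Fin r → Fin s → ℤ} {u v : Fin r → Fin s} {n : Fin r → ℤ}
    {D κ : ℕ} {j₀ : Fin r} {P : Fin r → Finset (ZMod N)} {Y : Finset (ZMod N)}
    (h : IsLocalDomain c u v n D κ j₀ P Y) (hY : Y.Nonempty)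
    (hsurj : ∀ j, Function.Surjective fun x : Fin s → ZMod N ↦ linForm (c j) x)
    {B : ∀ j, Fin (k j) → Finset (ZMod N)} {q : ∀ j, Fin (k j) → ZMod N → ZMod N}
    {ε : ℝ} (hε : 0 ≤ ε) {m : Fin r → ℕ}
    (hQ : ∀ j i, IsSpecialQuadraticAverage ε (m j) (B j i) (q j i) (Q j i))
    (hPB2 : ∀ j i, ∀ a ∈ P j, ∀ a' ∈ P j, ∀ b ∈ P j, ∀ b' ∈ P j, a + b - a' - b' ∈ B j i)
    {R : ℝ} (hR : ∀ i, R ≤ rank (P j₀) (q j₀ i)) (hU : ∀ j, ∑ i, ‖U j i‖ ≤ L)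
    (hV : ∀ j i x, ‖V j i x‖ ≤ ‖U j i‖) {w : ℝ} (hw : 0 ≤ w)
    (hW : ∀ j i, ∑ ξ, ‖fourierCoef (V j i) ξ‖ ≤ ‖U j i‖ * w) :
    ‖𝔼 x : Fin s → ZMod N, ∏ j, ∑ i, Q j i (linForm (c j) x) * V j i (linForm (c j) x)‖ ≤
      r * ε * L ^ r +
        L ^ r * w ^ r * (N / Y.card * D * Real.exp (-R / (4 * (r : ℝ) ^ 3))) := by
  set η : ℝ := N / Y.card * D * Real.exp (-R / (4 * (r : ℝ) ^ 3)) with hη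
  have hη0 : 0 ≤ η := by positivity
  have hexp : 𝔼 x : Fin s → ZMod N, ∏ j, ∑ i, Q j i (linForm (c j) x) * V j i (linForm (c j) x) =
      ∑ I : ∀ j, Fin (k j), 𝔼 x : Fin s → ZMod N,
        ∏ j, (Q j (I j) (linForm (c j) x) * V j (I j) (linForm (c j) x)) := by
    rw [← Finset.expect_sum_comm]
    refine Finset.expect_congr rfl fun x _ ↦ ?_
    rw [Finset.prod_univ_sum, Fintype.piFinset_univ]
  have hprod : ∑ I : ∀ j, Fin (k j), ∏ j, ‖U j (I j)‖ ≤ L ^ r := by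
    have := Finset.prod_univ_sum (fun j ↦ (univ : Finset (Fin (k j)))) fun j i ↦ ‖U j i‖
    rw [Fintype.piFinset_univ] at this
    rw [← this]
    refine (Finset.prod_le_prod (fun _ _ ↦ Finset.sum_nonneg fun _ _ ↦ norm_nonneg _)
      fun j _ ↦ hU j).trans ?_
    simp
  rw [hexp]
  calc _ ≤ ∑ I : ∀ j, Fin (k j),
        (r * ε * ∏ j, ‖U j (I j)‖ + (∏ j, ‖U j (I j)‖ * w) * η) :=
        norm_sum_le_of_le _ fun I _ ↦ norm_expect_special_le h hY hsurj (fun j ↦ hQ j (I j))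
          (fun j ↦ hPB2 j (I j)) (hR (I j₀)) (fun j ↦ hV j (I j)) fun j ↦ hW j (I j)
    _ = (r * ε + w ^ r * η) * ∑ I : ∀ j, Fin (k j), ∏ j, ‖U j (I j)‖ := by
        rw [Finset.mul_sum]
        refine Finset.sum_congr rfl fun I _ ↦ ?_
        rw [Finset.prod_mul_distrib]
        simp
        ring
    _ ≤ (r * ε + w ^ r * η) * L ^ r := by gcongr
    _ = _ := by ring

/-- The density of the local domain. -/
lemma div_card_le {P : Fin r → Finset (ZMod N)} {Y : Finset (ZMod N)} (hY : Y.Nonempty) {κ K : ℕ}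
    (hκ : 1 ≤ κ) {d : Fin r → ℕ} (hd : ∑ j, d j ≤ K)
    (h : N * ∏ j, (P j).card ≤ κ ^ (∑ j, d j) * (N ^ r * Y.card)) {γ : ℝ} (hγ : 0 < γ)
    (hPγ : ∀ j, γ ≤ (P j).card / N) : (N : ℝ) / Y.card ≤ (κ : ℝ) ^ K / γ ^ r := by
  have hN : (0 : ℝ) < N := by exact_mod_cast NeZero.pos N
  have hYc : (0 : ℝ) < Y.card := by exact_mod_cast hY.card_pos
  have h' : (N : ℝ) * ∏ j, ((P j).card : ℝ) ≤ (κ : ℝ) ^ (∑ j, d j) * ((N : ℝ) ^ r * Y.card) := by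
    exact_mod_cast h
  have h1 : (γ * N) ^ r ≤ ∏ j, ((P j).card : ℝ) := by
    have := Finset.prod_le_prod (s := (univ : Finset (Fin r))) (f := fun _ ↦ γ * N)
      (g := fun j ↦ ((P j).card : ℝ)) (fun _ _ ↦ by positivity)
      fun j _ ↦ (le_div_iff₀ hN).1 (hPγ j)
    simpa using this
  have hκ' : (1 : ℝ) ≤ κ := by exact_mod_cast hκ
  rw [div_le_div_iff₀ hYc (by positivity)]
  refine le_of_mul_le_mul_left ?_ (show (0 : ℝ) < (N : ℝ) ^ r by positivity)
  calc (N : ℝ) ^ r * (N * γ ^ r) = N * (γ * N) ^ r := by rw [mul_pow]; ring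
    _ ≤ N * ∏ j, ((P j).card : ℝ) := by gcongr
    _ ≤ (κ : ℝ) ^ (∑ j, d j) * ((N : ℝ) ^ r * Y.card) := h'
    _ ≤ (κ : ℝ) ^ K * ((N : ℝ) ^ r * Y.card) := by gcongr
    _ = _ := by ring

end Main

end QuadAvg

theorem mainTheorem6
    (N : ℕ) [NeZero N] (r s : ℕ) (hr : 0 < r) (ε θ : ℝ) (hε : 0 < ε) (hθ : 0 < θ)
    -- the parameters of the `r` decompositions
    (k d m d' : Fin r → ℕ) (C T R ρ ε' γ' : Fin r → ℝ)
    (hd : ∀ j, 1 ≤ d j) (hC : ∀ j, 1 ≤ C j)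
    (hρ : ∀ j, 0 < ρ j ∧ ρ j ≤ 1) (hε' : ∀ j, 0 < ε' j)
    -- the special quadratic averages `Q j i` with bases `(B j i, q j i)`
    (B : ∀ j, Fin (k j) → Finset (ZMod N)) (q : ∀ j, Fin (k j) → ZMod N → ZMod N)
    (Q : ∀ j, Fin (k j) → ZMod N → ℂ)
    (hQ : ∀ j i, QuadAvg.IsSpecialQuadraticAverage ε (m j) (B j i) (q j i) (Q j i))
    (hB : ∀ j i, QuadAvg.ComplexityAtMost (B j i) (d j)
      (ε' j * ρ j / (800 * d j * 5 ^ d j)))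
    -- the progressions, and the rank
    (P : Fin r → Finset (ZMod N)) (hP : ∀ j, QuadAvg.IsGAP (P j) (d' j))
    (hd' : ∀ j, d' j ≤ k j * d j)
    (hγ' : ∀ j, ((P j).card : ℝ) / N = γ' j)
    (hPB : ∀ j i, P j ⊆ B j i)
    (hPB2 : ∀ j i, ∀ a ∈ P j, ∀ a' ∈ P j, ∀ b ∈ P j, ∀ b' ∈ P j, a + b - a' - b' ∈ B j i)
    (hR : ∀ j i, R j ≤ QuadAvg.rank (P j) (q j i))
    -- the coefficient functions
    (U : ∀ j, Fin (k j) → ZMod N → ℂ)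
    (hU : ∀ j, ∑ i, ‖U j i‖ ≤ 2 * C j)
    (hU2 : ∀ j, ∑ i, QuadAvg.u2DualNorm (U j i) ≤ T j)
    (f : Fin r → ZMod N → ℂ) (hf : ∀ j x, f j x = ∑ i, Q j i x * U j i x)
    (hεθ : r * (2 * (Finset.univ.sup k : ℕ) * ⨆ j, C j) ^ r * ε ≤ θ)
    -- the linear forms
    (c : Fin r → Fin s → ℤ) (hc : QuadAvg.SquareIndependent c)
    (hsurj : ∀ j, Function.Surjective fun x : Fin s → ZMod N ↦ QuadAvg.linForm (c j) x) :
    ‖𝔼 x : Fin s → ZMod N, ∏ j, f j (QuadAvg.linForm (c j) x)‖ ≤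
      5 * θ + QuadAvg.chi r (Finset.univ.sup k) (Finset.univ.sup d) (⨆ j, C j) (⨆ j, T j)
          (⨆ j, ∑ u, |(c j u : ℝ)|) (⨅ j, γ' j) ε (⨅ j, ρ j) θ *
        Real.exp (-(⨅ j, R j) / (4 * (r : ℝ) ^ 3)) := by
  -- Any index would serve: high rank is needed for one form only.
  let j₀ : Fin r := ⟨0, hr⟩
  have hne : Nonempty (Fin r) := ⟨j₀⟩
  have hN : (0 : ℝ) < N := by exact_mod_cast NeZero.pos N
  have hCC : ∀ j, C j ≤ ⨆ j, C j := le_ciSup (Set.finite_range C).bddAbove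
  have hTT : ∀ j, T j ≤ ⨆ j, T j := le_ciSup (Set.finite_range T).bddAbove
  have hRR : ∀ j, ⨅ j, R j ≤ R j := ciInf_le (Set.finite_range R).bddBelow
  have hγγ : ∀ j, ⨅ j, γ' j ≤ γ' j := ciInf_le (Set.finite_range γ').bddBelow
  have hMM : ∀ j, ∑ u, |(c j u : ℝ)| ≤ ⨆ j, ∑ u, |(c j u : ℝ)| :=
    le_ciSup (Set.finite_range fun j ↦ ∑ u, |(c j u : ℝ)|).bddAbove
  obtain ⟨jγ, hjγ⟩ := exists_eq_ciInf_of_finite (f := γ')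
  obtain ⟨jρ, hjρ⟩ := exists_eq_ciInf_of_finite (f := ρ)
  have hγ0 : 0 < ⨅ j, γ' j := by
    rw [← hjγ, ← hγ' jγ]
    have : (0 : ℝ) < (P jγ).card := by exact_mod_cast (hP jγ).nonempty.card_pos
    positivity
  have hγ1 : ⨅ j, γ' j ≤ 1 := by
    rw [← hjγ, ← hγ' jγ]
    refine div_le_one_of_le₀ ?_ hN.le
    have := Finset.card_le_univ (P jγ)
    rw [ZMod.card] at this
    exact_mod_cast this
  have hρ0 : 0 < ⨅ j, ρ j := by rw [← hjρ]; exact (hρ jρ).1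
  have hρ1 : ⨅ j, ρ j ≤ 1 := by rw [← hjρ]; exact (hρ jρ).2
  have hC1 : 1 ≤ ⨆ j, C j := (hC j₀).trans (hCC j₀)
  set CC := ⨆ j, C j with hCCdef
  set TT := ⨆ j, T j with hTTdef
  set K := Finset.univ.sup k with hKdef
  set γ := ⨅ j, γ' j with hγdef
  have hχ : 0 ≤ QuadAvg.chi r K (Finset.univ.sup d) CC TT (⨆ j, ∑ u, |(c j u : ℝ)|) γ ε
      (⨅ j, ρ j) θ * Real.exp (-(⨅ j, R j) / (4 * (r : ℝ) ^ 3)) :=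
    mul_nonneg (QuadAvg.chi_nonneg (by linarith) hγ0.le) (Real.exp_pos _).le
  have hkK : ∀ j, k j ≤ K := fun j ↦ Finset.le_sup (Finset.mem_univ j)
  have hQ1 : ∀ j i x, ‖Q j i x‖ ≤ 1 := fun j i ↦ (hQ j i).1.norm_le_one
  have hUL : ∀ j, ∑ i, ‖U j i‖ ≤ 2 * CC := fun j ↦ (hU j).trans (by linarith [hCC j])
  have hfL : ∀ j x, ‖f j x‖ ≤ 2 * CC := fun j x ↦ by
    rw [hf]
    exact QuadAvg.norm_sum_mul_le hQ1 hUL (fun j i x ↦ norm_le_pi_norm _ _) j x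
  have hUT : ∀ j i, QuadAvg.u2DualNorm (U j i) ≤ TT := fun j i ↦
    (Finset.single_le_sum (f := fun i ↦ QuadAvg.u2DualNorm (U j i))
      (fun _ _ ↦ QuadAvg.u2DualNorm_nonneg _) (Finset.mem_univ i)).trans ((hU2 j).trans (hTT j))
  -- the trivial cases
  rcases le_or_gt ((2 * CC) ^ r) (5 * θ) with hA | hA
  · have h1 : ‖𝔼 x : Fin s → ZMod N, ∏ j, f j (QuadAvg.linForm (c j) x)‖ ≤ (2 * CC) ^ r := by
      refine QuadAvg.norm_expect_le_of_le (by positivity) fun x _ ↦ ?_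
      rw [norm_prod]
      refine (Finset.prod_le_prod (fun _ _ ↦ norm_nonneg _) fun j _ ↦ hfL j _).trans ?_
      simp
    linarith
  -- The L¹ norm of f j₀ is at most the sum of the L² norms of the U j₀ i, hence at most T; the
  -- other factors are bounded by 2C.
  rcases le_or_gt (TT * (2 * CC) ^ (r - 1)) (5 * θ) with hB' | hB'
  · have h1 := QuadAvg.norm_expect_prod_le_of_expect_le hsurj hfL j₀ (T := TT) (by
      simp only [hf]
      refine (QuadAvg.expect_norm_sum_mul_le hQ1 j₀ (e := fun i ↦ QuadAvg.u2DualNorm (U j₀ i))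
        fun i ↦ QuadAvg.expect_norm_le_of_expect_norm_sq_le _ (QuadAvg.u2DualNorm_nonneg _)
          (QuadAvg.expect_norm_sq_le _)).trans ((hU2 j₀).trans (hTT j₀)))
    linarith
  rcases Nat.eq_zero_or_pos K with hK0 | hK0
  · have : ∀ j x, f j x = 0 := fun j x ↦ by
      have hk0 : k j = 0 := by have := hkK j; omega
      rw [hf]
      refine Finset.sum_eq_zero fun i _ ↦ ?_
      exact absurd i.2 (by omega)
    simp only [this, Finset.prod_const, Finset.card_univ, Fintype.card_fin, zero_pow hr.ne',
      Finset.expect_const_zero, norm_zero]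
    linarith
  have hd1 : 1 ≤ Finset.univ.sup d := (hd j₀).trans (Finset.le_sup (Finset.mem_univ j₀))
  -- the coefficients of the forms
  set M := Finset.univ.sup fun j ↦ ∑ u, (c j u).natAbs with hMdef
  have hM : ∀ j, ∑ u, |c j u| ≤ (M : ℤ) := fun j ↦ by
    have := Finset.le_sup (f := fun j ↦ ∑ u, (c j u).natAbs) (Finset.mem_univ j)
    have e : ∑ u, |c j u| = ((∑ u, (c j u).natAbs : ℕ) : ℤ) := by push_cast; rfl
    rw [e]
    exact_mod_cast this
  have hM1 : 1 ≤ M := by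
    by_contra hM0
    have h0 : ∀ u, c j₀ u = 0 := fun u ↦ by
      have h1 := hM j₀
      rw [Nat.lt_one_iff.1 (not_le.1 hM0)] at h1
      have h2 := (Finset.single_le_sum (f := fun u ↦ |c j₀ u|) (fun _ _ ↦ abs_nonneg _)
        (Finset.mem_univ u)).trans h1
      exact abs_nonpos_iff.1 (by simpa using h2)
    refine hc.linearIndependent.ne_zero j₀ ?_
    funext p
    simp [h0]
  have hMle : (M : ℝ) ≤ ⨆ j, ∑ u, |(c j u : ℝ)| := by
    obtain ⟨j, -, hj⟩ := Finset.exists_mem_eq_sup Finset.univ Finset.univ_nonempty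
      fun j ↦ ∑ u, (c j u).natAbs
    refine le_trans (le_of_eq ?_) (hMM j)
    rw [hMdef, hj]
    push_cast
    simp only [Nat.cast_natAbs, Int.cast_abs]
  obtain ⟨u, v, n, D, Y, hdom, hY, hYcard⟩ := QuadAvg.exists_isLocalDomain hc hM hM1 j₀ hP rfl
  set κ := r * (M + r.factorial * M ^ (2 * r) * M) with hκ
  have hκ1 : 1 ≤ κ := hdom.D_pos.trans_le hdom.D_le
  -- the approximation of the coefficient functions
  have hr' : (1 : ℝ) ≤ r := by exact_mod_cast hr
  have hK' : (1 : ℝ) ≤ K := by exact_mod_cast hK0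
  -- Chosen so that the total replacement error (2C)^r · r · K e is exactly θ.
  set e : ℝ := θ / (r * K * (2 * CC) ^ r) with he
  have he0 : 0 < e := by positivity
  have hTpos : 0 < TT := by
    by_contra hT
    have : TT * (2 * CC) ^ (r - 1) ≤ 0 :=
      mul_nonpos_of_nonpos_of_nonneg (not_lt.1 hT) (by positivity)
    linarith
  have heT : e ≤ TT := by
    rw [he, div_le_iff₀ (by positivity)]
    calc θ ≤ TT * (2 * CC) ^ (r - 1) := by linarith
      _ ≤ TT * (2 * CC) ^ r := by
          gcongr
          · linarith
          · omega
      _ ≤ TT * (r * K * (2 * CC) ^ r) := by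
          gcongr
          exact le_mul_of_one_le_left (by positivity) (one_le_mul_of_one_le_of_one_le hr' hK')
  choose V hV hUV hW using fun j i ↦
    QuadAvg.exists_truncation (U j i) (hUT j i) he0 heT (norm_le_pi_norm (U j i))
  have hte : TT / e = TT * (r * K * (2 * CC) ^ r) / θ := by rw [he]; field_simp
  rw [hte] at hW
  set t : ℝ := TT * (r * K * (2 * CC) ^ r) / θ with ht
  have ht0 : 0 < t := by positivity
  have step1 := QuadAvg.norm_expect_prod_sub_le hsurj (by linarith) hQ1 hUL hV he0.le hUV hkK
  have step2 := QuadAvg.norm_expect_prod_sum_le hdom hY hsurj hε.le hQ hPB2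
    (fun i ↦ (hRR j₀).trans (hR j₀ i)) hUL hV (w := (11 * t) ^ (8 * t ^ 4)) (by positivity) hW
  have hKe : (2 * CC) ^ r * (r * (K * e)) = θ := by rw [he]; field_simp
  have hbad : r * ε * (2 * CC) ^ r ≤ θ := by
    calc r * ε * (2 * CC) ^ r ≤ r * ε * (2 * K * CC) ^ r := by
          gcongr
          linarith
      _ = r * (2 * K * CC) ^ r * ε := by ring
      _ ≤ θ := hεθ
  have hdsum : ∑ j, d' j ≤ r * K * Finset.univ.sup d := by
    calc ∑ j, d' j ≤ ∑ _j : Fin r, K * Finset.univ.sup d :=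
          Finset.sum_le_sum fun j _ ↦ (hd' j).trans
            (Nat.mul_le_mul (hkK j) (Finset.le_sup (Finset.mem_univ j)))
      _ = _ := by simp [mul_assoc]
  have hdens := QuadAvg.div_card_le hY hκ1 hdsum hYcard hγ0 fun j ↦ by
    rw [hγ' j]; exact hγγ j
  have hloss := QuadAvg.loss_le_chi (t := t) hr hK0 hd1 hC1 hθ hε hγ0 hγ1 hρ0 hρ1 hM1 hMle hκ hεθ
    hA hB' ht
  have hDκ : (D : ℝ) ≤ κ := by exact_mod_cast hdom.D_le
  have hlast : (2 * CC) ^ r * ((11 * t) ^ (8 * t ^ 4)) ^ r *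
      (N / Y.card * D * Real.exp (-(⨅ j, R j) / (4 * (r : ℝ) ^ 3))) ≤
      QuadAvg.chi r K (Finset.univ.sup d) CC TT (⨆ j, ∑ u, |(c j u : ℝ)|) γ ε
        (⨅ j, ρ j) θ * Real.exp (-(⨅ j, R j) / (4 * (r : ℝ) ^ 3)) := by
    rw [← mul_assoc]
    refine mul_le_mul_of_nonneg_right (le_trans ?_ hloss) (Real.exp_pos _).le
    gcongr
  have hfun : 𝔼 x : Fin s → ZMod N, ∏ j, f j (QuadAvg.linForm (c j) x) =
      𝔼 x : Fin s → ZMod N, ∏ j, ∑ i, Q j i (QuadAvg.linForm (c j) x) *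
        U j i (QuadAvg.linForm (c j) x) := by simp only [hf]
  rw [hfun]
  -- Replacing U by V costs θ and the exceptional points cost θ, so 2θ of the allowed 5θ is used.
  have htri := norm_add_le
    ((𝔼 x : Fin s → ZMod N, ∏ j, ∑ i, Q j i (QuadAvg.linForm (c j) x) *
      U j i (QuadAvg.linForm (c j) x)) - 𝔼 x : Fin s → ZMod N, ∏ j, ∑ i,
        Q j i (QuadAvg.linForm (c j) x) * V j i (QuadAvg.linForm (c j) x))
    (𝔼 x : Fin s → ZMod N, ∏ j, ∑ i,
        Q j i (QuadAvg.linForm (c j) x) * V j i (QuadAvg.linForm (c j) x))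
  rw [sub_add_cancel] at htri
  linarith
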